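/- Let $\mathfrak g=\mathfrak g_0\oplus\mathfrak g_1$ be a super Lie algebra over $\mathbb C$ (of arbitrary dimension) and let $\delta:\mathfrak g\to\mathbb C$ be a character, i.e. an even linear map ($\delta(\mathfrak g_1)=0$) with $\delta([x,y])=0$ for all $x,y$. Write $|x|\in\mathbb Z/2$ for the parity of a homogeneous element $x$. Let $U(\mathfrak g)=T(\mathfrak g)/(x\otimes y-(-1)^{|x||y|}y\otimes x-[x,y])$ be the enveloping algebra. It is a super Hopf algebra with $\Delta x=x\otimes1+1\otimes x$, $\varepsilon(x)=0$, $S(x)=-x$ for $x\in\mathfrak g$; extend $\delta$ to an algebra map $U(\mathfrak g)\to\mathbb C$ and put $\widetilde S=(\delta\otimes S)\Delta$. The pair $(\delta,1)$ is a super modular pair in involution. On $C^n=U(\mathfrak g)^{\otimes n}$, $n\ge0$ ($C^0=\mathbb C$), consider the cofaces $\delta_0(h_1,\dots,h_n)=(1,h_1,\dots,h_n)$, $\delta_i=$ ($\Delta$ applied to $h_i$) for $1\le i\le n$, $\delta_{n+1}(h_1,\dots,h_n)=(h_1,\dots,h_n,1)$; the codegeneracies $\sigma_i:C^{n+1}\to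 C^n$, $0\le i\le n$, which apply $\varepsilon$ to $h_{i+1}$; and the cyclic operators $\tau_0=\mathrm{id}$, $\tau_n(h_1,\dots,h_n)=\widetilde S(h_1)\cdot(h_2,\dots,h_n,1)$, where $h\cdot(c_1,\dots,c_n)=\pm(h^{(1)}c_1,\dots,h^{(n)}c_n)$ with the Koszul sign. Put $\lambda_n=(-1)^n\tau_n$, $b=\sum_{i=0}^{n+1}(-1)^i\delta_i:C^n\to C^{n+1}$ and $B=\bigl(\sum_{k=0}^{n}\lambda_n^k\bigr)\,\sigma_n\tau_{n+1}(1-\lambda_{n+1}):C^{n+1}\to C^n$ (with $B=0$ on $C^0$). The periodic Hopf cyclic cohomology $HP^p_{(\delta,1)}(U(\mathfrak g))$, $p\in\mathbb Z/2$, is the cohomology of the $\mathbb Z/2$-graded complex with terms $\bigoplus_{n\equiv p\bmod 2}C^n$ and differential $b+B$. Let $\bigwedge\mathfrak g=T(\mathfrak g)/(x\otimes y+(-1)^{|x||y|}y\otimes x)$, with $\bigwedge^n\mathfrak g$ the image of $\mathfrak g^{\otimes n}$. For homogeneous $x_1,\dots,x_n$ put $\alpha_i=|x_i|(|x_1|+\dots+|x_{i-1}|)$.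 The homology $H_i(\mathfrak g;\mathbb C_\delta)$ is the homology in degree $i$ of the complex $(\bigwedge^\bullet\mathfrak g,d)$, $$d(x_1\wedge\dots\wedge x_n)=\sum_{i}(-1)^{i+1+\alpha_i}\delta(x_i)\,x_1\wedge\cdots\widehat{x_i}\cdots\wedge x_n+\sum_{i<j}(-1)^{i+j+\alpha_i+\alpha_j-|x_i||x_j|}[x_i,x_j]\wedge x_1\wedge\cdots\widehat{x_i}\cdots\widehat{x_j}\cdots\wedge x_n .$$ The antisymmetrization map $A:\bigwedge^n\mathfrak g\to U(\mathfrak g)^{\otimes n}$ is $$A(x_1\wedge\dots\wedge x_n)=\frac1{n!}\sum_{\sigma\in S_n}(-1)^{\alpha_\sigma}\operatorname{sign}(\sigma)\,(x_{\sigma(1)},\dots,x_{\sigma(n)}),$$ where $\alpha_\sigma$ is the sum of $|x_i||x_j|$ over all pairs $i<j$ whose order is reversed by the rearrangement $x_{\sigma(1)},\dots,x_{\sigma(n)}$. **Theorem.** One has $d^2=0$, $(b+B)^2=0$, $bA=0$ and $BA=Ad$, and for each $p\in\mathbb Z/2$ the map $A$ induces a linear isomorphism $$\bigoplus_{i\ge0,\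 i\equiv p\bmod 2}H_i(\mathfrak g;\mathbb C_\delta)\;\xrightarrow{\ \cong\ }\;HP^p_{(\delta,1)}(U(\mathfrak g)),\qquad [z]\mapsto[A(z)]\quad(z\in\textstyle\bigwedge^i\mathfrak g,\ dz=0).$$ -/

import Mathlib

open scoped TensorProduct DirectSum

noncomputable section

set_option linter.unusedSectionVars false

namespace SuperHopf

universe u v

/-- The Koszul sign `(-1)^{ij}` of two parities. -/
def koszul (i j : ZMod 2) : ℂ := (-1) ^ (i.val * j.val)

theorem parity_cases (i : ZMod 2) : i = 0 ∨ i = 1 := by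
  revert i; decide

theorem koszul_zero_left (j : ZMod 2) : koszul 0 j = 1 := by simp [koszul]

theorem koszul_zero_right (j : ZMod 2) : koszul j 0 = 1 := by simp [koszul]

theorem koszul_one_one : koszul 1 1 = -1 := by
  simp [koszul, show ZMod.val (1 : ZMod 2) = 1 from rfl]

theorem koszul_mul_self (i j : ZMod 2) : koszul i j * koszul i j = 1 := by
  rcases parity_cases i with rfl | rfl <;> rcases parity_cases j with rfl | rfl <;>
    simp [koszul_zero_left, koszul_zero_right, koszul_one_one]

theorem koszul_comm (i j : ZMod 2) : koszul i j = koszul j i := by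
  simp [koszul, mul_comm]

theorem koszul_add_right (i j k : ZMod 2) : koszul i (j + k) = koszul i j * koszul i k := by
  have h2 : (1 + 1 : ZMod 2) = 0 := rfl
  rcases parity_cases i with rfl | rfl <;> rcases parity_cases j with rfl | rfl <;>
    rcases parity_cases k with rfl | rfl <;>
    simp [koszul_zero_left, koszul_zero_right, koszul_one_one, h2]

theorem koszul_add_left (i j k : ZMod 2) : koszul (i + j) k = koszul i k * koszul j k := by
  rw [koszul_comm, koszul_add_right, koszul_comm k i, koszul_comm k j]

theorem units_smul_eq_koszul_smul {M : Type*} [AddCommGroup M] [Module ℂ M] (i j : ZMod 2)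
    (m : M) : ((-1 : ℤˣ) ^ (i * j)) • m = koszul i j • m := by
  rcases parity_cases i with rfl | rfl <;> rcases parity_cases j with rfl | rfl <;>
    simp [koszul_zero_left, koszul_zero_right, koszul_one_one]

/-! ### Super vector spaces -/

section SuperVectorSpace

variable {V : Type*} [AddCommGroup V] [Module ℂ V] (𝒱 : ZMod 2 → Submodule ℂ V)
  [DirectSum.Decomposition 𝒱]

/-- The projection of a super vector space onto its part of parity `i`. -/
def homProj (i : ZMod 2) : V →ₗ[ℂ] V :=
  (𝒱 i).subtype ∘ₗ DirectSum.component ℂ (ZMod 2) (fun k => 𝒱 k) i ∘ₗ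
    (DirectSum.decomposeLinearEquiv 𝒱).toLinearMap

/-- The operator `v ↦ (-1)^{i|v|} v`. -/
def twist (i : ZMod 2) : V →ₗ[ℂ] V := ∑ j : ZMod 2, koszul i j • homProj 𝒱 j

theorem homProj_mem (i : ZMod 2) (v : V) : homProj 𝒱 i v ∈ 𝒱 i := by
  simp [homProj]

theorem homProj_of_mem {i : ZMod 2} {v : V} (hv : v ∈ 𝒱 i) (j : ZMod 2) :
    homProj 𝒱 j v = if i = j then v else 0 := by
  simp only [homProj, LinearMap.comp_apply, LinearEquiv.coe_coe,
    DirectSum.decomposeLinearEquiv_apply, Submodule.subtype_apply,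
    DirectSum.decompose_of_mem 𝒱 hv]
  change ((DirectSum.of (fun k => 𝒱 k) i ⟨v, hv⟩ j : 𝒱 j) : V) = _
  rw [DirectSum.coe_of_apply]
  split_ifs <;> rfl

theorem sum_homProj (v : V) : ∑ i : ZMod 2, homProj 𝒱 i v = v := by
  classical
  have h := DirectSum.sum_support_decompose 𝒱 v
  rw [Finset.sum_subset (Finset.subset_univ _)] at h
  · exact h
  · intro i _ hi
    simpa using hi

theorem twist_of_mem {i : ZMod 2} {v : V} (hv : v ∈ 𝒱 i) (j : ZMod 2) :
    twist 𝒱 j v = koszul j i • v := by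
  simp [twist, homProj_of_mem 𝒱 hv]

theorem twist_zero (v : V) : twist 𝒱 0 v = v := by
  simp only [twist, koszul_zero_left, one_smul, LinearMap.sum_apply]
  exact sum_homProj 𝒱 v

theorem twist_twist (i : ZMod 2) (v : V) : twist 𝒱 i (twist 𝒱 i v) = v := by
  have h : twist 𝒱 i (twist 𝒱 i v) = ∑ j : ZMod 2, homProj 𝒱 j v := by
    conv_lhs => rw [← sum_homProj 𝒱 v]
    simp only [map_sum]
    refine Finset.sum_congr rfl fun j _ => ?_
    rw [twist_of_mem 𝒱 (homProj_mem 𝒱 j v), map_smul, twist_of_mem 𝒱 (homProj_mem 𝒱 j v),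
      smul_smul, koszul_mul_self, one_smul]
  rw [h, sum_homProj]

theorem twist_comm (i j : ZMod 2) (v : V) :
    twist 𝒱 i (twist 𝒱 j v) = twist 𝒱 j (twist 𝒱 i v) := by
  rcases parity_cases i with rfl | rfl <;> rcases parity_cases j with rfl | rfl <;>
    simp only [twist_zero]

theorem hom_induction {P : V → Prop} (v : V) (hadd : ∀ x y, P x → P y → P (x + y))
    (hom : ∀ i, ∀ x ∈ 𝒱 i, P x) : P v := by
  rw [← sum_homProj 𝒱 v]
  have : (Finset.univ : Finset (ZMod 2)) = {0, 1} := rfl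
  rw [this, Finset.sum_pair (by decide)]
  exact hadd _ _ (hom 0 _ (homProj_mem 𝒱 0 v)) (hom 1 _ (homProj_mem 𝒱 1 v))

theorem linearMap_ext_hom {W : Type*} [AddCommGroup W] [Module ℂ W] {f g : V →ₗ[ℂ] W}
    (h : ∀ i, ∀ x ∈ 𝒱 i, f x = g x) : f = g := by
  ext v
  exact hom_induction 𝒱 v (fun x y hx hy => by rw [map_add, map_add, hx, hy]) h

end SuperVectorSpace

/-- A super Lie algebra structure on the complex super vector space `𝔤 = 𝒢 0 ⊕ 𝒢 1`. -/
structure SuperLieAlgebra {𝔤 : Type u} [AddCommGroup 𝔤] [Module ℂ 𝔤]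
    (𝒢 : ZMod 2 → Submodule ℂ 𝔤) where
  bracket : 𝔤 →ₗ[ℂ] 𝔤 →ₗ[ℂ] 𝔤
  bracket_mem : ∀ {i j : ZMod 2} {x y : 𝔤}, x ∈ 𝒢 i → y ∈ 𝒢 j → bracket x y ∈ 𝒢 (i + j)
  skew : ∀ {i j : ZMod 2} {x y : 𝔤}, x ∈ 𝒢 i → y ∈ 𝒢 j →
    bracket x y = -(koszul i j • bracket y x)
  jacobi : ∀ {i j k : ZMod 2} {x y z : 𝔤}, x ∈ 𝒢 i → y ∈ 𝒢 j → z ∈ 𝒢 k →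
    bracket x (bracket y z) = bracket (bracket x y) z + koszul i j • bracket y (bracket x z)

/-- The eigenspaces of an involutive automorphism `γ`: `a` has parity `i` iff `γ a = (-1)^i a`. -/
def eigenGrading {A : Type*} [Ring A] [Algebra ℂ A] (γ : A →ₐ[ℂ] A) (i : ZMod 2) :
    Submodule ℂ A :=
  LinearMap.ker (γ.toLinearMap - koszul 1 i • LinearMap.id)

theorem mem_eigenGrading {A : Type*} [Ring A] [Algebra ℂ A] (γ : A →ₐ[ℂ] A) (i : ZMod 2) (a : A) :
    a ∈ eigenGrading γ i ↔ γ a = koszul 1 i • a := by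
  simp [eigenGrading, sub_eq_zero]

/-- An involutive automorphism of a complex algebra makes it a super algebra. -/
@[reducible] def eigenGradedAlgebra {A : Type*} [Ring A] [Algebra ℂ A] (γ : A →ₐ[ℂ] A)
    (hγ : ∀ a, γ (γ a) = a) : GradedAlgebra (eigenGrading γ) :=
  { one_mem := by simp [mem_eigenGrading, koszul_zero_right]
    mul_mem := fun i j a b ha hb => by
      rw [mem_eigenGrading] at *
      rw [map_mul, ha, hb, koszul_add_right, smul_mul_smul_comm]
    toDecomposition := DirectSum.Decomposition.ofLinearMap (eigenGrading γ)
      (∑ i : ZMod 2, DirectSum.lof ℂ (ZMod 2) (fun i => eigenGrading γ i) i ∘ₗ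
        LinearMap.codRestrict (eigenGrading γ i)
          ((2⁻¹ : ℂ) • (LinearMap.id + koszul 1 i • γ.toLinearMap)) (fun a => by
            simp only [mem_eigenGrading, LinearMap.smul_apply, LinearMap.add_apply,
              LinearMap.id_apply, AlgHom.toLinearMap_apply, map_smul, map_add, hγ]
            rw [smul_comm (koszul 1 i), smul_add (koszul 1 i), smul_smul (koszul 1 i),
              koszul_mul_self, one_smul, add_comm]))
      (by
        ext a
        have h : (Finset.univ : Finset (ZMod 2)) = {0, 1} := rfl
        rw [h, Finset.sum_pair (by decide)]
        simp only [LinearMap.comp_apply, LinearMap.add_apply, map_add, LinearMap.id_apply,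
          DirectSum.coeLinearMap_lof, LinearMap.codRestrict_apply, LinearMap.smul_apply,
          AlgHom.toLinearMap_apply, koszul_zero_right, koszul_one_one]
        module)
      (by
        ext i x : 2
        obtain ⟨x, hx⟩ := x
        have hx' := (mem_eigenGrading γ i x).1 hx
        have key : ∀ j : ZMod 2, LinearMap.codRestrict (eigenGrading γ j)
          ((2⁻¹ : ℂ) • (LinearMap.id + koszul 1 j • γ.toLinearMap)) (fun a => by
            simp only [mem_eigenGrading, LinearMap.smul_apply, LinearMap.add_apply,
              LinearMap.id_apply, AlgHom.toLinearMap_apply, map_smul, map_add, hγ]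
            rw [smul_comm (koszul 1 j), smul_add (koszul 1 j), smul_smul (koszul 1 j),
              koszul_mul_self, one_smul, add_comm]) x =
            if h : i = j then h ▸ ⟨x, hx⟩ else 0 := by
          intro j
          split_ifs with h
          · subst h
            apply Subtype.ext
            simp only [LinearMap.codRestrict_apply, LinearMap.smul_apply, LinearMap.add_apply,
              LinearMap.id_apply, AlgHom.toLinearMap_apply, hx', smul_smul, koszul_mul_self]
            module
          · apply Subtype.ext
            have hk : koszul 1 j * koszul 1 i = -1 := by
              rcases parity_cases i with rfl | rfl <;> rcases parity_cases j with rfl | rfl <;>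
                simp_all [koszul_zero_right, koszul_one_one]
            simp only [LinearMap.codRestrict_apply, LinearMap.smul_apply, LinearMap.add_apply,
              LinearMap.id_apply, AlgHom.toLinearMap_apply, hx', smul_smul, hk]
            simp
        simp only [LinearMap.comp_apply, DirectSum.coeLinearMap_lof, LinearMap.sum_apply, key]
        rw [Finset.sum_eq_single i]
        · simp
        · intro j _ hj
          simp [Ne.symm hj]
        · simp) }

/-! ### Super Hopf algebras and modular pairs in involution -/

section HopfCyclic

variable {H : Type u} [Ring H] [Algebra ℂ H] (ℋ : ZMod 2 → Submodule ℂ H) [GradedAlgebra ℋ]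

/-- A super Hopf algebra: a Hopf algebra in the category of super vector spaces and even maps.
The product of `H ⊗ H` in `comul_mul` is that of the graded tensor product,
`(a ⊗ b) (a' ⊗ b') = (-1)^{|b||a'|} a a' ⊗ b b'`.  A linear map is even iff it commutes with the
parity operator `twist ℋ 1 : a ↦ (-1)^{|a|} a`. -/
class SuperHopfAlgebra [Coalgebra ℂ H] where
  antipode : H →ₗ[ℂ] H
  comul_even : ∀ a : H, Coalgebra.comul (R := ℂ) (twist ℋ 1 a) =
    TensorProduct.map (twist ℋ 1) (twist ℋ 1) (Coalgebra.comul (R := ℂ) a)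
  counit_even : ∀ a : H, Coalgebra.counit (R := ℂ) (twist ℋ 1 a) = Coalgebra.counit (R := ℂ) a
  antipode_even : ∀ a : H, antipode (twist ℋ 1 a) = twist ℋ 1 (antipode a)
  comul_one : Coalgebra.comul (R := ℂ) (1 : H) = 1 ⊗ₜ[ℂ] 1
  comul_mul : ∀ a b : H, GradedTensorProduct.of ℂ ℋ ℋ (Coalgebra.comul (R := ℂ) (a * b)) =
    GradedTensorProduct.of ℂ ℋ ℋ (Coalgebra.comul (R := ℂ) a) *
      GradedTensorProduct.of ℂ ℋ ℋ (Coalgebra.comul (R := ℂ) b)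
  counit_one : Coalgebra.counit (R := ℂ) (1 : H) = 1
  counit_mul : ∀ a b : H, Coalgebra.counit (R := ℂ) (a * b) =
    Coalgebra.counit (R := ℂ) a * Coalgebra.counit (R := ℂ) b
  mul_antipode_left : ∀ a : H, LinearMap.mul' ℂ H
    (antipode.rTensor H (Coalgebra.comul (R := ℂ) a)) = algebraMap ℂ H (Coalgebra.counit a)
  mul_antipode_right : ∀ a : H, LinearMap.mul' ℂ H
    (antipode.lTensor H (Coalgebra.comul (R := ℂ) a)) = algebraMap ℂ H (Coalgebra.counit a)

variable [Coalgebra ℂ H] [SuperHopfAlgebra ℋ]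

/-- The `δ`-twisted antipode `(δ ⊗ S) Δ`. -/
def twistedAntipode (δ : H →ₐ[ℂ] ℂ) : H →ₗ[ℂ] H :=
  (TensorProduct.lid ℂ H).toLinearMap ∘ₗ
    TensorProduct.map δ.toLinearMap (SuperHopfAlgebra.antipode ℋ) ∘ₗ Coalgebra.comul

/-- A super modular pair in involution `(δ, σ)`. -/
structure SuperMPI where
  char : H →ₐ[ℂ] ℂ
  char_even : ∀ a, char (twist ℋ 1 a) = char a
  cochar : H
  cochar_even : cochar ∈ ℋ 0
  comul_cochar : Coalgebra.comul (R := ℂ) cochar = cochar ⊗ₜ[ℂ] cochar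
  counit_cochar : Coalgebra.counit (R := ℂ) cochar = 1
  char_cochar : char cochar = 1
  involution : ∀ a, SuperHopfAlgebra.antipode ℋ cochar *
    twistedAntipode ℋ char (twistedAntipode ℋ char a) * cochar = a

/-! ### The cocyclic module -/

/-- `h ↦ (c ↦ h ⊗ (c₁ ⊗ ⋯ ⊗ cₙ))`. -/
def splitAux (V : Type v) [AddCommGroup V] [Module ℂ V] (n : ℕ) :
    V →ₗ[ℂ] MultilinearMap ℂ (fun _ : Fin n => V) (V ⊗[ℂ] (⨂[ℂ]^n V)) where
  toFun h := (TensorProduct.mk ℂ V (⨂[ℂ]^n V) h).compMultilinearMap (PiTensorProduct.tprod ℂ)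
  map_add' h h' := by ext c; simp
  map_smul' r h := by ext c; simp

/-- The identification `V ⊗ V^{⊗ n} = V^{⊗ (n+1)}`, `v ⊗ (v₁,…,vₙ) ↦ (v,v₁,…,vₙ)`. -/
def consEquiv (V : Type v) [AddCommGroup V] [Module ℂ V] (n : ℕ) :
    V ⊗[ℂ] (⨂[ℂ]^n V) ≃ₗ[ℂ] ⨂[ℂ]^(n + 1) V :=
  LinearEquiv.ofLinearMap
    (TensorProduct.lift
      (PiTensorProduct.lift.toLinearMap ∘ₗ
        (PiTensorProduct.tprod ℂ (s := fun _ : Fin (n + 1) => V)).curryLeft))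
    (PiTensorProduct.lift (splitAux V n).uncurryLeft)
    (by
      ext c
      simp [splitAux, MultilinearMap.curryLeft_apply, LinearMap.uncurryLeft_apply])
    (by
      ext h c
      simp [splitAux, MultilinearMap.curryLeft_apply, LinearMap.uncurryLeft_apply])

theorem consEquiv_tmul_tprod (V : Type v) [AddCommGroup V] [Module ℂ V] (n : ℕ) (h : V)
    (c : Fin n → V) :
    consEquiv V n (h ⊗ₜ PiTensorProduct.tprod ℂ c) = PiTensorProduct.tprod ℂ (Fin.cons h c) := by
  simp [consEquiv, MultilinearMap.curryLeft_apply]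

/-- `(h, c) ↦ (h, f c)`. -/
def consMap {V : Type v} [AddCommGroup V] [Module ℂ V] {m n : ℕ}
    (f : (⨂[ℂ]^m V) →ₗ[ℂ] ⨂[ℂ]^n V) : (⨂[ℂ]^(m + 1) V) →ₗ[ℂ] ⨂[ℂ]^(n + 1) V :=
  (consEquiv V n).toLinearMap ∘ₗ f.lTensor V ∘ₗ (consEquiv V m).symm.toLinearMap

/-- `c ↦ (h, c)`. -/
def consWith {V : Type v} [AddCommGroup V] [Module ℂ V] (h : V) (n : ℕ) :
    (⨂[ℂ]^n V) →ₗ[ℂ] ⨂[ℂ]^(n + 1) V :=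
  (consEquiv V n).toLinearMap ∘ₗ TensorProduct.mk ℂ V (⨂[ℂ]^n V) h

variable {ℋ}

/-- The cofaces `δ_i : H^{⊗ n} → H^{⊗ (n+1)}`, `0 ≤ i ≤ n+1`: `δ_0` inserts `1` in front,
`δ_{n+1}` appends `σ`, and `δ_i` applies `Δ` to the `i`-th factor for `1 ≤ i ≤ n`
(for `i > n+1` the value is irrelevant). -/
def coface (σ : H) : (n i : ℕ) → (⨂[ℂ]^n H) →ₗ[ℂ] ⨂[ℂ]^(n + 1) H
  | 0, 0 => consWith 1 0
  | 0, _ + 1 => consWith σ 0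
  | n + 1, 0 => consWith 1 (n + 1)
  | n + 1, 1 => (consEquiv H (n + 1)).toLinearMap ∘ₗ (consEquiv H n).toLinearMap.lTensor H ∘ₗ
      (TensorProduct.assoc ℂ H H (⨂[ℂ]^n H)).toLinearMap ∘ₗ
      (Coalgebra.comul (R := ℂ) (A := H)).rTensor (⨂[ℂ]^n H) ∘ₗ (consEquiv H n).symm.toLinearMap
  | n + 1, i + 2 => consMap (coface σ n (i + 1))

/-- The codegeneracies `σ_i : H^{⊗ (n+1)} → H^{⊗ n}`, `0 ≤ i ≤ n`: `σ_i` applies `ε` to the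
`(i+1)`-st factor (for `i > n` the value is irrelevant). -/
def codegeneracy : (n i : ℕ) → (⨂[ℂ]^(n + 1) H) →ₗ[ℂ] ⨂[ℂ]^n H
  | n + 1, i + 1 => consMap (codegeneracy n i)
  | n, _ => (TensorProduct.lid ℂ (⨂[ℂ]^n H)).toLinearMap ∘ₗ
      (Coalgebra.counit (R := ℂ) (A := H)).rTensor (⨂[ℂ]^n H) ∘ₗ (consEquiv H n).symm.toLinearMap

variable (ℋ)

/-- The interchange `(a ⊗ b) ⊗ (c ⊗ x) ↦ (-1)^{|b||c|} (a ⊗ c) ⊗ (b ⊗ x)` given by the braiding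
of super vector spaces. -/
def superInterchange (X : Type v) [AddCommGroup X] [Module ℂ X] :
    (H ⊗[ℂ] H) ⊗[ℂ] (H ⊗[ℂ] X) →ₗ[ℂ] (H ⊗[ℂ] H) ⊗[ℂ] (H ⊗[ℂ] X) :=
  ∑ i : ZMod 2, ∑ j : ZMod 2, koszul i j •
    ((TensorProduct.tensorTensorTensorComm ℂ H H H X).toLinearMap ∘ₗ
      TensorProduct.map ((homProj ℋ i).lTensor H) ((homProj ℋ j).rTensor X))

/-- The diagonal left action of `H` on `H^{⊗ n}`,
`h · (c₁,…,cₙ) = ± (h⁽¹⁾ c₁, …, h⁽ⁿ⁾ cₙ)` with the Koszul sign; on `H^{⊗ 0} = ℂ` it is `ε`. -/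
def diagAct : (n : ℕ) → H ⊗[ℂ] (⨂[ℂ]^n H) →ₗ[ℂ] ⨂[ℂ]^n H
  | 0 => (TensorProduct.lid ℂ (⨂[ℂ]^0 H)).toLinearMap ∘ₗ
      (Coalgebra.counit (R := ℂ) (A := H)).rTensor (⨂[ℂ]^0 H)
  | n + 1 => (consEquiv H n).toLinearMap ∘ₗ
      TensorProduct.map (LinearMap.mul' ℂ H) (diagAct n) ∘ₗ
      superInterchange ℋ (⨂[ℂ]^n H) ∘ₗ
      TensorProduct.map (Coalgebra.comul (R := ℂ) (A := H)) (consEquiv H n).symm.toLinearMap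

variable {ℋ}

namespace SuperMPI

variable (P : SuperMPI ℋ)

/-- The cyclic operator: `τ_0 = id` and `τ_n(h₁,…,hₙ) = S̃(h₁) · (h₂,…,hₙ,σ)`. -/
def cyclicOp : (n : ℕ) → (⨂[ℂ]^n H) →ₗ[ℂ] ⨂[ℂ]^n H
  | 0 => LinearMap.id
  | n + 1 => diagAct ℋ (n + 1) ∘ₗ
      TensorProduct.map (twistedAntipode ℋ P.char) (coface P.cochar n (n + 1)) ∘ₗ
      (consEquiv H n).symm.toLinearMap

/-- The Hochschild coboundary `b = ∑_{i=0}^{n+1} (-1)^i δ_i`. -/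
def hochschildB (n : ℕ) : (⨂[ℂ]^n H) →ₗ[ℂ] ⨂[ℂ]^(n + 1) H :=
  ∑ i ∈ Finset.range (n + 2), (-1 : ℂ) ^ i • coface P.cochar n i

/-- `λ_n = (-1)^n τ_n`. -/
def signedCyclic (n : ℕ) : Module.End ℂ (⨂[ℂ]^n H) := (-1 : ℂ) ^ n • P.cyclicOp n

/-- The operator `B = N σ_{-1} (1 - λ) : H^{⊗ (n+1)} → H^{⊗ n}` with the extra degeneracy
`σ_{-1} = σ_n τ_{n+1}` and the norm `N = 1 + λ_n + ⋯ + λ_n^n`. -/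
def connesB (n : ℕ) : (⨂[ℂ]^(n + 1) H) →ₗ[ℂ] ⨂[ℂ]^n H :=
  (∑ k ∈ Finset.range (n + 1), P.signedCyclic n ^ k) ∘ₗ codegeneracy n n ∘ₗ
    P.cyclicOp (n + 1) ∘ₗ (LinearMap.id - P.signedCyclic (n + 1))

/-- The space `⨁ₙ H^{⊗ n}` of all (finite) cochains. -/
abbrev Cochains (H : Type u) [Ring H] [Algebra ℂ H] : Type u := ⨁ n : ℕ, ⨂[ℂ]^n H

instance (q : Submodule ℂ (Cochains H)) : AddCommGroup q := Submodule.addCommGroup q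

/-- The total differential `b + B` of the `(b, B)` bicomplex, where `B` is `0` on `H^{⊗ 0}`. -/
def totalDifferential : Cochains H →ₗ[ℂ] Cochains H :=
  DirectSum.toModule ℂ ℕ _ fun n =>
    DirectSum.lof ℂ ℕ (fun k => ⨂[ℂ]^k H) (n + 1) ∘ₗ P.hochschildB n +
    match n with
    | 0 => 0
    | m + 1 => DirectSum.lof ℂ ℕ (fun k => ⨂[ℂ]^k H) m ∘ₗ P.connesB m

/-- The cochains that are concentrated in the degrees `n ≡ p mod 2`. -/
def parityPart (H : Type u) [Ring H] [Algebra ℂ H] (p : ZMod 2) : Submodule ℂ (Cochains H) :=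
  ⨅ n : ℕ, ⨅ _ : (n : ZMod 2) ≠ p, LinearMap.ker (DirectSum.component ℂ ℕ (fun k => ⨂[ℂ]^k H) n)

/-- The cocycles of the periodic `(b, B)` complex. -/
def periodicCocycles (p : ZMod 2) : Submodule ℂ (Cochains H) :=
  LinearMap.ker P.totalDifferential ⊓ parityPart H p

/-- The coboundaries of the periodic `(b, B)` complex. -/
def periodicCoboundaries (p : ZMod 2) : Submodule ℂ (Cochains H) :=
  (parityPart H (p + 1)).map P.totalDifferential

/-- The periodic Hopf cyclic cohomology `HP^p_{(δ,σ)}(H)`, `p ∈ ℤ/2`. -/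
abbrev HP (p : ZMod 2) : Type u :=
  P.periodicCocycles p ⧸ (P.periodicCoboundaries p).submoduleOf (P.periodicCocycles p)

end SuperMPI

end HopfCyclic

namespace SuperLieAlgebra

variable {𝔤 : Type u} [AddCommGroup 𝔤] [Module ℂ 𝔤] {𝒢 : ZMod 2 → Submodule ℂ 𝔤}
  [DirectSum.Decomposition 𝒢] (L : SuperLieAlgebra 𝒢)

/-! ### The enveloping algebra -/

/-- The relations `a ⊗ b - (-1)^{|a||b|} b ⊗ a = [a,b]` of the enveloping algebra. -/
inductive EnvelopingRel : TensorAlgebra ℂ 𝔤 → TensorAlgebra ℂ 𝔤 → Prop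
  | of {i j : ZMod 2} {a b : 𝔤} (ha : a ∈ 𝒢 i) (hb : b ∈ 𝒢 j) :
      EnvelopingRel
        (TensorAlgebra.ι ℂ a * TensorAlgebra.ι ℂ b -
          koszul i j • (TensorAlgebra.ι ℂ b * TensorAlgebra.ι ℂ a))
        (TensorAlgebra.ι ℂ (L.bracket a b))

/-- The enveloping algebra `U(𝔤)` of a super Lie algebra. -/
def Enveloping : Type u := RingQuot L.EnvelopingRel

instance : Ring L.Enveloping := inferInstanceAs (Ring (RingQuot L.EnvelopingRel))
instance : Algebra ℂ L.Enveloping := inferInstanceAs (Algebra ℂ (RingQuot L.EnvelopingRel))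

namespace Enveloping

/-- The quotient map `T(𝔤) → U(𝔤)`. -/
def mk : TensorAlgebra ℂ 𝔤 →ₐ[ℂ] L.Enveloping := RingQuot.mkAlgHom ℂ L.EnvelopingRel

theorem mk_surjective : Function.Surjective (mk L) :=
  RingQuot.mkAlgHom_surjective ℂ L.EnvelopingRel

/-- The canonical map `𝔤 → U(𝔤)`. -/
def ι : 𝔤 →ₗ[ℂ] L.Enveloping := (mk L).toLinearMap ∘ₗ TensorAlgebra.ι ℂ

theorem ι_mul_ι {i j : ZMod 2} {a b : 𝔤} (ha : a ∈ 𝒢 i) (hb : b ∈ 𝒢 j) :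
    ι L a * ι L b - koszul i j • (ι L b * ι L a) = ι L (L.bracket a b) := by
  have h : mk L _ = mk L _ := RingQuot.mkAlgHom_rel ℂ (EnvelopingRel.of (L := L) ha hb)
  simp only [map_sub, map_mul, map_smul] at h
  exact h

/-- The universal property of `U(𝔤)`. -/
def lift {A : Type*} [Ring A] [Algebra ℂ A] (f : 𝔤 →ₗ[ℂ] A)
    (hf : ∀ (i j : ZMod 2) (a b : 𝔤), a ∈ 𝒢 i → b ∈ 𝒢 j →
      f a * f b - koszul i j • (f b * f a) = f (L.bracket a b)) : L.Enveloping →ₐ[ℂ] A :=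
  RingQuot.liftAlgHom ℂ ⟨TensorAlgebra.lift ℂ f, by
    rintro _ _ ⟨ha, hb⟩
    simpa using hf _ _ _ _ ha hb⟩

theorem lift_ι {A : Type*} [Ring A] [Algebra ℂ A] (f : 𝔤 →ₗ[ℂ] A)
    (hf : ∀ (i j : ZMod 2) (a b : 𝔤), a ∈ 𝒢 i → b ∈ 𝒢 j →
      f a * f b - koszul i j • (f b * f a) = f (L.bracket a b)) (x : 𝔤) :
    lift L f hf (ι L x) = f x := by
  have h := RingQuot.liftAlgHom_mkAlgHom_apply ℂ (TensorAlgebra.lift ℂ f)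
    (s := L.EnvelopingRel) (by rintro _ _ ⟨ha, hb⟩; simpa using hf _ _ _ _ ha hb)
    (TensorAlgebra.ι ℂ x)
  exact h.trans (TensorAlgebra.lift_ι_apply f x)

theorem induction {P : L.Enveloping → Prop} (one : P 1) (add : ∀ a b, P a → P b → P (a + b))
    (smul : ∀ (r : ℂ) a, P a → P (r • a))
    (mul : ∀ i, ∀ x ∈ 𝒢 i, ∀ a, P a → P (ι L x * a)) (a : L.Enveloping) : P a := by
  obtain ⟨t, rfl⟩ := mk_surjective L a
  have key : ∀ s : TensorAlgebra ℂ 𝔤, ∀ b, P b → P (mk L s * b) := by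
    intro s
    induction s using TensorAlgebra.induction with
    | algebraMap r =>
      intro b hb
      rw [AlgHom.commutes, ← Algebra.smul_def]
      exact smul r b hb
    | ι x =>
      intro b hb
      change P (ι L x * b)
      refine hom_induction 𝒢 x ?_ fun i x hx => mul i x hx b hb
      intro x y hx hy
      rw [map_add, add_mul]
      exact add _ _ hx hy
    | mul s t hs ht =>
      intro b hb
      rw [map_mul, mul_assoc]
      exact hs _ (ht _ hb)
    | add s t hs ht =>
      intro b hb
      rw [map_add, add_mul]
      exact add _ _ (hs _ hb) (ht _ hb)
  simpa using key t 1 one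

theorem linearMap_ext {W : Type*} [AddCommGroup W] [Module ℂ W] {f g : L.Enveloping →ₗ[ℂ] W}
    (one : f 1 = g 1)
    (mul : ∀ i, ∀ x ∈ 𝒢 i, ∀ a, f a = g a → f (ι L x * a) = g (ι L x * a)) : f = g := by
  ext a
  exact induction L (P := fun a => f a = g a) one
    (fun a b ha hb => by rw [map_add, map_add, ha, hb])
    (fun r a ha => by rw [map_smul, map_smul, ha]) mul a

/-- The parity automorphism of `U(𝔤)`, which extends `x ↦ (-1)^{|x|} x`. -/
def parityAut : L.Enveloping →ₐ[ℂ] L.Enveloping :=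
  lift L (ι L ∘ₗ twist 𝒢 1) (by
    intro i j a b ha hb
    simp only [LinearMap.comp_apply, twist_of_mem 𝒢 ha, twist_of_mem 𝒢 hb,
      twist_of_mem 𝒢 (L.bracket_mem ha hb), map_smul, ← ι_mul_ι L ha hb, koszul_add_right]
    simp only [smul_mul_assoc, mul_smul_comm, smul_sub, smul_smul]
    ring_nf)

theorem parityAut_ι {i : ZMod 2} {x : 𝔤} (hx : x ∈ 𝒢 i) :
    parityAut L (ι L x) = koszul 1 i • ι L x := by
  unfold parityAut
  rw [lift_ι, LinearMap.comp_apply, twist_of_mem 𝒢 hx, map_smul]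

theorem parityAut_parityAut (a : L.Enveloping) : parityAut L (parityAut L a) = a := by
  refine DFunLike.congr_fun (f := (parityAut L).toLinearMap ∘ₗ (parityAut L).toLinearMap)
    (g := LinearMap.id) (linearMap_ext L (by simp) ?_) a
  intro i x hx a ha
  simp only [LinearMap.comp_apply, AlgHom.toLinearMap_apply, LinearMap.id_apply] at ha ⊢
  rw [map_mul, map_mul, ha, parityAut_ι L hx, map_smul, parityAut_ι L hx, smul_smul,
    koszul_mul_self, one_smul]

/-- The grading `U(𝔤) = U(𝔤)₀ ⊕ U(𝔤)₁` by parity: the eigenspaces of the parity automorphism. -/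
def grading : ZMod 2 → Submodule ℂ L.Enveloping := eigenGrading (parityAut L)

instance : GradedAlgebra (grading L) := eigenGradedAlgebra _ (parityAut_parityAut L)

theorem ι_mem {i : ZMod 2} {x : 𝔤} (hx : x ∈ 𝒢 i) : ι L x ∈ grading L i :=
  (mem_eigenGrading _ _ _).2 (parityAut_ι L hx)

theorem twist_one_eq (a : L.Enveloping) : twist (grading L) 1 a = parityAut L a := by
  refine hom_induction (grading L) (P := fun a => twist (grading L) 1 a = parityAut L a) a (fun x y hx hy => by rw [map_add, map_add, hx, hy]) ?_
  intro i x hx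
  rw [twist_of_mem _ hx, (mem_eigenGrading _ _ _).1 hx]

theorem twist_mul (i : ZMod 2) (a b : L.Enveloping) :
    twist (grading L) i (a * b) = twist (grading L) i a * twist (grading L) i b := by
  rcases parity_cases i with rfl | rfl
  · simp only [twist_zero]
  · simp only [twist_one_eq, map_mul]

theorem gtp_add (b b' c : L.Enveloping) :
    (GradedTensorProduct.tmul ℂ (b + b') c : GradedTensorProduct ℂ (grading L) (grading L)) =
      GradedTensorProduct.tmul ℂ b c + GradedTensorProduct.tmul ℂ b' c :=
  congrArg (GradedTensorProduct.of ℂ (grading L) (grading L)) (TensorProduct.add_tmul b b' c)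

theorem gtp_smul (r : ℂ) (b c : L.Enveloping) :
    (GradedTensorProduct.tmul ℂ (r • b) c : GradedTensorProduct ℂ (grading L) (grading L)) =
      r • GradedTensorProduct.tmul ℂ b c :=
  congrArg (GradedTensorProduct.of ℂ (grading L) (grading L)) (TensorProduct.smul_tmul' r b c).symm

theorem gtp_left_mul (x b c : L.Enveloping) :
    GradedTensorProduct.tmul ℂ x (1 : L.Enveloping) * GradedTensorProduct.tmul ℂ b c =
      (GradedTensorProduct.tmul ℂ (x * b) c :
        GradedTensorProduct ℂ (grading L) (grading L)) := by
  refine hom_induction (grading L) (P := fun b => GradedTensorProduct.tmul ℂ x (1 : L.Enveloping) *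
    GradedTensorProduct.tmul ℂ b c = (GradedTensorProduct.tmul ℂ (x * b) c :
        GradedTensorProduct ℂ (grading L) (grading L))) b ?_ ?_
  · intro b b' hb hb'
    rw [mul_add x, gtp_add, gtp_add, mul_add, hb, hb']
  · intro i b hb
    exact GradedTensorProduct.tmul_one_mul_coe_tmul (grading L) (grading L) x ⟨b, hb⟩ c

theorem gtp_right_mul {i : ZMod 2} {x : L.Enveloping} (hx : x ∈ grading L i)
    (b c : L.Enveloping) :
    GradedTensorProduct.tmul ℂ (1 : L.Enveloping) x * GradedTensorProduct.tmul ℂ b c =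
      (GradedTensorProduct.tmul ℂ (twist (grading L) i b) (x * c) :
        GradedTensorProduct ℂ (grading L) (grading L)) := by
  refine hom_induction (grading L) (P := fun b => GradedTensorProduct.tmul ℂ (1 : L.Enveloping) x *
    GradedTensorProduct.tmul ℂ b c = (GradedTensorProduct.tmul ℂ (twist (grading L) i b) (x * c) :
        GradedTensorProduct ℂ (grading L) (grading L))) b ?_ ?_
  · intro b b' hb hb'
    rw [map_add (twist _ _), gtp_add, gtp_add, mul_add, hb, hb']
  · intro j b hb
    have h := GradedTensorProduct.tmul_coe_mul_coe_tmul (R := ℂ) (grading L) (grading L) 1 ⟨x, hx⟩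
      ⟨b, hb⟩ c
    rw [units_smul_eq_koszul_smul, one_mul] at h
    rw [twist_of_mem _ hb, gtp_smul]
    exact h

/-- The comultiplication `U(𝔤) → U(𝔤) ⊗ U(𝔤)`, as a homomorphism into the graded tensor product,
determined by `Δ x = x ⊗ 1 + 1 ⊗ x` for `x ∈ 𝔤`. -/
def comulHom : L.Enveloping →ₐ[ℂ] GradedTensorProduct ℂ (grading L) (grading L) :=
  lift L ((GradedTensorProduct.includeLeft (grading L) (grading L)).toLinearMap ∘ₗ ι L +
      (GradedTensorProduct.includeRight (grading L) (grading L)).toLinearMap ∘ₗ ι L) (by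
    intro i j a b ha hb
    have cross : ∀ {i j : ZMod 2} {a b : 𝔤}, a ∈ 𝒢 i → b ∈ 𝒢 j →
        GradedTensorProduct.includeRight (grading L) (grading L) (ι L a) *
          GradedTensorProduct.includeLeft (grading L) (grading L) (ι L b) =
        koszul i j • (GradedTensorProduct.includeLeft (grading L) (grading L) (ι L b) *
          GradedTensorProduct.includeRight (grading L) (grading L) (ι L a)) := by
      intro i j a b ha hb
      have h1 := gtp_right_mul L (ι_mem L ha) (ι L b) 1
      have h2 := gtp_left_mul L (ι L b) 1 (ι L a)
      rw [twist_of_mem _ (ι_mem L hb), gtp_smul, mul_one] at h1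
      rw [mul_one] at h2
      exact h1.trans (congrArg _ h2.symm)
    have hL := congrArg (GradedTensorProduct.includeLeft (grading L) (grading L)) (ι_mul_ι L ha hb)
    have hR := congrArg (GradedTensorProduct.includeRight (grading L) (grading L)) (ι_mul_ι L ha hb)
    simp only [map_sub, map_mul, map_smul] at hL hR
    simp only [LinearMap.add_apply, LinearMap.comp_apply, AlgHom.toLinearMap_apply, mul_add,
      add_mul, smul_add, cross ha hb, cross hb ha, smul_smul, koszul_comm j i, koszul_mul_self,
      one_smul, ← hL, ← hR]
    abel)

/-- The comultiplication of `U(𝔤)`. -/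
def comul : L.Enveloping →ₗ[ℂ] L.Enveloping ⊗[ℂ] L.Enveloping :=
  (GradedTensorProduct.of ℂ (grading L) (grading L)).symm.toLinearMap ∘ₗ (comulHom L).toLinearMap

theorem comul_one : comul L 1 = 1 ⊗ₜ 1 := by
  rw [comul, LinearMap.comp_apply, AlgHom.toLinearMap_apply, map_one]
  rfl

/-- Left multiplication by `x ⊗ 1 + 1 ⊗ x` in the graded tensor product, for `x` of parity `i`. -/
def comulStep (i : ZMod 2) (x : L.Enveloping) :
    L.Enveloping ⊗[ℂ] L.Enveloping →ₗ[ℂ] L.Enveloping ⊗[ℂ] L.Enveloping :=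
  TensorProduct.map (LinearMap.mulLeft ℂ x) LinearMap.id +
    TensorProduct.map (twist (grading L) i) (LinearMap.mulLeft ℂ x)

theorem comulStep_tmul (i : ZMod 2) (x b c : L.Enveloping) :
    comulStep L i x (b ⊗ₜ c) = (x * b) ⊗ₜ c + (twist (grading L) i b) ⊗ₜ (x * c) := rfl

theorem comul_ι_mul {i : ZMod 2} {x : 𝔤} (hx : x ∈ 𝒢 i) (a : L.Enveloping) :
    comul L (ι L x * a) = comulStep L i (ι L x) (comul L a) := by
  have key : ∀ t : L.Enveloping ⊗[ℂ] L.Enveloping,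
      (GradedTensorProduct.includeLeft (grading L) (grading L) (ι L x) +
        GradedTensorProduct.includeRight (grading L) (grading L) (ι L x)) *
        GradedTensorProduct.of ℂ (grading L) (grading L) t =
      GradedTensorProduct.of ℂ (grading L) (grading L) (comulStep L i (ι L x) t) := by
    intro t
    induction t with
    | zero => simp
    | add t t' ht ht' => rw [map_add, mul_add, ht, ht', map_add, map_add]
    | tmul b c =>
      rw [comulStep_tmul, map_add, add_mul]
      exact congrArg₂ (· + ·) (gtp_left_mul L (ι L x) b c) (gtp_right_mul L (ι_mem L hx) b c)
  have h := key (comul L a)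
  have hc : comulHom L (ι L x) = GradedTensorProduct.includeLeft (grading L) (grading L) (ι L x) +
        GradedTensorProduct.includeRight (grading L) (grading L) (ι L x) := by
    unfold comulHom
    rw [lift_ι]
    rfl
  rw [← hc] at h
  have h' : GradedTensorProduct.of ℂ (grading L) (grading L) (comul L a) = comulHom L a := rfl
  rw [h', ← map_mul] at h
  exact h

theorem twist_ι_mul (j : ZMod 2) {i : ZMod 2} {x : 𝔤} (hx : x ∈ 𝒢 i) (a : L.Enveloping) :
    twist (grading L) j (ι L x * a) = koszul j i • (ι L x * twist (grading L) j a) := by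
  rw [twist_mul, twist_of_mem _ (ι_mem L hx), smul_mul_assoc]

theorem twist_algebraMap (j : ZMod 2) (r : ℂ) :
    twist (grading L) j (algebraMap ℂ _ r) = algebraMap ℂ _ r := by
  have h : algebraMap ℂ L.Enveloping r ∈ grading L 0 := by
    rw [Algebra.algebraMap_eq_smul_one]
    exact Submodule.smul_mem _ _ SetLike.GradedOne.one_mem
  rw [twist_of_mem _ h, koszul_zero_right, one_smul]

theorem twist_one (j : ZMod 2) : twist (grading L) j 1 = 1 := by
  simpa using twist_algebraMap L j 1

theorem comul_twist (j : ZMod 2) (a : L.Enveloping) :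
    comul L (twist (grading L) j a) =
      TensorProduct.map (twist (grading L) j) (twist (grading L) j) (comul L a) := by
  refine DFunLike.congr_fun (f := comul L ∘ₗ twist (grading L) j)
    (g := TensorProduct.map (twist (grading L) j) (twist (grading L) j) ∘ₗ comul L)
    (linearMap_ext L ?_ ?_) a
  · simp [comul_one, twist_one]
  · intro i x hx a ha
    simp only [LinearMap.comp_apply] at ha ⊢
    rw [twist_ι_mul L j hx, map_smul, comul_ι_mul L hx, comul_ι_mul L hx, ha]
    generalize comul L a = t
    induction t with
    | zero => simp
    | add t t' ht ht' => simp only [map_add, smul_add, ht, ht']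
    | tmul b c =>
      simp only [comulStep_tmul, TensorProduct.map_tmul, map_add, twist_ι_mul L j hx,
        TensorProduct.smul_tmul', TensorProduct.tmul_smul, smul_add, twist_comm _ i j]

/-- The counit of `U(𝔤)`, determined by `ε x = 0` for `x ∈ 𝔤`. -/
def counitHom : L.Enveloping →ₐ[ℂ] ℂ := lift L 0 (by simp)

theorem counitHom_ι_mul (x : 𝔤) (a : L.Enveloping) : counitHom L (ι L x * a) = 0 := by
  rw [map_mul]
  unfold counitHom
  rw [lift_ι, LinearMap.zero_apply, zero_mul]

theorem counitHom_twist (i : ZMod 2) (a : L.Enveloping) :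
    counitHom L (twist (grading L) i a) = counitHom L a := by
  refine DFunLike.congr_fun (f := (counitHom L).toLinearMap ∘ₗ twist (grading L) i)
    (g := (counitHom L).toLinearMap) (linearMap_ext L ?_ ?_) a
  · simp [twist_one]
  · intro j x hx a _
    simp [twist_ι_mul L i hx, counitHom_ι_mul]

/-- The analogue of `comulStep` on the triple tensor product. -/
def comulStep₃ (i : ZMod 2) (x : L.Enveloping) :
    L.Enveloping ⊗[ℂ] (L.Enveloping ⊗[ℂ] L.Enveloping) →ₗ[ℂ]
      L.Enveloping ⊗[ℂ] (L.Enveloping ⊗[ℂ] L.Enveloping) :=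
  TensorProduct.map (LinearMap.mulLeft ℂ x) LinearMap.id +
    TensorProduct.map (twist (grading L) i) (comulStep L i x)

theorem comulStep₃_tmul (i : ZMod 2) (x b : L.Enveloping) (t : L.Enveloping ⊗[ℂ] L.Enveloping) :
    comulStep₃ L i x (b ⊗ₜ t) =
      (x * b) ⊗ₜ t + (twist (grading L) i b) ⊗ₜ (comulStep L i x t) := rfl

instance : Coalgebra ℂ L.Enveloping where
  comul := comul L
  counit := (counitHom L).toLinearMap
  coassoc := by
    refine linearMap_ext L ?_ ?_
    · simp [comul_one]
    · intro i x hx a ha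
      simp only [LinearMap.comp_apply, LinearEquiv.coe_coe] at ha ⊢
      rw [comul_ι_mul L hx]
      have h1 : ∀ t : L.Enveloping ⊗[ℂ] L.Enveloping,
          (comul L).lTensor L.Enveloping (comulStep L i (ι L x) t) =
          comulStep₃ L i (ι L x)
            ((comul L).lTensor L.Enveloping t) := by
        intro t
        induction t with
        | zero => simp
        | add t t' ht ht' => simp only [map_add, ht, ht']
        | tmul b c => simp [comulStep_tmul, comulStep₃_tmul, comul_ι_mul L hx]
      have h2 : ∀ t : L.Enveloping ⊗[ℂ] L.Enveloping,
          TensorProduct.assoc ℂ L.Enveloping L.Enveloping L.Enveloping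
            ((comul L).rTensor L.Enveloping (comulStep L i (ι L x) t)) =
          comulStep₃ L i (ι L x)
            (TensorProduct.assoc ℂ L.Enveloping L.Enveloping L.Enveloping
              ((comul L).rTensor L.Enveloping t)) := by
        intro t
        induction t with
        | zero => simp
        | add t t' ht ht' => simp only [map_add, ht, ht']
        | tmul b c =>
          simp only [comulStep_tmul, map_add, LinearMap.rTensor_tmul, comul_ι_mul L hx,
            comul_twist]
          generalize comul L b = s
          induction s with
          | zero => simp
          | add s s' hs hs' =>
            simp only [map_add, TensorProduct.add_tmul] at hs hs' ⊢
            rw [← hs, ← hs']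
            abel
          | tmul p q =>
            simp [comulStep_tmul, comulStep₃_tmul, TensorProduct.add_tmul, TensorProduct.tmul_add,
              add_assoc]
      rw [h1, h2, ha]
  rTensor_counit_comp_comul := by
    refine linearMap_ext L ?_ ?_
    · simp [comul_one]
    · intro i x hx a ha
      simp only [LinearMap.comp_apply] at ha ⊢
      have h : ∀ t : L.Enveloping ⊗[ℂ] L.Enveloping,
          (counitHom L).toLinearMap.rTensor L.Enveloping (comulStep L i (ι L x) t) =
          (LinearMap.mulLeft ℂ (ι L x)).lTensor ℂ
            ((counitHom L).toLinearMap.rTensor L.Enveloping t) := by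
        intro t
        induction t with
        | zero => simp
        | add t t' ht ht' => simp only [map_add, ht, ht']
        | tmul b c => simp [comulStep_tmul, counitHom_ι_mul, counitHom_twist]
      rw [comul_ι_mul L hx, h, ha]
      simp
  lTensor_counit_comp_comul := by
    refine linearMap_ext L ?_ ?_
    · simp [comul_one]
    · intro i x hx a ha
      simp only [LinearMap.comp_apply] at ha ⊢
      have h : ∀ t : L.Enveloping ⊗[ℂ] L.Enveloping,
          (counitHom L).toLinearMap.lTensor L.Enveloping (comulStep L i (ι L x) t) =
          (LinearMap.mulLeft ℂ (ι L x)).rTensor ℂ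
            ((counitHom L).toLinearMap.lTensor L.Enveloping t) := by
        intro t
        induction t with
        | zero => simp
        | add t t' ht ht' => simp only [map_add, ht, ht']
        | tmul b c => simp [comulStep_tmul, counitHom_ι_mul]
      rw [comul_ι_mul L hx, h, ha]
      simp

theorem comul_eq (a : L.Enveloping) : Coalgebra.comul (R := ℂ) a = comul L a := rfl

theorem counit_eq (a : L.Enveloping) : Coalgebra.counit (R := ℂ) a = counitHom L a := rfl

/-- The map `x ↦ (u ↦ -(-1)^{|x||u|} u x)`. -/
def antipodeOp : 𝔤 →ₗ[ℂ] Module.End ℂ L.Enveloping :=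
  -∑ i : ZMod 2, LinearMap.lcomp ℂ L.Enveloping (twist (grading L) i) ∘ₗ
    (LinearMap.mul ℂ L.Enveloping).flip ∘ₗ ι L ∘ₗ homProj 𝒢 i

theorem antipodeOp_apply {i : ZMod 2} {x : 𝔤} (hx : x ∈ 𝒢 i) (u : L.Enveloping) :
    antipodeOp L x u = -(twist (grading L) i u * ι L x) := by
  simp only [antipodeOp, LinearMap.neg_apply, LinearMap.sum_apply, LinearMap.comp_apply,
    homProj_of_mem 𝒢 hx]
  rw [Finset.sum_eq_single i]
  · simp
  · intro j _ hj
    simp [Ne.symm hj]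
  · simp

theorem antipodeOp_rel (i j : ZMod 2) (a b : 𝔤) (ha : a ∈ 𝒢 i) (hb : b ∈ 𝒢 j) :
    antipodeOp L a * antipodeOp L b - koszul i j • (antipodeOp L b * antipodeOp L a) =
      antipodeOp L (L.bracket a b) := by
  ext u
  simp only [LinearMap.sub_apply, LinearMap.smul_apply, Module.End.mul_apply,
    antipodeOp_apply L ha, antipodeOp_apply L hb, antipodeOp_apply L (L.bracket_mem ha hb),
    map_neg, twist_mul, twist_of_mem _ (ι_mem L ha), twist_of_mem _ (ι_mem L hb),
    ← ι_mul_ι L ha hb]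
  have h : twist (grading L) (i + j) u = twist (grading L) i (twist (grading L) j u) := by
    have h2 : (1 + 1 : ZMod 2) = 0 := rfl
    rcases parity_cases i with rfl | rfl <;> rcases parity_cases j with rfl | rfl <;>
      simp [twist_zero, twist_twist, h2]
  rw [h, twist_comm _ j i]
  simp only [mul_sub, neg_mul, neg_neg, mul_smul_comm, smul_mul_assoc, mul_assoc, smul_smul,
    koszul_comm j i, koszul_mul_self, one_smul, neg_sub]

/-- The antipode of `U(𝔤)`, determined by `S 1 = 1` and `S (x a) = -(-1)^{|x||a|} S(a) x` for
`x ∈ 𝔤`; so `S` is the super antiautomorphism of `U(𝔤)` with `S x = -x` for `x ∈ 𝔤`. -/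
def antipode : L.Enveloping →ₗ[ℂ] L.Enveloping :=
  LinearMap.applyₗ (1 : L.Enveloping) ∘ₗ
    (lift L (antipodeOp L) (antipodeOp_rel L)).toLinearMap

theorem antipode_one : antipode L 1 = 1 := by
  simp [antipode]

theorem antipode_ι_mul {i : ZMod 2} {x : 𝔤} (hx : x ∈ 𝒢 i) (a : L.Enveloping) :
    antipode L (ι L x * a) = -(twist (grading L) i (antipode L a) * ι L x) := by
  simp only [antipode, LinearMap.comp_apply, AlgHom.toLinearMap_apply, map_mul, lift_ι,
    LinearMap.applyₗ_apply_apply, Module.End.mul_apply, antipodeOp_apply L hx]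

theorem antipode_twist (j : ZMod 2) (a : L.Enveloping) :
    antipode L (twist (grading L) j a) = twist (grading L) j (antipode L a) := by
  refine DFunLike.congr_fun (f := antipode L ∘ₗ twist (grading L) j)
    (g := twist (grading L) j ∘ₗ antipode L) (linearMap_ext L ?_ ?_) a
  · simp [antipode_one, twist_one]
  · intro i x hx a ha
    simp only [LinearMap.comp_apply] at ha ⊢
    rw [twist_ι_mul L j hx, map_smul, antipode_ι_mul L hx, antipode_ι_mul L hx, ha, map_neg,
      twist_mul, twist_of_mem _ (ι_mem L hx), twist_comm _ i j, mul_smul_comm, smul_neg]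

instance : SuperHopfAlgebra (grading L) where
  antipode := antipode L
  comul_even := comul_twist L 1
  counit_even := counitHom_twist L 1
  antipode_even := antipode_twist L 1
  comul_one := comul_one L
  comul_mul a b := map_mul (comulHom L) a b
  counit_one := map_one (counitHom L)
  counit_mul a b := map_mul (counitHom L) a b
  mul_antipode_left a := by
    simp only [comul_eq, counit_eq]
    refine DFunLike.congr_fun (f := LinearMap.mul' ℂ L.Enveloping ∘ₗ
      (antipode L).rTensor L.Enveloping ∘ₗ comul L)
      (g := Algebra.linearMap ℂ L.Enveloping ∘ₗ (counitHom L).toLinearMap)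
      (linearMap_ext L ?_ ?_) a
    · simp [comul_one, antipode_one]
    · intro i x hx a _
      simp only [LinearMap.comp_apply, comul_ι_mul L hx, AlgHom.toLinearMap_apply,
        counitHom_ι_mul, map_zero]
      generalize comul L a = t
      induction t with
      | zero => simp
      | add t t' ht ht' => simp only [map_add, ht, ht', add_zero]
      | tmul b c =>
        simp [comulStep_tmul, antipode_ι_mul L hx, antipode_twist, mul_assoc]
  mul_antipode_right a := by
    simp only [comul_eq, counit_eq]
    refine DFunLike.congr_fun (f := LinearMap.mul' ℂ L.Enveloping ∘ₗ
      (antipode L).lTensor L.Enveloping ∘ₗ comul L)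
      (g := Algebra.linearMap ℂ L.Enveloping ∘ₗ (counitHom L).toLinearMap)
      (linearMap_ext L ?_ ?_) a
    · simp [comul_one, antipode_one]
    · intro i x hx a ha
      simp only [LinearMap.comp_apply, comul_ι_mul L hx, AlgHom.toLinearMap_apply,
        counitHom_ι_mul, map_zero, Algebra.linearMap_apply] at ha ⊢
      have h : ∀ t : L.Enveloping ⊗[ℂ] L.Enveloping, LinearMap.mul' ℂ L.Enveloping
          ((antipode L).lTensor L.Enveloping (comulStep L i (ι L x) t)) =
          ι L x * LinearMap.mul' ℂ L.Enveloping ((antipode L).lTensor L.Enveloping t) -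
          twist (grading L) i
            (LinearMap.mul' ℂ L.Enveloping ((antipode L).lTensor L.Enveloping t)) * ι L x := by
        intro t
        induction t with
        | zero => simp
        | add t t' ht ht' =>
          simp only [map_add, ht, ht', mul_add, add_mul]
          abel
        | tmul b c =>
          simp [comulStep_tmul, antipode_ι_mul L hx, twist_mul, mul_assoc, sub_eq_add_neg]
      rw [h, ha, twist_algebraMap, Algebra.commutes, sub_self]

theorem antipode_eq (a : L.Enveloping) :
    SuperHopfAlgebra.antipode (grading L) a = antipode L a := rfl

end Enveloping

/-! ### Characters and the modular pair `(δ, 1)` -/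

/-- A character of a super Lie algebra: an even linear form that vanishes on brackets, i.e. a
homomorphism of super Lie algebras `𝔤 → ℂ`. -/
structure Character where
  toLinearMap : 𝔤 →ₗ[ℂ] ℂ
  map_odd : ∀ x ∈ 𝒢 1, toLinearMap x = 0
  map_bracket : ∀ x y, toLinearMap (L.bracket x y) = 0

namespace Character

variable {L} (δ : L.Character)

/-- The extension of a character of `𝔤` to `U(𝔤)`. -/
def toAlgHom : L.Enveloping →ₐ[ℂ] ℂ :=
  Enveloping.lift L δ.toLinearMap (by
    intro i j a b ha hb
    rw [δ.map_bracket]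
    rcases parity_cases i with rfl | rfl
    · rw [koszul_zero_left, one_smul, mul_comm, sub_self]
    · rw [δ.map_odd a ha]
      simp)

theorem toAlgHom_ι (x : 𝔤) : δ.toAlgHom (Enveloping.ι L x) = δ.toLinearMap x :=
  Enveloping.lift_ι L _ _ x

theorem smul_twist {i : ZMod 2} {x : 𝔤} (hx : x ∈ 𝒢 i) (a : L.Enveloping) :
    δ.toLinearMap x • twist (Enveloping.grading L) i a = δ.toLinearMap x • a := by
  rcases parity_cases i with rfl | rfl
  · rw [twist_zero]
  · rw [δ.map_odd x hx, zero_smul, zero_smul]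

theorem toAlgHom_twist (i : ZMod 2) (a : L.Enveloping) :
    δ.toAlgHom (twist (Enveloping.grading L) i a) = δ.toAlgHom a := by
  refine DFunLike.congr_fun (f := δ.toAlgHom.toLinearMap ∘ₗ twist (Enveloping.grading L) i)
    (g := δ.toAlgHom.toLinearMap) (Enveloping.linearMap_ext L ?_ ?_) a
  · simp [Enveloping.twist_one]
  · intro j x hx a ha
    simp only [LinearMap.comp_apply, AlgHom.toLinearMap_apply] at ha ⊢
    rw [Enveloping.twist_ι_mul L i hx, map_smul, map_mul, map_mul, ha, toAlgHom_ι]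
    rcases parity_cases j with rfl | rfl
    · rw [koszul_zero_right, one_smul]
    · rw [δ.map_odd x hx, zero_mul, smul_zero]

local notation "𝒮" => twistedAntipode (Enveloping.grading L) δ.toAlgHom

theorem twistedAntipode_one : 𝒮 1 = 1 := by
  simp [twistedAntipode, Enveloping.comul_eq, Enveloping.comul_one, Enveloping.antipode_eq,
    Enveloping.antipode_one]

theorem twistedAntipode_ι_mul {i : ZMod 2} {x : 𝔤} (hx : x ∈ 𝒢 i) (a : L.Enveloping) :
    𝒮 (Enveloping.ι L x * a) =
      δ.toLinearMap x • 𝒮 a - twist (Enveloping.grading L) i (𝒮 a) * Enveloping.ι L x := by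
  simp only [twistedAntipode, LinearMap.comp_apply, Enveloping.comul_eq,
    Enveloping.comul_ι_mul L hx, LinearEquiv.coe_coe]
  generalize Enveloping.comul L a = t
  induction t with
  | zero => simp
  | add t t' ht ht' =>
    simp only [map_add, ht, ht', smul_add, add_mul]
    abel
  | tmul b c =>
    simp [Enveloping.comulStep_tmul, Enveloping.antipode_eq, Enveloping.antipode_ι_mul L hx,
      toAlgHom_twist, toAlgHom_ι, mul_smul, sub_eq_add_neg]

theorem twistedAntipode_twist (j : ZMod 2) (a : L.Enveloping) :
    𝒮 (twist (Enveloping.grading L) j a) = twist (Enveloping.grading L) j (𝒮 a) := by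
  refine DFunLike.congr_fun (f := 𝒮 ∘ₗ twist (Enveloping.grading L) j)
    (g := twist (Enveloping.grading L) j ∘ₗ 𝒮) (Enveloping.linearMap_ext L ?_ ?_) a
  · simp [twistedAntipode_one, Enveloping.twist_one]
  · intro i x hx a ha
    simp only [LinearMap.comp_apply] at ha ⊢
    rw [Enveloping.twist_ι_mul L j hx, map_smul, twistedAntipode_ι_mul δ hx,
      twistedAntipode_ι_mul δ hx, ha, map_sub, map_smul, Enveloping.twist_mul,
      twist_of_mem _ (Enveloping.ι_mem L hx), twist_comm _ i j, mul_smul_comm, smul_sub]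
    congr 1
    rcases parity_cases i with rfl | rfl
    · rw [koszul_zero_right, one_smul]
    · rw [δ.map_odd x hx, zero_smul, smul_zero]

theorem twistedAntipode_mul_ι {i : ZMod 2} {x : 𝔤} (hx : x ∈ 𝒢 i) (a : L.Enveloping) :
    𝒮 (a * Enveloping.ι L x) =
      δ.toLinearMap x • 𝒮 a - Enveloping.ι L x * twist (Enveloping.grading L) i (𝒮 a) := by
  refine DFunLike.congr_fun
    (f := 𝒮 ∘ₗ LinearMap.mulRight ℂ (Enveloping.ι L x))
    (g := δ.toLinearMap x • 𝒮 -
      LinearMap.mulLeft ℂ (Enveloping.ι L x) ∘ₗ twist (Enveloping.grading L) i ∘ₗ 𝒮)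
    (Enveloping.linearMap_ext L ?_ ?_) a
  · have h := twistedAntipode_ι_mul δ hx 1
    simp only [mul_one, twistedAntipode_one, Enveloping.twist_one, one_mul] at h
    simp [h, twistedAntipode_one, Enveloping.twist_one]
  · intro k y hy a ha
    simp only [LinearMap.comp_apply, LinearMap.mulRight_apply, LinearMap.sub_apply,
      LinearMap.smul_apply, LinearMap.mulLeft_apply] at ha ⊢
    rw [mul_assoc, twistedAntipode_ι_mul δ hy, twistedAntipode_ι_mul δ hy, ha]
    simp only [map_sub, map_smul, Enveloping.twist_mul, twist_of_mem _ (Enveloping.ι_mem L hx),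
      twist_of_mem _ (Enveloping.ι_mem L hy), twist_comm _ k i, koszul_comm k i, sub_mul, mul_sub,
      smul_sub, smul_mul_assoc, mul_smul_comm, mul_assoc, smul_comm (δ.toLinearMap y)]
    abel

theorem twistedAntipode_twistedAntipode (a : L.Enveloping) : 𝒮 (𝒮 a) = a := by
  refine DFunLike.congr_fun (f := 𝒮 ∘ₗ 𝒮) (g := LinearMap.id)
    (Enveloping.linearMap_ext L ?_ ?_) a
  · simp [twistedAntipode_one]
  · intro i x hx a ha
    simp only [LinearMap.comp_apply, LinearMap.id_apply] at ha ⊢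
    rw [twistedAntipode_ι_mul δ hx, map_sub, map_smul, twistedAntipode_mul_ι δ hx,
      twistedAntipode_twist, twist_twist, ha, smul_twist δ hx, sub_sub_cancel]

/-- The modular pair in involution `(δ, 1)` of `U(𝔤)`. -/
def mpi : SuperMPI (Enveloping.grading L) where
  char := δ.toAlgHom
  char_even := toAlgHom_twist δ 1
  cochar := 1
  cochar_even := SetLike.GradedOne.one_mem
  comul_cochar := Enveloping.comul_one L
  counit_cochar := map_one (Enveloping.counitHom L)
  char_cochar := map_one δ.toAlgHom
  involution a := by
    rw [twistedAntipode_twistedAntipode, Enveloping.antipode_eq, Enveloping.antipode_one, one_mul,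
      mul_one]

end Character
end SuperLieAlgebra

/-! ### The exterior algebra of a super vector space -/

section Exterior

variable {𝔤 : Type u} [AddCommGroup 𝔤] [Module ℂ 𝔤] (𝒢 : ZMod 2 → Submodule ℂ 𝔤)

/-- The relations `a ⊗ b + (-1)^{|a||b|} b ⊗ a = 0` of the exterior algebra. -/
inductive ExteriorRel : TensorAlgebra ℂ 𝔤 → TensorAlgebra ℂ 𝔤 → Prop
  | of {i j : ZMod 2} {a b : 𝔤} (ha : a ∈ 𝒢 i) (hb : b ∈ 𝒢 j) :
      ExteriorRel
        (TensorAlgebra.ι ℂ a * TensorAlgebra.ι ℂ b +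
          koszul i j • (TensorAlgebra.ι ℂ b * TensorAlgebra.ι ℂ a)) 0

/-- The exterior algebra `⋀ 𝔤` of the super vector space `𝔤 = 𝒢 0 ⊕ 𝒢 1`. -/
def SuperExterior : Type u := RingQuot (ExteriorRel 𝒢)

namespace SuperExterior

instance : Ring (SuperExterior 𝒢) := inferInstanceAs (Ring (RingQuot (ExteriorRel 𝒢)))
instance : Algebra ℂ (SuperExterior 𝒢) := inferInstanceAs (Algebra ℂ (RingQuot (ExteriorRel 𝒢)))

/-- The quotient map `T(𝔤) → ⋀ 𝔤`. -/
def mk : TensorAlgebra ℂ 𝔤 →ₐ[ℂ] SuperExterior 𝒢 := RingQuot.mkAlgHom ℂ (ExteriorRel 𝒢)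

theorem mk_surjective : Function.Surjective (mk 𝒢) :=
  RingQuot.mkAlgHom_surjective ℂ (ExteriorRel 𝒢)

/-- The canonical map `𝔤 → ⋀ 𝔤`. -/
def ι : 𝔤 →ₗ[ℂ] SuperExterior 𝒢 := (mk 𝒢).toLinearMap ∘ₗ TensorAlgebra.ι ℂ

theorem ι_mul_ι {i j : ZMod 2} {a b : 𝔤} (ha : a ∈ 𝒢 i) (hb : b ∈ 𝒢 j) :
    ι 𝒢 a * ι 𝒢 b + koszul i j • (ι 𝒢 b * ι 𝒢 a) = 0 := by
  have h : mk 𝒢 _ = mk 𝒢 _ := RingQuot.mkAlgHom_rel ℂ (ExteriorRel.of (𝒢 := 𝒢) ha hb)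
  simp only [map_add, map_mul, map_smul, map_zero] at h
  exact h

/-- The universal property of `⋀ 𝔤`. -/
def lift {A : Type*} [Ring A] [Algebra ℂ A] (f : 𝔤 →ₗ[ℂ] A)
    (hf : ∀ (i j : ZMod 2) (a b : 𝔤), a ∈ 𝒢 i → b ∈ 𝒢 j →
      f a * f b + koszul i j • (f b * f a) = 0) : SuperExterior 𝒢 →ₐ[ℂ] A :=
  RingQuot.liftAlgHom ℂ ⟨TensorAlgebra.lift ℂ f, by
    rintro _ _ ⟨ha, hb⟩
    simpa using hf _ _ _ _ ha hb⟩

theorem lift_ι {A : Type*} [Ring A] [Algebra ℂ A] (f : 𝔤 →ₗ[ℂ] A)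
    (hf : ∀ (i j : ZMod 2) (a b : 𝔤), a ∈ 𝒢 i → b ∈ 𝒢 j →
      f a * f b + koszul i j • (f b * f a) = 0) (x : 𝔤) :
    lift 𝒢 f hf (ι 𝒢 x) = f x := by
  have h := RingQuot.liftAlgHom_mkAlgHom_apply ℂ (TensorAlgebra.lift ℂ f)
    (s := ExteriorRel 𝒢) (by rintro _ _ ⟨ha, hb⟩; simpa using hf _ _ _ _ ha hb)
    (TensorAlgebra.ι ℂ x)
  exact h.trans (TensorAlgebra.lift_ι_apply f x)

/-- The `n`-th exterior power `⋀ⁿ 𝔤`, as a subspace of `⋀ 𝔤`. -/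
def power (n : ℕ) : Submodule ℂ (SuperExterior 𝒢) := LinearMap.range (ι 𝒢) ^ n

/-- The element `x₁ ∧ ⋯ ∧ xₙ`. -/
def wedge {n : ℕ} (x : Fin n → 𝔤) : SuperExterior 𝒢 := (List.ofFn fun k => ι 𝒢 (x k)).prod

/-- The augmentation `⋀ 𝔤 → ⋀⁰ 𝔤 = ℂ`, which vanishes on `⋀ⁿ 𝔤` for `n > 0`. -/
def augmentation : SuperExterior 𝒢 →ₐ[ℂ] ℂ := lift 𝒢 0 (by simp)

variable [DirectSum.Decomposition 𝒢]

/-- The map `x ↦ (y ⊗ w ↦ (-1)^{|x||y|} y ⊗ (x ∧ w))`. -/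
def shift : 𝔤 →ₗ[ℂ] Module.End ℂ (𝔤 ⊗[ℂ] SuperExterior 𝒢) :=
  ∑ i : ZMod 2, TensorProduct.mapBilinear (RingHom.id ℂ) 𝔤 (SuperExterior 𝒢) 𝔤 (SuperExterior 𝒢)
    (twist 𝒢 i) ∘ₗ
    LinearMap.mul ℂ (SuperExterior 𝒢) ∘ₗ ι 𝒢 ∘ₗ homProj 𝒢 i

theorem shift_tmul {i : ZMod 2} {x : 𝔤} (hx : x ∈ 𝒢 i) (y : 𝔤) (w : SuperExterior 𝒢) :
    shift 𝒢 x (y ⊗ₜ w) = twist 𝒢 i y ⊗ₜ (ι 𝒢 x * w) := by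
  simp only [shift, LinearMap.sum_apply, LinearMap.comp_apply, homProj_of_mem 𝒢 hx]
  rw [Finset.sum_eq_single i]
  · simp
  · intro j _ hj
    simp [Ne.symm hj]
  · simp

/-- The map `x ↦ ((w, u) ↦ (x ∧ w, x ⊗ w - shift x u))`. -/
def coderivOp : 𝔤 →ₗ[ℂ] Module.End ℂ (SuperExterior 𝒢 × (𝔤 ⊗[ℂ] SuperExterior 𝒢)) where
  toFun x := LinearMap.prod (LinearMap.mulLeft ℂ (ι 𝒢 x) ∘ₗ LinearMap.fst ℂ _ _)
    (TensorProduct.mk ℂ 𝔤 (SuperExterior 𝒢) x ∘ₗ LinearMap.fst ℂ _ _ -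
      shift 𝒢 x ∘ₗ LinearMap.snd ℂ _ _)
  map_add' x y := by
    refine LinearMap.ext fun z => Prod.ext ?_ ?_
    · simp [add_mul]
    · simp
      abel
  map_smul' r x := by
    refine LinearMap.ext fun z => Prod.ext ?_ ?_
    · simp
    · simp [TensorProduct.smul_tmul', smul_sub]

theorem coderivOp_apply (x : 𝔤) (z : SuperExterior 𝒢 × (𝔤 ⊗[ℂ] SuperExterior 𝒢)) :
    coderivOp 𝒢 x z = (ι 𝒢 x * z.1, x ⊗ₜ z.1 - shift 𝒢 x z.2) := rfl

theorem shift_rel {i j : ZMod 2} {a b : 𝔤} (ha : a ∈ 𝒢 i) (hb : b ∈ 𝒢 j)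
    (u : 𝔤 ⊗[ℂ] SuperExterior 𝒢) :
    shift 𝒢 a (shift 𝒢 b u) + koszul i j • shift 𝒢 b (shift 𝒢 a u) = 0 := by
  induction u with
  | zero => simp
  | add u v hu hv =>
    simp only [map_add, smul_add]
    rw [add_add_add_comm, hu, hv, add_zero]
  | tmul y w =>
    simp only [shift_tmul 𝒢 ha, shift_tmul 𝒢 hb]
    rw [twist_comm _ i j, ← TensorProduct.tmul_smul, ← TensorProduct.tmul_add, ← mul_assoc,
      ← mul_assoc, ← smul_mul_assoc, ← add_mul, ι_mul_ι 𝒢 ha hb, zero_mul, TensorProduct.tmul_zero]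

theorem coderivOp_rel (i j : ZMod 2) (a b : 𝔤) (ha : a ∈ 𝒢 i) (hb : b ∈ 𝒢 j) :
    coderivOp 𝒢 a * coderivOp 𝒢 b + koszul i j • (coderivOp 𝒢 b * coderivOp 𝒢 a) = 0 := by
  refine LinearMap.ext fun z => Prod.ext ?_ ?_
  · simp only [LinearMap.add_apply, LinearMap.smul_apply, Module.End.mul_apply, coderivOp_apply,
      Prod.fst_add, Prod.smul_fst, LinearMap.zero_apply, Prod.fst_zero]
    rw [← mul_assoc, ← mul_assoc, ← smul_mul_assoc, ← add_mul, ι_mul_ι 𝒢 ha hb, zero_mul]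
  · simp only [LinearMap.add_apply, LinearMap.smul_apply, Module.End.mul_apply, coderivOp_apply,
      Prod.snd_add, Prod.smul_snd, LinearMap.zero_apply, Prod.snd_zero, map_sub, smul_sub,
      shift_tmul 𝒢 ha, shift_tmul 𝒢 hb, twist_of_mem 𝒢 ha, twist_of_mem 𝒢 hb,
      ← TensorProduct.smul_tmul', smul_smul, koszul_comm j i, koszul_mul_self, one_smul]
    have h := shift_rel 𝒢 ha hb z.2
    rw [← h]
    abel

/-- The component `⋀ⁿ 𝔤 → 𝔤 ⊗ ⋀ⁿ⁻¹ 𝔤` of the coproduct of `⋀ 𝔤`,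
`x₁ ∧ ⋯ ∧ xₙ ↦ ∑ i, (-1)^{i-1+α_i} x_i ⊗ (x₁ ∧ ⋯ x̂_i ⋯ ∧ xₙ)` with
`α_i = |x_i| (|x₁| + ⋯ + |x_{i-1}|)`; see `coderiv_wedge`. -/
def coderiv : SuperExterior 𝒢 →ₗ[ℂ] 𝔤 ⊗[ℂ] SuperExterior 𝒢 :=
  LinearMap.snd ℂ _ _ ∘ₗ LinearMap.applyₗ ((1 : SuperExterior 𝒢), (0 : 𝔤 ⊗[ℂ] SuperExterior 𝒢)) ∘ₗ
    (lift 𝒢 (coderivOp 𝒢) (coderivOp_rel 𝒢)).toLinearMap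

theorem coderiv_one : coderiv 𝒢 1 = 0 := by
  simp [coderiv]

theorem lift_coderivOp_fst (w : SuperExterior 𝒢)
    (z : SuperExterior 𝒢 × (𝔤 ⊗[ℂ] SuperExterior 𝒢)) :
    (lift 𝒢 (coderivOp 𝒢) (coderivOp_rel 𝒢) w z).1 = w * z.1 := by
  obtain ⟨t, rfl⟩ := mk_surjective 𝒢 w
  induction t using TensorAlgebra.induction generalizing z with
  | algebraMap r => simp [Algebra.smul_def]
  | ι x =>
    change (lift 𝒢 (coderivOp 𝒢) (coderivOp_rel 𝒢) (ι 𝒢 x) z).1 = ι 𝒢 x * z.1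
    rw [lift_ι, coderivOp_apply]
  | mul s t hs ht => rw [map_mul, map_mul, Module.End.mul_apply, hs, ht, mul_assoc]
  | add s t hs ht => rw [map_add, map_add, LinearMap.add_apply, Prod.fst_add, hs, ht, add_mul]

theorem coderiv_ι_mul (x : 𝔤) (w : SuperExterior 𝒢) :
    coderiv 𝒢 (ι 𝒢 x * w) = x ⊗ₜ w - shift 𝒢 x (coderiv 𝒢 w) := by
  have h := lift_coderivOp_fst 𝒢 w (1, 0)
  simp only [mul_one] at h
  simp only [coderiv, LinearMap.comp_apply, AlgHom.toLinearMap_apply, map_mul, lift_ι,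
    LinearMap.applyₗ_apply_apply, Module.End.mul_apply, coderivOp_apply, h, LinearMap.snd_apply]

/-- The sign `(-1)^{i+α_i}` (with `i` counted from `0`) of moving the `i`-th of the elements
`x₀, …, xₙ₋₁` of parities `p` to the front of `x₀ ∧ ⋯ ∧ xₙ₋₁`. -/
def frontSign {n : ℕ} (p : Fin n → ZMod 2) (i : Fin n) : ℂ :=
  (-1) ^ (i : ℕ) * ∏ k ∈ Finset.Iio i, koszul (p k) (p i)

theorem frontSign_zero {n : ℕ} (p : Fin (n + 1) → ZMod 2) : frontSign p 0 = 1 := by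
  have h : Finset.Iio (0 : Fin (n + 1)) = ∅ := by
    ext k
    simp
  simp [frontSign, h]

theorem frontSign_succ {n : ℕ} (p : Fin (n + 1) → ZMod 2) (i : Fin n) :
    frontSign p i.succ = -(koszul (p 0) (p i.succ) * frontSign (fun k => p k.succ) i) := by
  have h : Finset.Iio i.succ = insert 0 ((Finset.Iio i).map (Fin.succEmb n)) := by
    ext k
    refine Fin.cases ?_ (fun k => ?_) k <;> simp
  rw [frontSign, h, Finset.prod_insert (by simp), Finset.prod_map]
  simp [frontSign, pow_succ]
  ring

theorem frontSign_succAbove_of_lt {n : ℕ} (p : Fin (n + 1) → ZMod 2) {a : Fin (n + 1)} {b : Fin n}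
    (h : b.castSucc < a) : frontSign (fun k => p (a.succAbove k)) b = frontSign p b.castSucc := by
  have h' : Finset.Iio b.castSucc = (Finset.Iio b).map Fin.castSuccEmb := by
    ext k
    refine Fin.lastCases ?_ (fun k => ?_) k
    · simp
    · simp
  rw [frontSign, frontSign, h', Finset.prod_map]
  simp only [Fin.val_castSucc, Fin.coe_castSuccEmb, Fin.succAbove_of_castSucc_lt a b h]
  congr 1
  refine Finset.prod_congr rfl fun k hk => ?_
  rw [Fin.succAbove_of_castSucc_lt a k (lt_trans (by simpa using hk) h)]

theorem frontSign_succAbove_of_le {n : ℕ} (p : Fin (n + 1) → ZMod 2) {a : Fin (n + 1)} {b : Fin n}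
    (h : a ≤ b.castSucc) : frontSign (fun k => p (a.succAbove k)) b =
      -(koszul (p a) (p b.succ) * frontSign p b.succ) := by
  have h' : Finset.Iio b.succ = insert a ((Finset.Iio b).map a.succAboveEmb) := by
    ext k
    simp only [Finset.mem_Iio, Finset.mem_insert, Finset.mem_map, Fin.coe_succAboveEmb]
    constructor
    · intro hk
      by_cases hka : k = a
      · exact Or.inl hka
      · obtain ⟨l, rfl⟩ := Fin.exists_succAbove_eq hka
        refine Or.inr ⟨l, ?_, rfl⟩
        rw [← Fin.succAbove_of_le_castSucc a b h] at hk
        exact (Fin.strictMono_succAbove a).lt_iff_lt.1 hk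
    · rintro (rfl | ⟨l, hl, rfl⟩)
      · exact lt_of_le_of_lt h Fin.castSucc_lt_succ
      · rw [← Fin.succAbove_of_le_castSucc a b h]
        exact Fin.strictMono_succAbove a hl
  rw [frontSign, frontSign, h', Finset.prod_insert (by
    simp [Fin.succAbove_ne]), Finset.prod_map]
  simp only [Fin.val_succ, Fin.coe_succAboveEmb, Fin.succAbove_of_le_castSucc a b h, pow_succ]
  have hk := koszul_mul_self (p a) (p b.succ)
  linear_combination (-(-1 : ℂ) ^ (b : ℕ) *
    ∏ k ∈ Finset.Iio b, koszul (p (a.succAbove k)) (p b.succ)) * hk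

theorem wedge_succ {n : ℕ} (x : Fin (n + 1) → 𝔤) :
    wedge 𝒢 x = ι 𝒢 (x 0) * wedge 𝒢 (fun k => x k.succ) := by
  simp [wedge, List.ofFn_succ]

theorem coderiv_wedge {n : ℕ} (p : Fin (n + 1) → ZMod 2) (x : Fin (n + 1) → 𝔤)
    (hx : ∀ k, x k ∈ 𝒢 (p k)) :
    coderiv 𝒢 (wedge 𝒢 x) =
      ∑ i, frontSign p i • (x i ⊗ₜ[ℂ] wedge 𝒢 (fun k => x (i.succAbove k))) := by
  induction n with
  | zero =>
    rw [wedge_succ, coderiv_ι_mul]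
    simp [wedge, coderiv_one, frontSign_zero]
  | succ n ih =>
    rw [wedge_succ, coderiv_ι_mul, ih (fun k => p k.succ) _ (fun k => hx k.succ), sub_eq_add_neg,
      map_sum, ← Finset.sum_neg_distrib]
    conv_rhs => rw [Fin.sum_univ_succ]
    congr 1
    · simp [frontSign_zero]
    · refine Finset.sum_congr rfl fun i _ => ?_
      rw [map_smul, shift_tmul 𝒢 (hx 0), twist_of_mem 𝒢 (hx i.succ), frontSign_succ, neg_smul,
        mul_comm, mul_smul, wedge_succ 𝒢 (fun k => x (i.succ.succAbove k)),
        ← TensorProduct.smul_tmul']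
      simp

end SuperExterior

end Exterior

namespace SuperLieAlgebra

open SuperExterior

variable {𝔤 : Type u} [AddCommGroup 𝔤] [Module ℂ 𝔤] {𝒢 : ZMod 2 → Submodule ℂ 𝔤}
  [DirectSum.Decomposition 𝒢] {L : SuperLieAlgebra 𝒢}

/-! ### Homology of a super Lie algebra with coefficients in a character -/

namespace Character

variable (δ : L.Character)

variable (L) in
/-- The map `x ⊗ (y ⊗ w) ↦ [x, y] ∧ w`. -/
def bracketWedge : 𝔤 ⊗[ℂ] (𝔤 ⊗[ℂ] SuperExterior 𝒢) →ₗ[ℂ] SuperExterior 𝒢 :=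
  LinearMap.mul' ℂ (SuperExterior 𝒢) ∘ₗ
    (ι 𝒢 ∘ₗ TensorProduct.lift L.bracket).rTensor (SuperExterior 𝒢) ∘ₗ
    (TensorProduct.assoc ℂ 𝔤 𝔤 (SuperExterior 𝒢)).symm.toLinearMap

theorem bracketWedge_tmul (x y : 𝔤) (w : SuperExterior 𝒢) :
    bracketWedge L (x ⊗ₜ (y ⊗ₜ w)) = ι 𝒢 (L.bracket x y) * w := by
  simp [bracketWedge]

/-- The Chevalley–Eilenberg differential of `⋀ 𝔤` with coefficients in `ℂ_δ`, i.e.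
`d = (δ ⊗ 1) ∂ - 1/2 [·,·] (1 ⊗ ∂) ∂` with `∂ = coderiv`.  On `x₁ ∧ ⋯ ∧ xₙ` it is
`∑ i, (-1)^{i+1+α_i} δ(x_i) x₁ ∧ ⋯ x̂_i ⋯ ∧ xₙ +
∑ i < j, (-1)^{i+j+α_i+α_j-|x_i||x_j|} [x_i,x_j] ∧ x₁ ∧ ⋯ x̂_i ⋯ x̂_j ⋯ ∧ xₙ`
(each pair is met twice by `(1 ⊗ ∂) ∂`); see `ceDifferential_wedge`. -/
def ceDifferential : SuperExterior 𝒢 →ₗ[ℂ] SuperExterior 𝒢 :=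
  (TensorProduct.lid ℂ (SuperExterior 𝒢)).toLinearMap ∘ₗ
      δ.toLinearMap.rTensor (SuperExterior 𝒢) ∘ₗ coderiv 𝒢 -
    (2⁻¹ : ℂ) • (bracketWedge L ∘ₗ (coderiv 𝒢).lTensor 𝔤 ∘ₗ coderiv 𝒢)

theorem ceDifferential_one : δ.ceDifferential 1 = 0 := by
  simp [ceDifferential, coderiv_one]

theorem ceDifferential_ι (x : 𝔤) : δ.ceDifferential (ι 𝒢 x) = algebraMap ℂ _ (δ.toLinearMap x) := by
  have h := coderiv_ι_mul 𝒢 x 1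
  rw [mul_one, coderiv_one, map_zero, sub_zero] at h
  simp [ceDifferential, h, coderiv_one, Algebra.algebraMap_eq_smul_one]

/-- The formula for the Chevalley–Eilenberg differential on homogeneous elements; the second sum
is over the pairs `i < j`. -/
theorem ceDifferential_wedge {n : ℕ} (p : Fin (n + 2) → ZMod 2) (x : Fin (n + 2) → 𝔤)
    (hx : ∀ k, x k ∈ 𝒢 (p k)) :
    δ.ceDifferential (wedge 𝒢 x) =
      ∑ i, frontSign p i • δ.toLinearMap (x i) • wedge 𝒢 (fun k => x (i.succAbove k)) +
      ∑ j : Fin (n + 2), ∑ i : Fin (n + 1), if i.castSucc < j then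
        (frontSign p i.castSucc * frontSign p j * koszul (p i.castSucc) (p j)) •
          (ι 𝒢 (L.bracket (x i.castSucc) (x j)) *
            wedge 𝒢 (fun k => x (j.succAbove (i.succAbove k)))) else 0 := by
  have h1 := coderiv_wedge 𝒢 p x hx
  have h2 : ∀ a : Fin (n + 2), coderiv 𝒢 (wedge 𝒢 fun k => x (a.succAbove k)) = _ := fun a =>
    coderiv_wedge 𝒢 (fun k => p (a.succAbove k)) _ (fun k => hx (a.succAbove k))
  let f : Fin (n + 2) → Fin (n + 1) → SuperExterior 𝒢 := fun a b =>
    (frontSign p a * frontSign (fun k => p (a.succAbove k)) b) •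
      (ι 𝒢 (L.bracket (x a) (x (a.succAbove b))) *
        wedge 𝒢 (fun k => x (a.succAbove (b.succAbove k))))
  have h3 : bracketWedge L ((coderiv 𝒢).lTensor 𝔤 (coderiv 𝒢 (wedge 𝒢 x))) =
      ∑ a, ∑ b, f a b := by
    simp only [h1, map_sum, map_smul, LinearMap.lTensor_tmul, h2, TensorProduct.tmul_sum,
      TensorProduct.tmul_smul, bracketWedge_tmul, Finset.smul_sum, smul_smul, f]
  have hlt : ∀ (a : Fin (n + 2)) (b : Fin (n + 1)), b.castSucc < a → f a b =
      -((frontSign p b.castSucc * frontSign p a * koszul (p b.castSucc) (p a)) •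
          (ι 𝒢 (L.bracket (x b.castSucc) (x a)) *
            wedge 𝒢 (fun k => x (a.succAbove (b.succAbove k))))) := by
    intro a b h
    simp only [f]
    rw [frontSign_succAbove_of_lt p h, Fin.succAbove_of_castSucc_lt a b h,
      L.skew (hx a) (hx b.castSucc), map_neg, map_smul, neg_mul, smul_mul_assoc, smul_neg, smul_smul,
      koszul_comm, mul_comm (frontSign p a)]
  have hswap : ∀ (a : Fin (n + 2)) (b : Fin (n + 1)), b.castSucc < a →
      f (a.succAbove b) (b.predAbove a) = f a b := by
    intro a b h
    have hle : b.castSucc ≤ (b.predAbove a).castSucc := by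
      rw [Fin.predAbove_of_castSucc_lt b a h, Fin.castSucc_le_castSucc_iff, Fin.le_def]
      rw [Fin.lt_def] at h
      simp at h ⊢
      omega
    have hs : (b.predAbove a).succ = a := by
      rw [Fin.predAbove_of_castSucc_lt b a h, Fin.succ_pred]
    rw [hlt a b h]
    simp only [f, Fin.succAbove_succAbove_succAbove_predAbove]
    rw [Fin.succAbove_of_castSucc_lt a b h, frontSign_succAbove_of_le p hle,
      Fin.succAbove_of_le_castSucc _ _ hle, hs, ← neg_smul]
    congr 1
    ring
  have hle : ∀ (a : Fin (n + 2)) (b : Fin (n + 1)), b.castSucc < a →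
      a.succAbove b ≤ (b.predAbove a).castSucc := by
    intro a b h
    rw [Fin.succAbove_of_castSucc_lt a b h, Fin.predAbove_of_castSucc_lt b a h,
      Fin.castSucc_le_castSucc_iff, Fin.le_def]
    rw [Fin.lt_def] at h
    simp at h ⊢
    omega
  have hge : ∀ (a : Fin (n + 2)) (b : Fin (n + 1)), ¬ b.castSucc < a →
      (b.predAbove a).castSucc < a.succAbove b := by
    intro a b h
    rw [not_lt] at h
    rw [Fin.succAbove_of_le_castSucc a b h, Fin.predAbove_of_le_castSucc b a h,
      Fin.castSucc_castPred]
    exact lt_of_le_of_lt h Fin.castSucc_lt_succ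
  have hsum : ∑ q : Fin (n + 2) × Fin (n + 1) with ¬ q.2.castSucc < q.1, f q.1 q.2 =
      ∑ q : Fin (n + 2) × Fin (n + 1) with q.2.castSucc < q.1, f q.1 q.2 := by
    symm
    refine Finset.sum_nbij' (fun q => (q.1.succAbove q.2, q.2.predAbove q.1))
      (fun q => (q.1.succAbove q.2, q.2.predAbove q.1)) ?_ ?_ ?_ ?_ ?_
    · rintro ⟨a, b⟩ h
      simpa using hle a b (by simpa using h)
    · rintro ⟨a, b⟩ h
      simpa using hge a b (by simpa using h)
    · rintro ⟨a, b⟩ _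
      simp [Fin.succAbove_succAbove_predAbove, Fin.predAbove_predAbove_succAbove]
    · rintro ⟨a, b⟩ _
      simp [Fin.succAbove_succAbove_predAbove, Fin.predAbove_predAbove_succAbove]
    · rintro ⟨a, b⟩ h
      exact (hswap a b (by simpa using h)).symm
  have hT : ∑ a, ∑ b, f a b = (2 : ℂ) •
      ∑ q : Fin (n + 2) × Fin (n + 1) with q.2.castSucc < q.1, f q.1 q.2 := by
    rw [← Fintype.sum_prod_type' f, ← Finset.sum_filter_add_sum_filter_not Finset.univ
      (fun q : Fin (n + 2) × Fin (n + 1) => q.2.castSucc < q.1), hsum, two_smul]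
  have hE : ∑ q : Fin (n + 2) × Fin (n + 1) with q.2.castSucc < q.1, f q.1 q.2 =
      -∑ j : Fin (n + 2), ∑ i : Fin (n + 1), if i.castSucc < j then
        (frontSign p i.castSucc * frontSign p j * koszul (p i.castSucc) (p j)) •
          (ι 𝒢 (L.bracket (x i.castSucc) (x j)) *
            wedge 𝒢 (fun k => x (j.succAbove (i.succAbove k)))) else 0 := by
    rw [Finset.sum_filter, Fintype.sum_prod_type, ← Finset.sum_neg_distrib]
    refine Finset.sum_congr rfl fun a _ => ?_
    rw [← Finset.sum_neg_distrib]
    refine Finset.sum_congr rfl fun b _ => ?_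
    split_ifs with h
    · exact hlt a b h
    · rw [neg_zero]
  simp only [ceDifferential, LinearMap.sub_apply, LinearMap.smul_apply, LinearMap.comp_apply,
    h3, hT, hE, smul_smul]
  rw [h1]
  simp [smul_smul]

/-- The cycles of degree `i`. -/
def cycles (i : ℕ) : Submodule ℂ (SuperExterior 𝒢) :=
  LinearMap.ker δ.ceDifferential ⊓ power 𝒢 i

/-- The boundaries of degree `i`. -/
def boundaries (i : ℕ) : Submodule ℂ (SuperExterior 𝒢) := (power 𝒢 (i + 1)).map δ.ceDifferential

/-- The homology `H_i(𝔤; ℂ_δ)`. -/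
abbrev Homology (i : ℕ) : Type u := δ.cycles i ⧸ (δ.boundaries i).submoduleOf (δ.cycles i)

end Character

/-! ### Antisymmetrization -/

variable (L) in
/-- The antisymmetrization map `A : ⋀ⁿ 𝔤 → U(𝔤)^{⊗ n}`, extended by `0` to the other exterior
powers.  It is the expansion
`A (x₁ ∧ ⋯ ∧ xₙ) = 1/n ∑ i, (-1)^{i-1+α_i} x_i ⊗ A (x₁ ∧ ⋯ x̂_i ⋯ ∧ xₙ)` of
`A (x₁ ∧ ⋯ ∧ xₙ) = 1/n! ∑ σ ∈ Sₙ, (-1)^{α_σ} sign(σ) (x_{σ(1)}, …, x_{σ(n)})`;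
see `antisymmetrization_wedge`. -/
def antisymmetrization : (n : ℕ) → SuperExterior 𝒢 →ₗ[ℂ] ⨂[ℂ]^n L.Enveloping
  | 0 => (PiTensorProduct.isEmptyEquiv (R := ℂ) (s := fun _ : Fin 0 => L.Enveloping)
      (Fin 0)).symm.toLinearMap ∘ₗ (augmentation 𝒢).toLinearMap
  | n + 1 => ((n : ℂ) + 1)⁻¹ • ((consEquiv L.Enveloping n).toLinearMap ∘ₗ
      TensorProduct.map (Enveloping.ι L) (antisymmetrization n) ∘ₗ coderiv 𝒢)

/-- The Koszul sign `(-1)^{α_σ}` of a permutation of elements of parities `p`: it contains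
`(-1)^{|a||b|}` for any two elements `a`, `b` that cross each other. -/
def koszulPerm {n : ℕ} (p : Fin n → ZMod 2) (σ : Equiv.Perm (Fin n)) : ℂ :=
  ∏ a, ∏ b, if a < b ∧ σ b < σ a then koszul (p (σ a)) (p (σ b)) else 1

theorem koszulPerm_succ {n : ℕ} (p : Fin (n + 1) → ZMod 2) (i : Fin (n + 1))
    (σ : Equiv.Perm (Fin n)) :
    koszulPerm p (i.cycleRange.symm * Equiv.Perm.decomposeFin.symm (0, σ)) =
      (∏ k ∈ Finset.Iio i, koszul (p k) (p i)) * koszulPerm (fun k => p (i.succAbove k)) σ := by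
  have h0 : (i.cycleRange.symm * Equiv.Perm.decomposeFin.symm (0, σ)) 0 = i := by
    simp
  have hs : ∀ k : Fin n, (i.cycleRange.symm * Equiv.Perm.decomposeFin.symm (0, σ)) k.succ =
      i.succAbove (σ k) := by
    intro k
    simp
  rw [koszulPerm, Fin.prod_univ_succ]
  congr 1
  · rw [Fin.prod_univ_succ]
    simp only [h0, hs, lt_self_iff_false, false_and, if_false, one_mul, Fin.succ_pos, true_and]
    rw [Equiv.prod_comp σ (fun k => if i.succAbove k < i then
      koszul (p i) (p (i.succAbove k)) else 1)]
    have h := Fin.prod_univ_succAbove (fun m => if m < i then koszul (p i) (p m) else 1) i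
    simp only [lt_self_iff_false, if_false, one_mul] at h
    rw [← h, ← Finset.prod_filter]
    refine Finset.prod_congr (by ext; simp) fun k _ => koszul_comm _ _
  · refine Finset.prod_congr rfl fun a _ => ?_
    rw [Fin.prod_univ_succ]
    simp [h0, hs, (Fin.strictMono_succAbove i).lt_iff_lt]

/-- The antisymmetrization map is given by the usual formula. -/
theorem antisymmetrization_wedge {n : ℕ} (p : Fin n → ZMod 2) (x : Fin n → 𝔤)
    (hx : ∀ k, x k ∈ 𝒢 (p k)) :
    antisymmetrization L n (wedge 𝒢 x) = ((n.factorial : ℂ))⁻¹ • ∑ σ : Equiv.Perm (Fin n),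
      (koszulPerm p σ * (Equiv.Perm.sign σ : ℤ)) •
        PiTensorProduct.tprod ℂ (fun k => Enveloping.ι L (x (σ k))) := by
  induction n with
  | zero =>
    rw [antisymmetrization, LinearMap.comp_apply, LinearEquiv.coe_coe,
      LinearEquiv.symm_apply_eq]
    simp [wedge, koszulPerm]
  | succ n ih =>
    have hbij : Function.Bijective (fun q : Fin (n + 1) × Equiv.Perm (Fin n) =>
        q.1.cycleRange.symm * Equiv.Perm.decomposeFin.symm (0, q.2)) := by
      rw [Fintype.bijective_iff_injective_and_card]
      constructor
      · rintro ⟨i, σ⟩ ⟨j, τ⟩ h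
        have h0 := congrArg (fun ρ : Equiv.Perm (Fin (n + 1)) => ρ 0) h
        simp only [Equiv.Perm.mul_apply, Equiv.Perm.decomposeFin_symm_apply_zero,
          Fin.cycleRange_symm_zero] at h0
        subst h0
        simpa using h
      · simp [Fintype.card_perm, Nat.factorial_succ]
    rw [← hbij.sum_comp, Fintype.sum_prod_type]
    simp only [antisymmetrization, LinearMap.smul_apply, LinearMap.comp_apply,
      coderiv_wedge 𝒢 p x hx, map_sum, map_smul, TensorProduct.map_tmul,
      fun i : Fin (n + 1) => ih (fun k => p (i.succAbove k)) _ (fun k => hx (i.succAbove k)),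
      Finset.smul_sum, TensorProduct.tmul_sum, TensorProduct.tmul_smul, LinearEquiv.coe_coe,
      consEquiv_tmul_tprod, smul_smul, koszulPerm_succ]
    refine Finset.sum_congr rfl fun i _ => Finset.sum_congr rfl fun σ _ => ?_
    congr 1
    · simp only [Equiv.Perm.sign_mul, Equiv.Perm.sign_symm, Fin.sign_cycleRange,
        Equiv.Perm.decomposeFin.symm_sign, frontSign, Nat.factorial_succ]
      push_cast
      rw [mul_inv]
      simp
      ring
    · congr 1
      ext k
      refine Fin.cases ?_ (fun k => ?_) k <;> simp

end SuperLieAlgebra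
end SuperHopf

end

noncomputable section

set_option linter.unusedSectionVars false

namespace SuperHopf

universe u

/-- The tensor `(v, c₁, …, cₙ)`. -/
notation:70 v:71 " ⊹ " c:70 => consEquiv _ _ (v ⊗ₜ[ℂ] c)

/-! ### Koszul signs and twists -/

theorem koszul_sum_right {ι : Type*} (s : Finset ι) (p : ι → ZMod 2) (i : ZMod 2) :
    koszul i (∑ k ∈ s, p k) = ∏ k ∈ s, koszul i (p k) := by
  classical
  induction s using Finset.induction_on with
  | empty => simp [koszul_zero_right]
  | insert a s ha ih => rw [Finset.sum_insert ha, Finset.prod_insert ha, koszul_add_right, ih]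

theorem koszul_self (i : ZMod 2) : koszul i i = koszul 1 i := by
  rcases parity_cases i with rfl | rfl
  · rw [koszul_zero_left, koszul_zero_right]
  · rfl

section Twist

variable {V : Type*} [AddCommGroup V] [Module ℂ V] (𝒱 : ZMod 2 → Submodule ℂ V)
  [DirectSum.Decomposition 𝒱]

theorem twist_mem {i : ZMod 2} {v : V} (hv : v ∈ 𝒱 i) (j : ZMod 2) : twist 𝒱 j v ∈ 𝒱 i := by
  rw [twist_of_mem 𝒱 hv]
  exact Submodule.smul_mem _ _ hv

theorem twist_add (i j : ZMod 2) (v : V) : twist 𝒱 (i + j) v = twist 𝒱 i (twist 𝒱 j v) := by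
  have h2 : (1 + 1 : ZMod 2) = 0 := rfl
  rcases parity_cases i with rfl | rfl <;> rcases parity_cases j with rfl | rfl <;>
    simp [twist_zero, twist_twist, h2]

/-- The map `x ⊗ y ⊗ c ↦ (-1)^{|x||y|} y ⊗ x ⊗ c`. -/
def braid (X : Type*) [AddCommGroup X] [Module ℂ X] : V ⊗[ℂ] (V ⊗[ℂ] X) →ₗ[ℂ] V ⊗[ℂ] (V ⊗[ℂ] X) :=
  ∑ i : ZMod 2, (TensorProduct.leftComm ℂ V V X).toLinearMap ∘ₗ
    TensorProduct.map (homProj 𝒱 i) ((twist 𝒱 i).rTensor X)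

variable {X : Type*} [AddCommGroup X] [Module ℂ X]

theorem braid_tmul {i : ZMod 2} {x : V} (hx : x ∈ 𝒱 i) (y : V) (c : X) :
    braid 𝒱 X (x ⊗ₜ (y ⊗ₜ c)) = twist 𝒱 i y ⊗ₜ (x ⊗ₜ c) := by
  simp only [braid, LinearMap.sum_apply, LinearMap.comp_apply, TensorProduct.map_tmul,
    homProj_of_mem 𝒱 hx]
  rw [Finset.sum_eq_single i]
  · simp
  · intro j _ hj
    simp [Ne.symm hj]
  · simp

theorem tensor_ext_hom {W : Type*} [AddCommGroup W] [Module ℂ W] {f g : V ⊗[ℂ] X →ₗ[ℂ] W}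
    (h : ∀ i, ∀ v ∈ 𝒱 i, ∀ c, f (v ⊗ₜ c) = g (v ⊗ₜ c)) : f = g := by
  refine TensorProduct.ext' fun v c => ?_
  exact hom_induction 𝒱 v (fun x y hx hy => by
    rw [TensorProduct.add_tmul, map_add, map_add, hx, hy]) (fun i x hx => h i x hx c)

theorem tensor_ext_hom₂ {W : Type*} [AddCommGroup W] [Module ℂ W]
    {f g : V ⊗[ℂ] (V ⊗[ℂ] X) →ₗ[ℂ] W}
    (h : ∀ i, ∀ v ∈ 𝒱 i, ∀ j, ∀ v' ∈ 𝒱 j, ∀ c, f (v ⊗ₜ (v' ⊗ₜ c)) = g (v ⊗ₜ (v' ⊗ₜ c))) :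
    f = g := by
  refine tensor_ext_hom 𝒱 fun i v hv t => ?_
  exact LinearMap.congr_fun (f := f ∘ₗ TensorProduct.mk ℂ V (V ⊗[ℂ] X) v)
    (g := g ∘ₗ TensorProduct.mk ℂ V (V ⊗[ℂ] X) v)
    (tensor_ext_hom 𝒱 fun j v' hv' c => h i v hv j v' hv' c) t

theorem braid_braid (t : V ⊗[ℂ] (V ⊗[ℂ] X)) : braid 𝒱 X (braid 𝒱 X t) = t := by
  refine LinearMap.congr_fun (f := braid 𝒱 X ∘ₗ braid 𝒱 X) (g := LinearMap.id)
    (tensor_ext_hom₂ 𝒱 fun i v hv j v' hv' c => ?_) t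
  simp only [LinearMap.comp_apply, LinearMap.id_apply]
  rw [braid_tmul 𝒱 hv, braid_tmul 𝒱 (twist_mem 𝒱 hv' i), twist_of_mem 𝒱 hv, twist_of_mem 𝒱 hv']
  rw [← TensorProduct.smul_tmul', ← TensorProduct.smul_tmul', TensorProduct.tmul_smul, smul_smul,
    koszul_comm, koszul_mul_self, one_smul]

theorem braid_natural {Y : Type*} [AddCommGroup Y] [Module ℂ Y] (f : X →ₗ[ℂ] Y)
    (t : V ⊗[ℂ] (V ⊗[ℂ] X)) :
    braid 𝒱 Y ((f.lTensor V).lTensor V t) = (f.lTensor V).lTensor V (braid 𝒱 X t) := by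
  refine LinearMap.congr_fun (f := braid 𝒱 Y ∘ₗ (f.lTensor V).lTensor V)
    (g := (f.lTensor V).lTensor V ∘ₗ braid 𝒱 X)
    (tensor_ext_hom₂ 𝒱 fun i v hv j v' hv' c => ?_) t
  simp [braid_tmul 𝒱 hv]

end Twist

/-! ### Tensor powers -/

section TensorPower

variable {V : Type*} [AddCommGroup V] [Module ℂ V]

theorem cons_induction {n : ℕ} {P : (⨂[ℂ]^(n + 1) V) → Prop} (c : ⨂[ℂ]^(n + 1) V) (zero : P 0)
    (add : ∀ a b, P a → P b → P (a + b)) (cons : ∀ (v : V) (c : ⨂[ℂ]^n V), P (v ⊹ c)) : P c := by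
  obtain ⟨t, rfl⟩ := (consEquiv V n).surjective c
  induction t with
  | zero => simpa using zero
  | tmul v c => exact cons v c
  | add s t hs ht => rw [map_add]; exact add _ _ hs ht

theorem power_ext {n : ℕ} {W : Type*} [AddCommGroup W] [Module ℂ W]
    {f g : (⨂[ℂ]^(n + 1) V) →ₗ[ℂ] W} (h : ∀ (v : V) (c : ⨂[ℂ]^n V), f (v ⊹ c) = g (v ⊹ c)) :
    f = g := by
  exact LinearMap.ext fun t => cons_induction (P := fun t => f t = g t) t
    (by rw [map_zero, map_zero]) (fun a b ha hb => by rw [map_add, map_add, ha, hb]) h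

theorem consMap_cons {m n : ℕ} (f : (⨂[ℂ]^m V) →ₗ[ℂ] ⨂[ℂ]^n V) (v : V) (c : ⨂[ℂ]^m V) :
    consMap f (v ⊹ c) = v ⊹ f c := by
  simp [consMap]

theorem consWith_eq (v : V) (n : ℕ) (c : ⨂[ℂ]^n V) : consWith v n c = v ⊹ c := rfl

theorem consMap_id (n : ℕ) : consMap (LinearMap.id : (⨂[ℂ]^n V) →ₗ[ℂ] ⨂[ℂ]^n V) = LinearMap.id :=
  power_ext fun v c => by simp [consMap_cons]

theorem add_cons {n : ℕ} (v w : V) (c : ⨂[ℂ]^n V) : (v + w) ⊹ c = (v ⊹ c) + (w ⊹ c) := by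
  rw [TensorProduct.add_tmul, map_add]

theorem sub_cons {n : ℕ} (v w : V) (c : ⨂[ℂ]^n V) : (v - w) ⊹ c = (v ⊹ c) - (w ⊹ c) := by
  rw [TensorProduct.sub_tmul, map_sub]

theorem smul_cons {n : ℕ} (r : ℂ) (v : V) (c : ⨂[ℂ]^n V) : (r • v) ⊹ c = r • (v ⊹ c) := by
  rw [← TensorProduct.smul_tmul', map_smul]

theorem cons_add {n : ℕ} (v : V) (c d : ⨂[ℂ]^n V) : v ⊹ (c + d) = (v ⊹ c) + (v ⊹ d) := by
  rw [TensorProduct.tmul_add, map_add]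

theorem cons_sub {n : ℕ} (v : V) (c d : ⨂[ℂ]^n V) : v ⊹ (c - d) = (v ⊹ c) - (v ⊹ d) := by
  rw [TensorProduct.tmul_sub, map_sub]

theorem cons_smul {n : ℕ} (r : ℂ) (v : V) (c : ⨂[ℂ]^n V) : v ⊹ (r • c) = r • (v ⊹ c) := by
  rw [TensorProduct.tmul_smul, map_smul]

theorem cons_neg {n : ℕ} (v : V) (c : ⨂[ℂ]^n V) : v ⊹ (-c) = -(v ⊹ c) := by
  rw [TensorProduct.tmul_neg, map_neg]

theorem cons_zero {n : ℕ} (v : V) : v ⊹ (0 : ⨂[ℂ]^n V) = 0 := by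
  rw [TensorProduct.tmul_zero, map_zero]

/-- The operation `t ⊗ c ↦ (t, c)` on `(V ⊗ V) ⊗ V^{⊗ n}`. -/
def cons₂ (n : ℕ) : (V ⊗[ℂ] V) ⊗[ℂ] (⨂[ℂ]^n V) →ₗ[ℂ] ⨂[ℂ]^(n + 2) V :=
  (consEquiv V (n + 1)).toLinearMap ∘ₗ (consEquiv V n).toLinearMap.lTensor V ∘ₗ
      (TensorProduct.assoc ℂ V V (⨂[ℂ]^n V)).toLinearMap

theorem cons₂_tmul {n : ℕ} (v w : V) (c : ⨂[ℂ]^n V) : cons₂ n ((v ⊗ₜ w) ⊗ₜ c) = v ⊹ w ⊹ c := by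
  simp [cons₂]

variable (𝒱 : ZMod 2 → Submodule ℂ V) [DirectSum.Decomposition 𝒱]

theorem power_ext_hom {n : ℕ} {W : Type*} [AddCommGroup W] [Module ℂ W]
    {f g : (⨂[ℂ]^(n + 1) V) →ₗ[ℂ] W}
    (h : ∀ i, ∀ v ∈ 𝒱 i, ∀ c : ⨂[ℂ]^n V, f (v ⊹ c) = g (v ⊹ c)) : f = g :=
  power_ext fun v c => hom_induction 𝒱 v
    (fun x y hx hy => by rw [add_cons, map_add, map_add, hx, hy]) (fun i x hx => h i x hx c)

theorem power_ext_hom₂ {n : ℕ} {W : Type*} [AddCommGroup W] [Module ℂ W]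
    {f g : (⨂[ℂ]^(n + 2) V) →ₗ[ℂ] W}
    (h : ∀ i, ∀ v ∈ 𝒱 i, ∀ j, ∀ v' ∈ 𝒱 j, ∀ c : ⨂[ℂ]^n V, f (v ⊹ v' ⊹ c) = g (v ⊹ v' ⊹ c)) :
    f = g :=
  power_ext_hom 𝒱 fun i v hv t =>
    LinearMap.congr_fun (f := f ∘ₗ consWith v (n + 1)) (g := g ∘ₗ consWith v (n + 1))
      (power_ext_hom 𝒱 fun j v' hv' c => h i v hv j v' hv' c) t

theorem power_ext_hom₃ {n : ℕ} {W : Type*} [AddCommGroup W] [Module ℂ W]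
    {f g : (⨂[ℂ]^(n + 3) V) →ₗ[ℂ] W}
    (h : ∀ i, ∀ v ∈ 𝒱 i, ∀ j, ∀ v' ∈ 𝒱 j, ∀ k, ∀ v'' ∈ 𝒱 k, ∀ c : ⨂[ℂ]^n V,
      f (v ⊹ v' ⊹ v'' ⊹ c) = g (v ⊹ v' ⊹ v'' ⊹ c)) : f = g :=
  power_ext_hom 𝒱 fun i v hv t =>
    LinearMap.congr_fun (f := f ∘ₗ consWith v (n + 2)) (g := g ∘ₗ consWith v (n + 2))
      (power_ext_hom₂ 𝒱 fun j v' hv' k v'' hv'' c => h i v hv j v' hv' k v'' hv'' c) t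

theorem power_ext_tprod {n : ℕ} {W : Type*} [AddCommGroup W] [Module ℂ W]
    {f g : (⨂[ℂ]^n V) →ₗ[ℂ] W}
    (h : ∀ (p : Fin n → ZMod 2) (v : Fin n → V), (∀ k, v k ∈ 𝒱 (p k)) →
      f (PiTensorProduct.tprod ℂ v) = g (PiTensorProduct.tprod ℂ v)) : f = g := by
  induction n with
  | zero =>
    refine PiTensorProduct.ext ?_
    ext v
    exact h (fun k => k.elim0) v (fun k => k.elim0)
  | succ n ih =>
    refine power_ext_hom 𝒱 fun i v hv c => ?_
    refine LinearMap.congr_fun (f := f ∘ₗ consWith v n) (g := g ∘ₗ consWith v n) (ih ?_) c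
    intro p w hw
    simp only [LinearMap.comp_apply, consWith_eq, consEquiv_tmul_tprod]
    refine h (Fin.cons i p) _ fun k => ?_
    refine Fin.cases ?_ (fun k => ?_) k
    · simpa using hv
    · simpa using hw k

/-- The super transposition of the first two factors. -/
def headSwap (n : ℕ) : (⨂[ℂ]^(n + 2) V) →ₗ[ℂ] ⨂[ℂ]^(n + 2) V :=
  (consEquiv V (n + 1)).toLinearMap ∘ₗ (consEquiv V n).toLinearMap.lTensor V ∘ₗ
    braid 𝒱 (⨂[ℂ]^n V) ∘ₗ (consEquiv V n).symm.toLinearMap.lTensor V ∘ₗ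
    (consEquiv V (n + 1)).symm.toLinearMap

theorem headSwap_cons {n : ℕ} {i : ZMod 2} {v : V} (hv : v ∈ 𝒱 i) (w : V) (c : ⨂[ℂ]^n V) :
    headSwap 𝒱 n (v ⊹ w ⊹ c) = twist 𝒱 i w ⊹ v ⊹ c := by
  simp [headSwap, braid_tmul 𝒱 hv]

/-- The cyclic rotation `(v₀, …, vₙ) ↦ ± (v₁, …, vₙ, v₀)` with the Koszul sign. -/
def rotate : (n : ℕ) → (⨂[ℂ]^(n + 1) V) →ₗ[ℂ] ⨂[ℂ]^(n + 1) V
  | 0 => LinearMap.id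
  | n + 1 => consMap (rotate n) ∘ₗ headSwap 𝒱 n

theorem rotate_cons {n : ℕ} {i : ZMod 2} {v : V} (hv : v ∈ 𝒱 i) (w : V) (c : ⨂[ℂ]^n V) :
    rotate 𝒱 (n + 1) (v ⊹ w ⊹ c) = twist 𝒱 i w ⊹ rotate 𝒱 n (v ⊹ c) := by
  rw [rotate, LinearMap.comp_apply, headSwap_cons 𝒱 hv, consMap_cons]

theorem rotate_tprod {n : ℕ} (p : Fin (n + 1) → ZMod 2) (v : Fin (n + 1) → V)
    (hv : ∀ k, v k ∈ 𝒱 (p k)) :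
    rotate 𝒱 n (PiTensorProduct.tprod ℂ v) =
      koszul (p 0) (p 0 + ∑ k, p k) • PiTensorProduct.tprod ℂ (fun k => v (k + 1)) := by
  induction n with
  | zero =>
    have h2 : ∀ i : ZMod 2, i + i = 0 := by decide
    simp [rotate, h2, koszul_zero_right]
  | succ n ih =>
    have h1 : v = Fin.cons (v 0) (Fin.cons (v 1) (fun k => v k.succ.succ)) := by
      ext k
      refine Fin.cases rfl (fun k => ?_) k
      refine Fin.cases rfl (fun k => ?_) k
      rfl
    have h2 : (fun k => v (k + 1)) = Fin.cons (v 1) (fun k : Fin (n + 1) =>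
        (Fin.cons (v 0) (fun k => v k.succ.succ) : Fin (n + 1) → V) (k + 1)) := by
      ext k
      refine Fin.cases (by simp) (fun k => ?_) k
      refine Fin.lastCases ?_ (fun k => ?_) k
      · simp
      · simp only [Fin.cons_succ, Fin.coeSucc_eq_succ]
        rw [Fin.succ_castSucc, Fin.coeSucc_eq_succ]
    have h3 := ih (Fin.cons (p 0) (fun k => p k.succ.succ))
      (Fin.cons (v 0) (fun k => v k.succ.succ))
      (fun k => by
        refine Fin.cases ?_ (fun k => ?_) k
        · simpa using hv 0
        · simpa using hv k.succ.succ)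
    rw [h2, ← consEquiv_tmul_tprod]
    conv_lhs => rw [h1, ← consEquiv_tmul_tprod, ← consEquiv_tmul_tprod, rotate_cons 𝒱 (hv 0),
      twist_of_mem 𝒱 (hv 1), consEquiv_tmul_tprod, h3, smul_cons, cons_smul, smul_smul]
    congr 1
    simp only [Fin.sum_univ_succ, Fin.cons_zero, Fin.cons_succ, koszul_add_right,
      Fin.succ_zero_eq_one]
    ring

theorem rotate_pow_tprod {n : ℕ} (p : Fin (n + 1) → ZMod 2) (v : Fin (n + 1) → V)
    (hv : ∀ k, v k ∈ 𝒱 (p k)) (m : ℕ) :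
    (rotate 𝒱 n ^ m) (PiTensorProduct.tprod ℂ v) =
      (∏ j ∈ Finset.range m, koszul (p (Fin.ofNat (n + 1) j))
        (p (Fin.ofNat (n + 1) j) + ∑ k, p k)) •
        PiTensorProduct.tprod ℂ (fun k => v (k + Fin.ofNat (n + 1) m)) := by
  induction m with
  | zero => simp
  | succ m ih =>
    rw [pow_succ', Module.End.mul_apply, ih, map_smul,
      rotate_tprod 𝒱 (fun k => p (k + Fin.ofNat (n + 1) m)) _ (fun k => hv _), smul_smul,
      Finset.prod_range_succ]
    have : ∑ k, p (k + Fin.ofNat (n + 1) m) = ∑ k, p k :=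
      Equiv.sum_comp (Equiv.addRight (Fin.ofNat (n + 1) m)) p
    rw [this, zero_add]
    congr 3
    ext k
    congr 1
    ext
    simp [Fin.val_add, add_assoc, add_comm 1 m]

theorem rotate_pow (n : ℕ) : rotate 𝒱 n ^ (n + 1) = 1 := by
  refine power_ext_tprod 𝒱 fun p v hv => ?_
  rw [rotate_pow_tprod 𝒱 p v hv]
  have h0 : Fin.ofNat (n + 1) (n + 1) = 0 := by
    ext
    simp
  have h1 : ∏ j ∈ Finset.range (n + 1), koszul (p (Fin.ofNat (n + 1) j))
      (p (Fin.ofNat (n + 1) j) + ∑ k, p k) = 1 := by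
    have hf : ∀ i : Fin (n + 1), Fin.ofNat (n + 1) i = i := fun i => by
      ext
      simp
    rw [Finset.prod_range]
    simp only [hf, koszul_add_right, koszul_self]
    rw [Finset.prod_mul_distrib, ← koszul_sum_right]
    simp only [koszul_comm _ (∑ k, p k)]
    rw [← koszul_sum_right, koszul_self, koszul_comm, koszul_mul_self]
  rw [h1, one_smul, h0]
  simp

end TensorPower

/-! ### Cyclic operators -/

section Cyclic

variable {M M' : Type*} [AddCommGroup M] [Module ℂ M] [AddCommGroup M'] [Module ℂ M']

/-- The norm `1 + l + ⋯ + l^{n-1}`. -/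
def cyclicNorm (l : Module.End ℂ M) (n : ℕ) : Module.End ℂ M := ∑ k ∈ Finset.range n, l ^ k

theorem mul_cyclicNorm {l : Module.End ℂ M} {n : ℕ} (hl : l ^ n = 1) :
    l * cyclicNorm l n = cyclicNorm l n := by
  have h := mul_geom_sum l n
  rw [hl, sub_self, sub_mul, one_mul, sub_eq_zero] at h
  exact h

theorem cyclicNorm_mul {l : Module.End ℂ M} {n : ℕ} (hl : l ^ n = 1) :
    cyclicNorm l n * l = cyclicNorm l n := by
  have h := geom_sum_mul l n
  rw [hl, sub_self, mul_sub, mul_one, sub_eq_zero] at h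
  exact h

theorem pow_mul_cyclicNorm {l : Module.End ℂ M} {n : ℕ} (hl : l ^ n = 1) (k : ℕ) :
    l ^ k * cyclicNorm l n = cyclicNorm l n := by
  induction k with
  | zero => rw [pow_zero, one_mul]
  | succ k ih => rw [pow_succ, mul_assoc, mul_cyclicNorm hl, ih]

theorem cyclicNorm_mul_pow {l : Module.End ℂ M} {n : ℕ} (hl : l ^ n = 1) (k : ℕ) :
    cyclicNorm l n * l ^ k = cyclicNorm l n := by
  induction k with
  | zero => rw [pow_zero, mul_one]
  | succ k ih => rw [pow_succ', ← mul_assoc, cyclicNorm_mul hl, ih]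

variable {l : Module.End ℂ M} {l' : Module.End ℂ M'} {s : ℕ → M →ₗ[ℂ] M'} {n : ℕ}

theorem cyclic_pow_slot (hs : ∀ i < n, ∀ x, l' (s (i + 1) x) = s i (l x)) {i : ℕ} (hi : i ≤ n)
    (x : M) : (l' ^ i) (s i x) = s 0 ((l ^ i) x) := by
  induction i generalizing x with
  | zero => simp
  | succ i ih =>
    rw [pow_succ, Module.End.mul_apply, hs i (by omega), ih (by omega), pow_succ,
      Module.End.mul_apply]

/-- The identity `(1 - λ) b = b' (1 - λ)`. -/
theorem cyclic_sub_comm (hl : l ^ (n + 1) = 1) (hl' : l' ^ (n + 2) = 1)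
    (hs : ∀ i < n, ∀ x, l' (s (i + 1) x) = s i (l x)) (x : M) :
    (∑ i ∈ Finset.range (n + 1), s i x + l' (s 0 x)) -
        l' (∑ i ∈ Finset.range (n + 1), s i x + l' (s 0 x)) =
      ∑ i ∈ Finset.range (n + 1), s i x - ∑ i ∈ Finset.range (n + 1), s i (l x) := by
  have h1 : s n (l x) = l' (l' (s 0 x)) := by
    have h := cyclic_pow_slot hs le_rfl (l x)
    rw [← Module.End.mul_apply, ← pow_succ, hl, Module.End.one_apply] at h
    rw [← h]
    simp only [← Module.End.mul_apply, ← pow_succ']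
    rw [hl', Module.End.one_apply]
  have h2 : l' (∑ i ∈ Finset.range (n + 1), s i x) =
      l' (s 0 x) + ∑ i ∈ Finset.range n, s i (l x) := by
    rw [Finset.sum_range_succ', map_add, map_sum, add_comm]
    exact congrArg _ (Finset.sum_congr rfl fun i hi => hs i (Finset.mem_range.1 hi) x)
  rw [map_add, h2, Finset.sum_range_succ (fun i => s i (l x)), h1]
  abel

/-- The identity `b N = N b'`. -/
theorem cyclic_norm_comm (hl : l ^ (n + 1) = 1) (hl' : l' ^ (n + 2) = 1)
    (hs : ∀ i < n, ∀ x, l' (s (i + 1) x) = s i (l x)) (x : M) :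
    ∑ i ∈ Finset.range (n + 1), s i (cyclicNorm l (n + 1) x) + l' (s 0 (cyclicNorm l (n + 1) x)) =
      cyclicNorm l' (n + 2) (∑ i ∈ Finset.range (n + 1), s i x) := by
  have h1 : ∀ i ∈ Finset.range (n + 1), cyclicNorm l' (n + 2) (s i x) =
      cyclicNorm l' (n + 2) (s 0 ((l ^ i) x)) := by
    intro i hi
    rw [← cyclic_pow_slot hs (Nat.lt_succ_iff.1 (Finset.mem_range.1 hi)), ← Module.End.mul_apply,
      cyclicNorm_mul_pow hl']
  have h3 : cyclicNorm l' (n + 2) (∑ i ∈ Finset.range (n + 1), s i x) =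
      cyclicNorm l' (n + 2) (s 0 (cyclicNorm l (n + 1) x)) := by
    rw [map_sum, Finset.sum_congr rfl h1, ← map_sum, ← map_sum,
      show cyclicNorm l (n + 1) = ∑ k ∈ Finset.range (n + 1), l ^ k from rfl, LinearMap.sum_apply]
  rw [h3]
  set y := cyclicNorm l (n + 1) x with hy
  have h2 : ∀ i ∈ Finset.range (n + 1), s i y = (l' ^ (n + 1 - 1 - i + 2)) (s 0 y) := by
    intro i hi
    have hi' : i ≤ n := Nat.lt_succ_iff.1 (Finset.mem_range.1 hi)
    have h := cyclic_pow_slot hs hi' y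
    rw [hy, ← Module.End.mul_apply (l ^ i), pow_mul_cyclicNorm hl, ← hy] at h
    rw [← h, ← Module.End.mul_apply, ← pow_add, show n + 1 - 1 - i + 2 + i = n + 2 by omega, hl',
      Module.End.one_apply]
  rw [Finset.sum_congr rfl h2,
    Finset.sum_range_reflect (fun i => (l' ^ (i + 2)) (s 0 y)) (n + 1), ← mul_cyclicNorm hl',
    cyclicNorm, Finset.mul_sum, Finset.sum_range_succ' (fun i => l' * l' ^ i), LinearMap.add_apply,
    LinearMap.sum_apply]
  simp [pow_succ']

end Cyclic

/-! ### Symmetrizers of Coxeter generators -/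

section Symmetrizer

variable {R : Type*} [Ring R] [Algebra ℂ R] (s : ℕ → R)

/-- The sum `1 + s_{k-1} + s_{k-1} s_{k-2} + ⋯ + s_{k-1} ⋯ s_0`. -/
def cosetSum : ℕ → R
  | 0 => 1
  | k + 1 => 1 + s k * cosetSum k

/-- The average of the group generated by `s_0, …, s_{k-1}`. -/
def symmetrizer : ℕ → R
  | 0 => 1
  | k + 1 => ((k : ℂ) + 2)⁻¹ • (symmetrizer k * cosetSum s (k + 1))

variable {s} {m : ℕ}

theorem cosetSum_comm (h2 : ∀ i j, i + 2 ≤ j → j < m → s i * s j = s j * s i) {k : ℕ} (hk : k < m)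
    {l : ℕ} (hl : l + 1 ≤ k) : cosetSum s l * s k = s k * cosetSum s l := by
  induction l with
  | zero => simp [cosetSum]
  | succ l ih =>
    rw [cosetSum, add_mul, mul_add, one_mul, mul_one, mul_assoc, ih (by omega), ← mul_assoc,
      h2 l k hl hk, mul_assoc]

theorem absorb_cosetSum (h1 : ∀ i < m, s i * s i = 1)
    (h2 : ∀ i j, i + 2 ≤ j → j < m → s i * s j = s j * s i)
    (h3 : ∀ i, i + 1 < m → s i * s (i + 1) * s i = s (i + 1) * s i * s (i + 1)) (k : ℕ)
    (hk : k ≤ m) (E : R) (hE : ∀ j, j + 1 < k → E * s j = E) (i : ℕ) (hi : i < k) :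
    E * cosetSum s k * s i = E * cosetSum s k := by
  induction k generalizing E i with
  | zero => omega
  | succ k ih =>
    rcases Nat.lt_succ_iff_lt_or_eq.1 hi with hi | rfl
    · have h := ih (by omega) (E * s k) (fun j hj => by
        rw [mul_assoc, ← h2 j k (by omega) (by omega), ← mul_assoc, hE j (by omega)]) i hi
      rw [cosetSum, mul_add, mul_one, ← mul_assoc, add_mul, h, hE i (by omega)]
    · rcases i with _ | k
      · simp only [cosetSum, mul_one, mul_add, add_mul]
        rw [mul_assoc, h1 0 (by omega), mul_one, add_comm]
      · have h4 := cosetSum_comm h2 (show k + 1 < m by omega) (le_refl (k + 1))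
        have h5 : E * s (k + 1) * s k * cosetSum s k * s (k + 1) =
            E * s (k + 1) * s k * cosetSum s k := by
          rw [mul_assoc _ (cosetSum s k), h4, ← mul_assoc]
          congr 1
          rw [mul_assoc, mul_assoc, ← mul_assoc (s (k + 1)), ← h3 k (by omega), ← mul_assoc,
            ← mul_assoc, hE k (by omega)]
        rw [cosetSum, cosetSum]
        simp only [mul_add, mul_one, ← mul_assoc, add_mul]
        rw [h5, mul_assoc E (s (k + 1)), h1 (k + 1) (by omega), mul_one]
        abel

theorem symmetrizer_mul (h1 : ∀ i < m, s i * s i = 1)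
    (h2 : ∀ i j, i + 2 ≤ j → j < m → s i * s j = s j * s i)
    (h3 : ∀ i, i + 1 < m → s i * s (i + 1) * s i = s (i + 1) * s i * s (i + 1)) (k : ℕ)
    (hk : k ≤ m) (i : ℕ) (hi : i < k) : symmetrizer s k * s i = symmetrizer s k := by
  induction k generalizing i with
  | zero => omega
  | succ k ih =>
    rw [symmetrizer, smul_mul_assoc, absorb_cosetSum h1 h2 h3 (k + 1) hk _
      (fun j hj => ih (by omega) j (by omega)) i hi]

variable {M : Type*} [AddCommGroup M] [Module ℂ M] {f : ℕ → Module.End ℂ M}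

theorem cosetSum_apply_of_fixed {x : M} {k : ℕ} (hx : ∀ i < k, f i x = x) :
    cosetSum f k x = ((k : ℂ) + 1) • x := by
  induction k with
  | zero => simp [cosetSum]
  | succ k ih =>
    rw [cosetSum, LinearMap.add_apply, Module.End.mul_apply, ih (fun i hi => hx i (by omega)),
      map_smul, hx k (by omega), Module.End.one_apply]
    push_cast
    module

theorem symmetrizer_apply_of_fixed {x : M} {k : ℕ} (hx : ∀ i < k, f i x = x) :
    symmetrizer f k x = x := by
  induction k with
  | zero => simp [symmetrizer]
  | succ k ih =>
    have h : (k : ℂ) + 2 ≠ 0 := by exact_mod_cast (by omega : k + 2 ≠ 0)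
    rw [symmetrizer, LinearMap.smul_apply, Module.End.mul_apply, cosetSum_apply_of_fixed hx,
      map_smul, ih (fun i hi => hx i (by omega)), smul_smul]
    push_cast
    rw [show (k : ℂ) + 1 + 1 = k + 2 by ring, inv_mul_cancel₀ h, one_smul]

end Symmetrizer

namespace SuperLieAlgebra

variable {𝔤 : Type u} [AddCommGroup 𝔤] [Module ℂ 𝔤] {𝒢 : ZMod 2 → Submodule ℂ 𝔤}
  [DirectSum.Decomposition 𝒢] (L : SuperLieAlgebra 𝒢)

open Enveloping

/-! ### The diagonal action -/

/-- The action of an element `x` of parity `i` as a super derivation,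
`(c₁, …, cₙ) ↦ ∑ k, ± (c₁, …, x c_k, …, cₙ)`. -/
def diagDer (i : ZMod 2) (x : L.Enveloping) :
    (n : ℕ) → (⨂[ℂ]^n L.Enveloping) →ₗ[ℂ] ⨂[ℂ]^n L.Enveloping
  | 0 => 0
  | n + 1 => (consEquiv L.Enveloping n).toLinearMap ∘ₗ
      (TensorProduct.map (LinearMap.mulLeft ℂ x) LinearMap.id +
        TensorProduct.map (twist (grading L) i) (diagDer i x n)) ∘ₗ
      (consEquiv L.Enveloping n).symm.toLinearMap

theorem diagDer_cons (i : ZMod 2) (x : L.Enveloping) {n : ℕ} (h : L.Enveloping)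
    (c : ⨂[ℂ]^n L.Enveloping) : diagDer L i x (n + 1) (h ⊹ c) =
      ((x * h) ⊹ c) + (twist (grading L) i h ⊹ diagDer L i x n c) := by
  simp [diagDer]

theorem superInterchange_tmul {X : Type*} [AddCommGroup X] [Module ℂ X] (a b : L.Enveloping)
    {j : ZMod 2} {h : L.Enveloping} (hh : h ∈ grading L j) (c : X) :
    superInterchange (grading L) X ((a ⊗ₜ b) ⊗ₜ (h ⊗ₜ c)) =
      (a ⊗ₜ h) ⊗ₜ (twist (grading L) j b ⊗ₜ c) := by
  simp only [superInterchange, LinearMap.sum_apply, LinearMap.smul_apply, LinearMap.comp_apply,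
    TensorProduct.map_tmul, LinearMap.lTensor_tmul, LinearMap.rTensor_tmul, LinearEquiv.coe_coe,
    TensorProduct.tensorTensorTensorComm_tmul, homProj_of_mem (grading L) hh]
  have : ∀ i : ZMod 2, ∑ k : ZMod 2, koszul i k • (a ⊗ₜ[ℂ] (if j = k then h else 0)) ⊗ₜ[ℂ]
      (homProj (grading L) i b ⊗ₜ[ℂ] c) =
      koszul i j • (a ⊗ₜ[ℂ] h) ⊗ₜ[ℂ] (homProj (grading L) i b ⊗ₜ[ℂ] c) := by
    intro i
    rw [Finset.sum_eq_single j]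
    · simp
    · intro k _ hk
      simp [Ne.symm hk]
    · simp
  simp only [this, twist, LinearMap.sum_apply, LinearMap.smul_apply, TensorProduct.sum_tmul,
    TensorProduct.tmul_sum, koszul_comm j]
  refine Finset.sum_congr rfl fun i _ => ?_
  rw [← TensorProduct.smul_tmul', TensorProduct.tmul_smul]

/-- The map `a ⊗ b ↦ (a h, (-1)^{j|b|} b · c)`. -/
def headAct (j : ZMod 2) (h : L.Enveloping) {n : ℕ} (c : ⨂[ℂ]^n L.Enveloping) :
    L.Enveloping ⊗[ℂ] L.Enveloping →ₗ[ℂ] ⨂[ℂ]^(n + 1) L.Enveloping :=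
  (consEquiv L.Enveloping n).toLinearMap ∘ₗ TensorProduct.map (LinearMap.mulRight ℂ h)
    (diagAct (grading L) n ∘ₗ (TensorProduct.mk ℂ _ _).flip c ∘ₗ twist (grading L) j)

theorem headAct_tmul (j : ZMod 2) (h : L.Enveloping) {n : ℕ} (c : ⨂[ℂ]^n L.Enveloping)
    (a b : L.Enveloping) : headAct L j h c (a ⊗ₜ b) =
      (a * h) ⊹ diagAct (grading L) n (twist (grading L) j b ⊗ₜ c) := rfl

theorem diagAct_cons {j : ZMod 2} {h : L.Enveloping} (hh : h ∈ grading L j) {n : ℕ}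
    (c : ⨂[ℂ]^n L.Enveloping) (u : L.Enveloping) :
    diagAct (grading L) (n + 1) (u ⊗ₜ (h ⊹ c)) = headAct L j h c (comul L u) := by
  simp only [diagAct, LinearMap.comp_apply, TensorProduct.map_tmul, LinearEquiv.coe_coe,
    LinearEquiv.symm_apply_apply, comul_eq]
  generalize comul L u = t
  induction t with
  | zero => simp
  | add s t hs ht => simp only [TensorProduct.add_tmul, map_add, hs, ht]
  | tmul a b => simp [superInterchange_tmul L a b hh, headAct_tmul]

theorem diagAct_zero (u : L.Enveloping) (c : ⨂[ℂ]^0 L.Enveloping) :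
    diagAct (grading L) 0 (u ⊗ₜ c) = counitHom L u • c := by
  simp [diagAct, counit_eq]

theorem diagAct_ι_mul {i : ZMod 2} {x : 𝔤} (hx : x ∈ 𝒢 i) (u : L.Enveloping) {n : ℕ}
    (d : ⨂[ℂ]^n L.Enveloping) : diagAct (grading L) n ((ι L x * u) ⊗ₜ d) =
      diagDer L i (ι L x) n (diagAct (grading L) n (u ⊗ₜ d)) := by
  induction n generalizing u with
  | zero => rw [diagAct_zero, counitHom_ι_mul, zero_smul]; rfl
  | succ n ih =>
    refine LinearMap.congr_fun
      (f := diagAct (grading L) (n + 1) ∘ₗ TensorProduct.mk ℂ _ _ (ι L x * u))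
      (g := diagDer L i (ι L x) (n + 1) ∘ₗ diagAct (grading L) (n + 1) ∘ₗ
        TensorProduct.mk ℂ _ _ u) (power_ext_hom (grading L) fun j h hh c => ?_) d
    simp only [LinearMap.comp_apply, TensorProduct.mk_apply, diagAct_cons L hh, comul_ι_mul L hx]
    generalize comul L u = t
    induction t with
    | zero => simp
    | add s t hs ht => simp only [map_add, hs, ht]
    | tmul a b =>
      simp only [comulStep_tmul, map_add, headAct_tmul, diagDer_cons, twist_ι_mul L j hx,
        twist_mul, twist_of_mem _ hh, ← TensorProduct.smul_tmul', map_smul, cons_smul, ih,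
        mul_smul_comm, koszul_comm j i, mul_assoc]

theorem diagAct_one {n : ℕ} (d : ⨂[ℂ]^n L.Enveloping) :
    diagAct (grading L) n (1 ⊗ₜ d) = d := by
  induction n with
  | zero => rw [diagAct_zero, map_one, one_smul]
  | succ n ih =>
    refine LinearMap.congr_fun (f := diagAct (grading L) (n + 1) ∘ₗ TensorProduct.mk ℂ _ _ 1)
      (g := LinearMap.id) (power_ext_hom (grading L) fun j h hh c => ?_) d
    simp only [LinearMap.comp_apply, TensorProduct.mk_apply, diagAct_cons L hh, comul_one,
      headAct_tmul, twist_one, ih, one_mul, LinearMap.id_apply]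

theorem diagAct_ι {i : ZMod 2} {x : 𝔤} (hx : x ∈ 𝒢 i) {n : ℕ} (d : ⨂[ℂ]^n L.Enveloping) :
    diagAct (grading L) n (ι L x ⊗ₜ d) = diagDer L i (ι L x) n d := by
  have h := diagAct_ι_mul L hx 1 d
  rwa [mul_one, diagAct_one] at h

theorem diagAct_mul (u v : L.Enveloping) {n : ℕ} (d : ⨂[ℂ]^n L.Enveloping) :
    diagAct (grading L) n ((u * v) ⊗ₜ d) =
      diagAct (grading L) n (u ⊗ₜ diagAct (grading L) n (v ⊗ₜ d)) := by
  induction u using Enveloping.induction with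
  | one => rw [one_mul, diagAct_one]
  | add a b ha hb => rw [add_mul, TensorProduct.add_tmul, TensorProduct.add_tmul, map_add, map_add,
      ha, hb]
  | smul r a ha => rw [smul_mul_assoc, ← TensorProduct.smul_tmul', ← TensorProduct.smul_tmul',
      map_smul, map_smul, ha]
  | mul i x hx a ha => rw [mul_assoc, diagAct_ι_mul L hx, diagAct_ι_mul L hx, ha]

/-! ### Operators on tensor powers of the enveloping algebra -/

/-- The coface that appends `1`. -/
abbrev snoc (n : ℕ) : (⨂[ℂ]^n L.Enveloping) →ₗ[ℂ] ⨂[ℂ]^(n + 1) L.Enveloping :=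
  coface (1 : L.Enveloping) n (n + 1)

theorem coface_zero (n : ℕ) : coface (1 : L.Enveloping) n 0 = consWith 1 n := by
  cases n <;> rfl

theorem coface_one_cons {n : ℕ} (h : L.Enveloping) (c : ⨂[ℂ]^n L.Enveloping) :
    coface (1 : L.Enveloping) (n + 1) 1 (h ⊹ c) = cons₂ n (comul L h ⊗ₜ c) := by
  simp [coface, cons₂, comul_eq]

theorem coface_succ_cons {n : ℕ} (i : ℕ) (h : L.Enveloping) (c : ⨂[ℂ]^n L.Enveloping) :
    coface (1 : L.Enveloping) (n + 1) (i + 2) (h ⊹ c) =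
      h ⊹ coface (1 : L.Enveloping) n (i + 1) c := by
  rw [coface, consMap_cons]

/-- The map that applies the counit to the first factor. -/
def counitHead (n : ℕ) : (⨂[ℂ]^(n + 1) L.Enveloping) →ₗ[ℂ] ⨂[ℂ]^n L.Enveloping :=
  (TensorProduct.lid ℂ (⨂[ℂ]^n L.Enveloping)).toLinearMap ∘ₗ
    (counitHom L).toLinearMap.rTensor (⨂[ℂ]^n L.Enveloping) ∘ₗ
    (consEquiv L.Enveloping n).symm.toLinearMap

theorem counitHead_cons {n : ℕ} (h : L.Enveloping) (c : ⨂[ℂ]^n L.Enveloping) :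
    counitHead L n (h ⊹ c) = counitHom L h • c := by
  simp [counitHead]

theorem counitHead_diagDer (i : ZMod 2) (x : 𝔤) {n : ℕ} (c : ⨂[ℂ]^(n + 1) L.Enveloping) :
    counitHead L n (diagDer L i (ι L x) (n + 1) c) =
      diagDer L i (ι L x) n (counitHead L n c) := by
  refine LinearMap.congr_fun (f := counitHead L n ∘ₗ diagDer L i (ι L x) (n + 1))
    (g := diagDer L i (ι L x) n ∘ₗ counitHead L n) (power_ext fun h c => ?_) c
  simp [diagDer_cons, counitHead_cons, counitHom_twist, counitHom_ι_mul, -map_mul]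

theorem codegeneracy_succ_succ {H : Type*} [Ring H] [Algebra ℂ H] [Coalgebra ℂ H] (n i : ℕ) :
    codegeneracy (H := H) (n + 1) (i + 1) = consMap (codegeneracy n i) := rfl

theorem codegeneracy_succ_cons {n i : ℕ} (h : L.Enveloping) (c : ⨂[ℂ]^(n + 1) L.Enveloping) :
    codegeneracy (n + 1) (i + 1) (h ⊹ c) = h ⊹ codegeneracy n i c := by
  rw [codegeneracy_succ_succ, consMap_cons]

theorem codegeneracy_last_diagDer (i : ZMod 2) (x : 𝔤) {n : ℕ}
    (c : ⨂[ℂ]^(n + 1) L.Enveloping) :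
    codegeneracy n n (diagDer L i (ι L x) (n + 1) c) =
      diagDer L i (ι L x) n (codegeneracy n n c) := by
  induction n with
  | zero => exact counitHead_diagDer L i x c
  | succ n ih =>
    refine LinearMap.congr_fun (f := codegeneracy (n + 1) (n + 1) ∘ₗ diagDer L i (ι L x) (n + 2))
      (g := diagDer L i (ι L x) (n + 1) ∘ₗ codegeneracy (n + 1) (n + 1))
      (power_ext fun h c => ?_) c
    simp only [LinearMap.comp_apply, diagDer_cons, map_add, codegeneracy_succ_cons, ih]

theorem codegeneracy_last_snoc {n : ℕ} (c : ⨂[ℂ]^n L.Enveloping) :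
    codegeneracy n n (snoc L n c) = c := by
  induction n with
  | zero =>
    refine (counitHead_cons L 1 c).trans ?_
    rw [map_one, one_smul]
  | succ n ih =>
    refine LinearMap.congr_fun (f := codegeneracy (n + 1) (n + 1) ∘ₗ snoc L (n + 1))
      (g := LinearMap.id) (power_ext fun h c => ?_) c
    simp only [LinearMap.comp_apply, coface_succ_cons, codegeneracy_succ_cons, ih,
      LinearMap.id_apply]

theorem cons₂_diagDer (i : ZMod 2) (x : L.Enveloping) {n : ℕ} (t : L.Enveloping ⊗[ℂ] L.Enveloping)
    (c : ⨂[ℂ]^n L.Enveloping) : diagDer L i x (n + 2) (cons₂ n (t ⊗ₜ c)) =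
      cons₂ n (comulStep L i x t ⊗ₜ c) + cons₂ n
        (TensorProduct.map (twist (grading L) i) (twist (grading L) i) t ⊗ₜ diagDer L i x n c) := by
  induction t with
  | zero => simp
  | add s t hs ht =>
    simp only [TensorProduct.add_tmul, map_add, hs, ht]
    abel
  | tmul a b =>
    simp only [cons₂_tmul, diagDer_cons, comulStep_tmul, TensorProduct.add_tmul, map_add,
      TensorProduct.map_tmul, cons_add]
    abel

theorem coface_diagDer {i : ZMod 2} {x : 𝔤} (hx : x ∈ 𝒢 i) {n : ℕ} (k : ℕ) (hk : k < n)
    (c : ⨂[ℂ]^n L.Enveloping) :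
    coface (1 : L.Enveloping) n (k + 1) (diagDer L i (ι L x) n c) =
      diagDer L i (ι L x) (n + 1) (coface (1 : L.Enveloping) n (k + 1) c) := by
  induction n generalizing k with
  | zero => omega
  | succ n ih =>
    refine LinearMap.congr_fun
      (f := coface (1 : L.Enveloping) (n + 1) (k + 1) ∘ₗ diagDer L i (ι L x) (n + 1))
      (g := diagDer L i (ι L x) (n + 2) ∘ₗ coface (1 : L.Enveloping) (n + 1) (k + 1))
      (power_ext fun h c => ?_) c
    rcases k with _ | k
    · simp only [LinearMap.comp_apply, diagDer_cons, map_add, zero_add, coface_one_cons,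
        comul_ι_mul L hx, comul_twist, cons₂_diagDer]
    · simp only [LinearMap.comp_apply, diagDer_cons, map_add, coface_succ_cons,
        ih k (by omega)]

theorem rotate_diagDer {i : ZMod 2} {x : L.Enveloping} (hx : x ∈ grading L i) {n : ℕ}
    (c : ⨂[ℂ]^(n + 1) L.Enveloping) :
    rotate (grading L) n (diagDer L i x (n + 1) c) =
      diagDer L i x (n + 1) (rotate (grading L) n c) := by
  induction n with
  | zero => rfl
  | succ n ih =>
    refine LinearMap.congr_fun (f := rotate (grading L) (n + 1) ∘ₗ diagDer L i x (n + 2))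
      (g := diagDer L i x (n + 2) ∘ₗ rotate (grading L) (n + 1))
      (power_ext_hom₂ (grading L) fun j h hh j' h' hh' c => ?_) c
    have := ih (h ⊹ c)
    have hxh : x * h ∈ grading L (i + j) := SetLike.GradedMul.mul_mem hx hh
    simp only [LinearMap.comp_apply, rotate_cons _ hh, diagDer_cons, map_add, cons_add,
      rotate_cons _ hxh, rotate_cons _ (twist_mem _ hh i), ← this, twist_mul, twist_of_mem _ hx]
    simp only [twist_of_mem _ hh, twist_of_mem _ hh', smul_cons, cons_smul, map_smul,
      smul_mul_assoc, mul_smul_comm, smul_smul, koszul_comm i j]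
    rw [koszul_add_left, show koszul j i * (koszul j j' * koszul j i) = koszul j j' by
      linear_combination koszul j j' * koszul_mul_self j i]
    module

end SuperLieAlgebra

namespace SuperLieAlgebra

variable {𝔤 : Type u} [AddCommGroup 𝔤] [Module ℂ 𝔤] {𝒢 : ZMod 2 → Submodule ℂ 𝔤}
  [DirectSum.Decomposition 𝒢] (L : SuperLieAlgebra 𝒢)

open Enveloping

/-! ### The cocyclic module `U(𝔤)^{⊗ (n+1)}` -/

theorem one_mem_grading : (1 : L.Enveloping) ∈ grading L 0 := SetLike.GradedOne.one_mem

theorem rotate_one_cons {n : ℕ} (c : ⨂[ℂ]^n L.Enveloping) :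
    rotate (grading L) n (1 ⊹ c) = snoc L n c := by
  induction n with
  | zero => rfl
  | succ n ih =>
    refine LinearMap.congr_fun (f := rotate (grading L) (n + 1) ∘ₗ consWith 1 (n + 1))
      (g := snoc L (n + 1)) (power_ext fun h c => ?_) c
    rw [LinearMap.comp_apply, consWith_eq, rotate_cons _ (one_mem_grading L), twist_zero, ih,
      coface_succ_cons]

theorem rotate_cons₂ {n : ℕ} {j : ZMod 2} {h : L.Enveloping} (hh : h ∈ grading L j)
    (t : L.Enveloping ⊗[ℂ] L.Enveloping) (c : ⨂[ℂ]^n L.Enveloping) :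
    rotate (grading L) (n + 2) (h ⊹ cons₂ n (t ⊗ₜ c)) =
      cons₂ (n + 1) (TensorProduct.map (twist (grading L) j) (twist (grading L) j) t ⊗ₜ
        rotate (grading L) n (h ⊹ c)) := by
  induction t with
  | zero => simp
  | add s t hs ht => simp only [TensorProduct.add_tmul, map_add, cons_add, hs, ht]
  | tmul a b => rw [cons₂_tmul, rotate_cons _ hh, rotate_cons _ hh, TensorProduct.map_tmul,
      cons₂_tmul]

theorem rotate_coface {n i : ℕ} (hi : i < n) (c : ⨂[ℂ]^(n + 1) L.Enveloping) :
    rotate (grading L) (n + 1) (coface (1 : L.Enveloping) (n + 1) (i + 2) c) =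
      coface (1 : L.Enveloping) (n + 1) (i + 1) (rotate (grading L) n c) := by
  induction n generalizing i with
  | zero => omega
  | succ n ih =>
    refine LinearMap.congr_fun
      (f := rotate (grading L) (n + 2) ∘ₗ coface (1 : L.Enveloping) (n + 2) (i + 2))
      (g := coface (1 : L.Enveloping) (n + 2) (i + 1) ∘ₗ rotate (grading L) (n + 1))
      (power_ext_hom₂ (grading L) fun j h hh j' h' hh' c => ?_) c
    simp only [LinearMap.comp_apply]
    rcases i with _ | i
    · rw [zero_add, coface_succ_cons, coface_one_cons, rotate_cons₂ L hh, rotate_cons _ hh,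
        coface_one_cons, comul_twist]
    · rw [coface_succ_cons, coface_succ_cons, rotate_cons _ hh, rotate_cons _ hh,
        coface_succ_cons, ← ih (by omega), coface_succ_cons]

/-- The signed rotation of `U(𝔤)^{⊗ (n+1)}`. -/
def signedRotate (n : ℕ) : Module.End ℂ (⨂[ℂ]^(n + 1) L.Enveloping) :=
  (-1 : ℂ) ^ n • rotate (grading L) n

theorem signedRotate_pow (n : ℕ) : signedRotate L n ^ (n + 1) = 1 := by
  rw [signedRotate, smul_pow, rotate_pow, ← pow_mul, (Nat.even_mul_succ_self n).neg_one_pow,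
    one_smul]

/-- The signed cofaces of `U(𝔤)^{⊗ (n+1)}` given by the comultiplication. -/
def slot (n i : ℕ) : (⨂[ℂ]^(n + 1) L.Enveloping) →ₗ[ℂ] ⨂[ℂ]^(n + 2) L.Enveloping :=
  (-1 : ℂ) ^ i • coface (1 : L.Enveloping) (n + 1) (i + 1)

theorem signedRotate_slot (n i : ℕ) (hi : i < n) (c : ⨂[ℂ]^(n + 1) L.Enveloping) :
    signedRotate L (n + 1) (slot L n (i + 1) c) = slot L n i (signedRotate L n c) := by
  simp only [signedRotate, slot, LinearMap.smul_apply, map_smul, rotate_coface L hi, smul_smul]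
  congr 1
  ring

/-- The sum of the signed cofaces of `U(𝔤)^{⊗ n}` given by the comultiplication. -/
def barDiff (n : ℕ) : (⨂[ℂ]^n L.Enveloping) →ₗ[ℂ] ⨂[ℂ]^(n + 1) L.Enveloping :=
  ∑ i ∈ Finset.range n, (-1 : ℂ) ^ i • coface (1 : L.Enveloping) n (i + 1)

theorem barDiff_succ (n : ℕ) (c : ⨂[ℂ]^(n + 1) L.Enveloping) :
    barDiff L (n + 1) c = ∑ i ∈ Finset.range (n + 1), slot L n i c := by
  simp [barDiff, slot]

theorem barDiff_cons {n : ℕ} (h : L.Enveloping) (c : ⨂[ℂ]^n L.Enveloping) :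
    barDiff L (n + 1) (h ⊹ c) = cons₂ n (comul L h ⊗ₜ c) - (h ⊹ barDiff L n c) := by
  simp only [barDiff, LinearMap.sum_apply, LinearMap.smul_apply]
  rw [Finset.sum_range_succ', zero_add, coface_one_cons, pow_zero, one_smul, sub_eq_neg_add,
    ← cons_neg, ← Finset.sum_neg_distrib, TensorProduct.tmul_sum, map_sum]
  refine congrArg (· + _) ?_
  refine Finset.sum_congr rfl fun i _ => ?_
  rw [coface_succ_cons, pow_succ, mul_neg_one, neg_smul, cons_neg, cons_smul]

theorem counitHead_cons₂ {n : ℕ} (h : L.Enveloping) (c : ⨂[ℂ]^n L.Enveloping) :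
    counitHead L (n + 1) (cons₂ n (comul L h ⊗ₜ c)) = h ⊹ c := by
  have key : ∀ t : L.Enveloping ⊗[ℂ] L.Enveloping, counitHead L (n + 1) (cons₂ n (t ⊗ₜ c)) =
      TensorProduct.lid ℂ _ ((counitHom L).toLinearMap.rTensor L.Enveloping t) ⊹ c := by
    intro t
    induction t with
    | zero => simp
    | add s t hs ht => simp only [TensorProduct.add_tmul, map_add, hs, ht]
    | tmul a b => simp [cons₂_tmul, counitHead_cons, smul_cons]
  have h1 := Coalgebra.rTensor_counit_comul (R := ℂ) h
  rw [key]
  erw [h1]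
  simp

theorem barDiff_counitHead {n : ℕ} (c : ⨂[ℂ]^(n + 1) L.Enveloping) :
    barDiff L n (counitHead L n c) + counitHead L (n + 1) (barDiff L (n + 1) c) = c := by
  refine LinearMap.congr_fun (f := barDiff L n ∘ₗ counitHead L n +
    counitHead L (n + 1) ∘ₗ barDiff L (n + 1)) (g := LinearMap.id) (power_ext fun h c => ?_) c
  simp only [LinearMap.add_apply, LinearMap.comp_apply, LinearMap.id_apply, barDiff_cons, map_sub,
    counitHead_cons₂, counitHead_cons, map_smul, add_sub_cancel]

namespace Character

variable {L} (δ : L.Character)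

local notation "𝒮" => twistedAntipode (Enveloping.grading L) δ.toAlgHom

/-! ### Coinvariants of the diagonal action -/

/-- The map `(h, c₁, …, cₙ) ↦ S̃(h) · (c₁, …, cₙ)`, which identifies `U(𝔤)^{⊗ n}` with the
`δ`-coinvariants of `U(𝔤)^{⊗ (n+1)}`. -/
def coinv (n : ℕ) : (⨂[ℂ]^(n + 1) L.Enveloping) →ₗ[ℂ] ⨂[ℂ]^n L.Enveloping :=
  diagAct (grading L) n ∘ₗ (𝒮).rTensor (⨂[ℂ]^n L.Enveloping) ∘ₗ
    (consEquiv L.Enveloping n).symm.toLinearMap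

theorem coinv_cons {n : ℕ} (h : L.Enveloping) (c : ⨂[ℂ]^n L.Enveloping) :
    δ.coinv n (h ⊹ c) = diagAct (grading L) n (𝒮 h ⊗ₜ c) := by
  simp [coinv]

theorem coinv_one_cons {n : ℕ} (c : ⨂[ℂ]^n L.Enveloping) : δ.coinv n (1 ⊹ c) = c := by
  rw [coinv_cons, twistedAntipode_one, diagAct_one]

theorem coinv_diagDer {i : ZMod 2} {x : 𝔤} (hx : x ∈ 𝒢 i) {n : ℕ}
    (c : ⨂[ℂ]^(n + 1) L.Enveloping) :
    δ.coinv n (diagDer L i (ι L x) (n + 1) c) = δ.toLinearMap x • δ.coinv n c := by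
  refine LinearMap.congr_fun (f := δ.coinv n ∘ₗ diagDer L i (ι L x) (n + 1))
    (g := δ.toLinearMap x • δ.coinv n) (power_ext fun h c => ?_) c
  simp only [LinearMap.comp_apply, LinearMap.smul_apply, diagDer_cons, map_add, coinv_cons,
    twistedAntipode_ι_mul δ hx, twistedAntipode_twist, TensorProduct.sub_tmul, map_sub,
    diagAct_mul, diagAct_ι L hx, ← TensorProduct.smul_tmul', map_smul, sub_add_cancel]

theorem eq_apply_coinv {n : ℕ} {W : Type*} [AddCommGroup W] [Module ℂ W]
    (f : (⨂[ℂ]^(n + 1) L.Enveloping) →ₗ[ℂ] W)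
    (hf : ∀ i, ∀ x ∈ 𝒢 i, ∀ c, f (diagDer L i (ι L x) (n + 1) c) = δ.toLinearMap x • f c)
    (c : ⨂[ℂ]^(n + 1) L.Enveloping) : f c = f (1 ⊹ δ.coinv n c) := by
  have key : ∀ h : L.Enveloping, ∀ (j : ZMod 2) (c : ⨂[ℂ]^n L.Enveloping),
      f (twist (grading L) j h ⊹ c) = f (1 ⊹ δ.coinv n (twist (grading L) j h ⊹ c)) := by
    intro h
    induction h using Enveloping.induction with
    | one => intro j c; rw [twist_one, coinv_one_cons]
    | add a b ha hb =>
      intro j c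
      simp only [map_add, add_cons, cons_add, ha, hb]
    | smul r a ha =>
      intro j c
      simp only [map_smul, smul_cons, cons_smul, ha]
    | mul i x hx a ha =>
      intro j c
      have h1 : (ι L x * twist (grading L) j a) ⊹ c =
          diagDer L i (ι L x) (n + 1) (twist (grading L) j a ⊹ c) -
            (twist (grading L) (i + j) a ⊹ diagDer L i (ι L x) n c) := by
        rw [diagDer_cons, twist_add, add_sub_cancel_right]
      rw [twist_ι_mul L j hx, smul_cons, map_smul, map_smul, cons_smul, map_smul, h1]
      simp only [map_sub, hf i x hx, coinv_diagDer δ hx, ha, cons_sub, cons_smul, map_smul]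
  refine LinearMap.congr_fun (f := f) (g := f ∘ₗ consWith 1 n ∘ₗ δ.coinv n)
    (power_ext fun h c => ?_) c
  simpa [twist_zero, consWith_eq] using key h 0 c

theorem cyclicOp_succ_cons {n : ℕ} (h : L.Enveloping) (c : ⨂[ℂ]^n L.Enveloping) :
    δ.mpi.cyclicOp (n + 1) (h ⊹ c) = diagAct (grading L) (n + 1) (𝒮 h ⊗ₜ snoc L n c) := by
  simp [SuperMPI.cyclicOp, mpi]

theorem cyclicOp_eq {n : ℕ} (c : ⨂[ℂ]^n L.Enveloping) :
    δ.mpi.cyclicOp n c = δ.coinv n (snoc L n c) := by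
  cases n with
  | zero => exact (coinv_one_cons δ c).symm
  | succ n =>
    refine LinearMap.congr_fun (f := δ.mpi.cyclicOp (n + 1))
      (g := δ.coinv (n + 1) ∘ₗ snoc L (n + 1)) (power_ext fun h c => ?_) c
    rw [cyclicOp_succ_cons, LinearMap.comp_apply, coface_succ_cons, coinv_cons]

theorem cyclicOp_coinv {n : ℕ} (c : ⨂[ℂ]^(n + 1) L.Enveloping) :
    δ.mpi.cyclicOp n (δ.coinv n c) = δ.coinv n (rotate (grading L) n c) := by
  have h := eq_apply_coinv δ (δ.coinv n ∘ₗ rotate (grading L) n) (fun i x hx c => by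
    rw [LinearMap.comp_apply, rotate_diagDer L (ι_mem L hx), coinv_diagDer δ hx]
    rfl) c
  rw [LinearMap.comp_apply, LinearMap.comp_apply, rotate_one_cons] at h
  rw [h, cyclicOp_eq]

theorem codegeneracy_diagAct_snoc {n : ℕ} (u : L.Enveloping) (c : ⨂[ℂ]^n L.Enveloping) :
    codegeneracy n n (diagAct (grading L) (n + 1) (u ⊗ₜ snoc L n c)) =
      diagAct (grading L) n (u ⊗ₜ c) := by
  induction u using Enveloping.induction with
  | one => rw [diagAct_one, diagAct_one, codegeneracy_last_snoc]
  | add a b ha hb => simp only [TensorProduct.add_tmul, map_add, ha, hb]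
  | smul r a ha => simp only [← TensorProduct.smul_tmul', map_smul, ha]
  | mul i x hx a ha =>
    rw [diagAct_ι_mul L hx, diagAct_ι_mul L hx, codegeneracy_last_diagDer, ha]

theorem codegeneracy_cyclicOp {n : ℕ} (c : ⨂[ℂ]^(n + 1) L.Enveloping) :
    codegeneracy n n (δ.mpi.cyclicOp (n + 1) c) = δ.coinv n c := by
  refine LinearMap.congr_fun (f := codegeneracy n n ∘ₗ δ.mpi.cyclicOp (n + 1))
    (g := δ.coinv n) (power_ext fun h c => ?_) c
  rw [LinearMap.comp_apply, cyclicOp_succ_cons, codegeneracy_diagAct_snoc, coinv_cons]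

theorem coinv_coinv {n : ℕ} (c : ⨂[ℂ]^(n + 2) L.Enveloping) :
    δ.coinv n (δ.coinv (n + 1) c) = δ.coinv n (counitHead L (n + 1) c) := by
  have h := eq_apply_coinv δ (δ.coinv n ∘ₗ counitHead L (n + 1)) (fun i x hx c => by
    rw [LinearMap.comp_apply, counitHead_diagDer, coinv_diagDer δ hx]
    rfl) c
  rw [LinearMap.comp_apply, LinearMap.comp_apply, counitHead_cons, map_one, one_smul] at h
  exact h.symm

/-! ### The Hochschild coboundary -/

theorem hochschildB_eq {n : ℕ} (c : ⨂[ℂ]^n L.Enveloping) :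
    δ.mpi.hochschildB n c = (1 ⊹ c) - barDiff L n c + (-1 : ℂ) ^ (n + 1) • snoc L n c := by
  have h : ∀ k, coface δ.mpi.cochar n k = coface (1 : L.Enveloping) n k := fun k => rfl
  simp only [SuperMPI.hochschildB, h, LinearMap.sum_apply, LinearMap.smul_apply]
  rw [Finset.sum_range_succ, Finset.sum_range_succ', coface_zero, consWith_eq, barDiff,
    LinearMap.sum_apply]
  simp only [pow_succ, mul_neg_one, neg_smul, Finset.sum_neg_distrib, LinearMap.smul_apply,
    pow_zero, one_smul]
  abel

/-- The Hochschild coboundary of `U(𝔤)`. -/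
def cobound : L.Enveloping →ₗ[ℂ] L.Enveloping ⊗[ℂ] L.Enveloping :=
  TensorProduct.mk ℂ _ _ 1 + (TensorProduct.mk ℂ _ _).flip 1 - comul L

theorem cobound_apply (h : L.Enveloping) :
    cobound (L := L) h = 1 ⊗ₜ h + h ⊗ₜ 1 - comul L h := rfl

theorem hochschildB_cons {n : ℕ} (h : L.Enveloping) (c : ⨂[ℂ]^n L.Enveloping) :
    δ.mpi.hochschildB (n + 1) (h ⊹ c) =
      cons₂ n (cobound h ⊗ₜ c) - (h ⊹ δ.mpi.hochschildB n c) := by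
  rw [hochschildB_eq, hochschildB_eq, barDiff_cons, coface_succ_cons, cobound_apply, cons_add,
    cons_sub, cons_smul, TensorProduct.sub_tmul, TensorProduct.add_tmul, map_sub, map_add,
    cons₂_tmul, cons₂_tmul, pow_succ (-1 : ℂ) (n + 1), mul_neg_one, neg_smul]
  abel

theorem hochschildB_zero (c : ⨂[ℂ]^0 L.Enveloping) : δ.mpi.hochschildB 0 c = 0 := by
  rw [hochschildB_eq]
  simp [barDiff, coface, consWith_eq]

/-- The operation `a ⊗ t ⊗ c ↦ (a, t, c)` on `(U(𝔤) ⊗ (U(𝔤) ⊗ U(𝔤))) ⊗ U(𝔤)^{⊗ n}`. -/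
def cons₃ (n : ℕ) : (L.Enveloping ⊗[ℂ] (L.Enveloping ⊗[ℂ] L.Enveloping)) ⊗[ℂ]
    (⨂[ℂ]^n L.Enveloping) →ₗ[ℂ] ⨂[ℂ]^(n + 3) L.Enveloping :=
  (consEquiv L.Enveloping (n + 2)).toLinearMap ∘ₗ (cons₂ n).lTensor L.Enveloping ∘ₗ
      (TensorProduct.assoc ℂ _ _ (⨂[ℂ]^n L.Enveloping)).toLinearMap

theorem cons₃_tmul {n : ℕ} (a : L.Enveloping) (t : L.Enveloping ⊗[ℂ] L.Enveloping)
    (c : ⨂[ℂ]^n L.Enveloping) : cons₃ n ((a ⊗ₜ t) ⊗ₜ c) = a ⊹ cons₂ n (t ⊗ₜ c) := by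
  simp [cons₃]

theorem hochschildB_cons₂ {n : ℕ} (t : L.Enveloping ⊗[ℂ] L.Enveloping)
    (c : ⨂[ℂ]^n L.Enveloping) : δ.mpi.hochschildB (n + 2) (cons₂ n (t ⊗ₜ c)) =
      cons₃ n (TensorProduct.assoc ℂ _ _ _ (cobound.rTensor _ t) ⊗ₜ c) -
        cons₃ n (cobound.lTensor _ t ⊗ₜ c) + cons₂ (n + 1) (t ⊗ₜ δ.mpi.hochschildB n c) := by
  induction t with
  | zero => simp
  | add s t hs ht =>
    simp only [map_add, TensorProduct.add_tmul, hs, ht]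
    abel
  | tmul a b =>
    have h : ∀ s : L.Enveloping ⊗[ℂ] L.Enveloping, cons₂ (n + 1) (s ⊗ₜ (b ⊹ c)) =
        cons₃ n (TensorProduct.assoc ℂ _ _ _ (s ⊗ₜ b) ⊗ₜ c) := by
      intro s
      induction s with
      | zero => simp
      | add s t hs ht => simp only [map_add, TensorProduct.add_tmul, hs, ht]
      | tmul x y => simp [cons₂_tmul, cons₃_tmul]
    rw [cons₂_tmul, hochschildB_cons, hochschildB_cons, h, LinearMap.rTensor_tmul,
      LinearMap.lTensor_tmul, cons₃_tmul, cons_sub, cons₂_tmul]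
    abel

theorem cobound_cobound (h : L.Enveloping) :
    TensorProduct.assoc ℂ _ _ _ (cobound.rTensor _ (cobound (L := L) h)) =
      cobound.lTensor _ (cobound (L := L) h) := by
  have h1 : ∀ t : L.Enveloping ⊗[ℂ] L.Enveloping,
      TensorProduct.assoc ℂ _ _ _ (cobound.rTensor _ t) = 1 ⊗ₜ t +
        (TensorProduct.mk ℂ _ _ (1 : L.Enveloping)).lTensor _ t -
        TensorProduct.assoc ℂ _ _ _ ((comul L).rTensor _ t) := by
    intro t
    induction t with
    | zero => simp
    | add s t hs ht =>
      simp only [map_add, hs, ht, TensorProduct.tmul_add]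
      abel
    | tmul a b => simp [cobound_apply, TensorProduct.add_tmul, TensorProduct.sub_tmul]
  have h2 : ∀ t : L.Enveloping ⊗[ℂ] L.Enveloping,
      cobound.lTensor _ t = (TensorProduct.mk ℂ _ _ (1 : L.Enveloping)).lTensor _ t +
        TensorProduct.assoc ℂ _ _ _ (t ⊗ₜ[ℂ] (1 : L.Enveloping)) - (comul L).lTensor _ t := by
    intro t
    induction t with
    | zero => simp
    | add s t hs ht =>
      simp only [map_add, hs, ht, TensorProduct.add_tmul]
      abel
    | tmul a b => simp [cobound_apply, TensorProduct.tmul_add, TensorProduct.tmul_sub]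
  have h3 : TensorProduct.assoc ℂ _ _ _ ((comul L).rTensor _ (comul L h)) =
      (comul L).lTensor _ (comul L h) := Coalgebra.coassoc_apply (R := ℂ) h
  rw [h1, h2, cobound_apply]
  simp only [map_add, map_sub, h3, TensorProduct.tmul_add, TensorProduct.tmul_sub,
    TensorProduct.add_tmul, TensorProduct.sub_tmul, LinearMap.lTensor_tmul, LinearMap.rTensor_tmul,
    TensorProduct.mk_apply, comul_one, TensorProduct.assoc_tmul]
  abel

theorem hochschildB_hochschildB {n : ℕ} (c : ⨂[ℂ]^n L.Enveloping) :
    δ.mpi.hochschildB (n + 1) (δ.mpi.hochschildB n c) = 0 := by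
  induction n with
  | zero => rw [hochschildB_zero, map_zero]
  | succ n ih =>
    refine LinearMap.congr_fun (f := δ.mpi.hochschildB (n + 2) ∘ₗ δ.mpi.hochschildB (n + 1))
      (g := 0) (power_ext fun h c => ?_) c
    rw [LinearMap.comp_apply, hochschildB_cons, map_sub, hochschildB_cons₂, hochschildB_cons, ih,
      cobound_cobound, cons_zero]
    simp

theorem hochschildB_coinv {n : ℕ} (c : ⨂[ℂ]^(n + 1) L.Enveloping) :
    δ.mpi.hochschildB n (δ.coinv n c) = δ.coinv (n + 1)
      (∑ i ∈ Finset.range (n + 1), slot L n i c + signedRotate L (n + 1) (slot L n 0 c)) := by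
  have h := eq_apply_coinv δ (δ.coinv (n + 1) ∘ₗ (∑ i ∈ Finset.range (n + 1), slot L n i +
    signedRotate L (n + 1) ∘ₗ slot L n 0)) (fun i x hx c => by
      have hs : ∀ k < n + 1, slot L n k (diagDer L i (ι L x) (n + 1) c) =
          diagDer L i (ι L x) (n + 2) (slot L n k c) := fun k hk => by
        simp only [slot, LinearMap.smul_apply, coface_diagDer L hx k hk, map_smul]
      simp only [LinearMap.comp_apply, LinearMap.add_apply, LinearMap.sum_apply, map_add, map_sum,
        signedRotate, LinearMap.smul_apply, map_smul, hs 0 (by omega),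
        rotate_diagDer L (ι_mem L hx), coinv_diagDer δ hx, smul_add, Finset.smul_sum,
        smul_comm (δ.toLinearMap x)]
      refine congrArg (· + _) (Finset.sum_congr rfl fun k hk => ?_)
      rw [hs k (Finset.mem_range.1 hk), coinv_diagDer δ hx]) c
  simp only [LinearMap.comp_apply, LinearMap.add_apply, LinearMap.sum_apply] at h
  rw [h, ← barDiff_succ, barDiff_cons, slot, signedRotate, pow_zero, one_smul, zero_add,
    coface_one_cons, comul_one, cons₂_tmul, LinearMap.smul_apply,
    rotate_cons _ (one_mem_grading L), twist_zero, rotate_one_cons, map_add, map_sub, map_smul,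
    coinv_one_cons, coinv_one_cons, coinv_one_cons, hochschildB_eq]

/-! ### The cyclic operator and the operator `B` -/

theorem signedCyclic_coinv {n : ℕ} (c : ⨂[ℂ]^(n + 1) L.Enveloping) :
    δ.mpi.signedCyclic n (δ.coinv n c) = δ.coinv n (signedRotate L n c) := by
  rw [SuperMPI.signedCyclic, LinearMap.smul_apply, cyclicOp_coinv, signedRotate,
    LinearMap.smul_apply, map_smul]

theorem signedCyclic_pow_coinv {n : ℕ} (k : ℕ) (c : ⨂[ℂ]^(n + 1) L.Enveloping) :
    (δ.mpi.signedCyclic n ^ k) (δ.coinv n c) = δ.coinv n ((signedRotate L n ^ k) c) := by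
  induction k with
  | zero => rfl
  | succ k ih => rw [pow_succ', pow_succ', Module.End.mul_apply, ih, signedCyclic_coinv,
      Module.End.mul_apply]

theorem coinv_surjective {n : ℕ} (c : ⨂[ℂ]^n L.Enveloping) : ∃ d, δ.coinv n d = c :=
  ⟨1 ⊹ c, coinv_one_cons δ c⟩

theorem signedCyclic_pow (n : ℕ) : δ.mpi.signedCyclic n ^ (n + 1) = 1 := by
  ext1
  ext c
  obtain ⟨d, hd⟩ := coinv_surjective δ (PiTensorProduct.tprod ℂ c)
  simp only [LinearMap.compMultilinearMap_apply, ← hd, signedCyclic_pow_coinv, signedRotate_pow]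
  rfl

theorem cyclicNorm_coinv {n : ℕ} (c : ⨂[ℂ]^(n + 1) L.Enveloping) :
    cyclicNorm (δ.mpi.signedCyclic n) (n + 1) (δ.coinv n c) =
      δ.coinv n (cyclicNorm (signedRotate L n) (n + 1) c) := by
  simp only [cyclicNorm, LinearMap.sum_apply, signedCyclic_pow_coinv, map_sum]

theorem connesB_eq {n : ℕ} (c : ⨂[ℂ]^(n + 1) L.Enveloping) :
    δ.mpi.connesB n c = cyclicNorm (δ.mpi.signedCyclic n) (n + 1)
      (δ.coinv n (c - δ.mpi.signedCyclic (n + 1) c)) := by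
  rw [SuperMPI.connesB, LinearMap.comp_apply, LinearMap.comp_apply, LinearMap.comp_apply,
    codegeneracy_cyclicOp]
  rfl

theorem connesB_coinv {n : ℕ} (c : ⨂[ℂ]^(n + 2) L.Enveloping) :
    δ.mpi.connesB n (δ.coinv (n + 1) c) = δ.coinv n (cyclicNorm (signedRotate L n) (n + 1)
      (counitHead L (n + 1) (c - signedRotate L (n + 1) c))) := by
  rw [connesB_eq, signedCyclic_coinv, ← map_sub, coinv_coinv, cyclicNorm_coinv]

theorem connesB_connesB {n : ℕ} (c : ⨂[ℂ]^(n + 2) L.Enveloping) :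
    δ.mpi.connesB n (δ.mpi.connesB (n + 1) c) = 0 := by
  rw [connesB_eq δ (n := n + 1), connesB_eq, ← Module.End.mul_apply (δ.mpi.signedCyclic (n + 1)),
    mul_cyclicNorm (signedCyclic_pow δ (n + 1)), sub_self, map_zero, map_zero]

theorem hochschildB_connesB {n : ℕ} (c : ⨂[ℂ]^(n + 1) L.Enveloping) :
    δ.mpi.hochschildB n (δ.mpi.connesB n c) +
      δ.mpi.connesB (n + 1) (δ.mpi.hochschildB (n + 1) c) = 0 := by
  obtain ⟨d, rfl⟩ := coinv_surjective δ c
  rw [connesB_coinv, hochschildB_coinv, hochschildB_coinv, connesB_coinv, ← map_add,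
    cyclic_norm_comm (signedRotate_pow L n) (signedRotate_pow L (n + 1)) (signedRotate_slot L n),
    cyclic_sub_comm (signedRotate_pow L (n + 1)) (signedRotate_pow L (n + 2))
      (signedRotate_slot L (n + 1)), ← barDiff_succ, ← barDiff_succ, ← barDiff_succ, ← map_sub,
    ← map_add, barDiff_counitHead, map_sub, ← Module.End.mul_apply,
    cyclicNorm_mul (signedRotate_pow L (n + 1)), sub_self, map_zero]

theorem totalDifferential_lof_zero (c : ⨂[ℂ]^0 L.Enveloping) :
    δ.mpi.totalDifferential (DirectSum.lof ℂ ℕ (fun k => ⨂[ℂ]^k L.Enveloping) 0 c) = 0 := by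
  simp [SuperMPI.totalDifferential, hochschildB_zero]

theorem totalDifferential_lof_succ {n : ℕ} (c : ⨂[ℂ]^(n + 1) L.Enveloping) :
    δ.mpi.totalDifferential (DirectSum.lof ℂ ℕ (fun k => ⨂[ℂ]^k L.Enveloping) (n + 1) c) =
      DirectSum.lof ℂ ℕ (fun k => ⨂[ℂ]^k L.Enveloping) (n + 2) (δ.mpi.hochschildB (n + 1) c) +
      DirectSum.lof ℂ ℕ (fun k => ⨂[ℂ]^k L.Enveloping) n (δ.mpi.connesB n c) := by
  simp [SuperMPI.totalDifferential]

theorem totalDifferential_totalDifferential (c : SuperMPI.Cochains L.Enveloping) :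
    δ.mpi.totalDifferential (δ.mpi.totalDifferential c) = 0 := by
  refine LinearMap.congr_fun (f := δ.mpi.totalDifferential ∘ₗ δ.mpi.totalDifferential) (g := 0)
    (DirectSum.linearMap_ext ℂ fun n => LinearMap.ext fun c => ?_) c
  simp only [LinearMap.comp_apply, LinearMap.zero_apply]
  rcases n with _ | n
  · rw [totalDifferential_lof_zero, map_zero]
  · rw [totalDifferential_lof_succ, map_add, totalDifferential_lof_succ, hochschildB_hochschildB,
      map_zero, zero_add]
    have h := hochschildB_connesB δ c
    rcases n with _ | n
    · rw [totalDifferential_lof_zero, add_zero]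
      rw [hochschildB_zero] at h
      rw [← map_zero (DirectSum.lof ℂ ℕ (fun k => ⨂[ℂ]^k L.Enveloping) 1), ← h]
      exact congrArg _ (zero_add _).symm
    · rw [totalDifferential_lof_succ, connesB_connesB, map_zero, add_zero, ← map_add]
      refine (congrArg _ ((add_comm _ _).trans h)).trans (map_zero _)

end Character

end SuperLieAlgebra

/-! ### The iterated coderivation of the exterior algebra -/

namespace SuperExterior

variable {𝔤 : Type u} [AddCommGroup 𝔤] [Module ℂ 𝔤] (𝒢 : ZMod 2 → Submodule ℂ 𝔤)
  [DirectSum.Decomposition 𝒢]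

theorem induction {P : SuperExterior 𝒢 → Prop} (one : P 1) (add : ∀ a b, P a → P b → P (a + b))
    (smul : ∀ (r : ℂ) a, P a → P (r • a))
    (mul : ∀ i, ∀ x ∈ 𝒢 i, ∀ a, P a → P (ι 𝒢 x * a)) (a : SuperExterior 𝒢) : P a := by
  obtain ⟨t, rfl⟩ := mk_surjective 𝒢 a
  have key : ∀ s : TensorAlgebra ℂ 𝔤, ∀ b, P b → P (mk 𝒢 s * b) := by
    intro s
    induction s using TensorAlgebra.induction with
    | algebraMap r =>
      intro b hb
      rw [AlgHom.commutes, ← Algebra.smul_def]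
      exact smul r b hb
    | ι x =>
      intro b hb
      change P (ι 𝒢 x * b)
      refine hom_induction 𝒢 x ?_ fun i x hx => mul i x hx b hb
      intro x y hx hy
      rw [map_add, add_mul]
      exact add _ _ hx hy
    | mul s t hs ht =>
      intro b hb
      rw [map_mul, mul_assoc]
      exact hs _ (ht _ hb)
    | add s t hs ht =>
      intro b hb
      rw [map_add, add_mul]
      exact add _ _ (hs _ hb) (ht _ hb)
  simpa using key t 1 one

/-- The component `⋀ⁿ 𝔤 → 𝔤 ⊗ 𝔤 ⊗ ⋀ⁿ⁻² 𝔤` of the coproduct of `⋀ 𝔤`. -/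
def coderiv₂ : SuperExterior 𝒢 →ₗ[ℂ] 𝔤 ⊗[ℂ] (𝔤 ⊗[ℂ] SuperExterior 𝒢) :=
  (coderiv 𝒢).lTensor 𝔤 ∘ₗ coderiv 𝒢

theorem coderiv₂_apply (w : SuperExterior 𝒢) :
    coderiv₂ 𝒢 w = (coderiv 𝒢).lTensor 𝔤 (coderiv 𝒢 w) := rfl

theorem braid_coderiv₂ (w : SuperExterior 𝒢) :
    braid 𝒢 (SuperExterior 𝒢) (coderiv₂ 𝒢 w) = -coderiv₂ 𝒢 w := by
  induction w using SuperExterior.induction with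
  | one => simp [coderiv₂, coderiv_one]
  | add a b ha hb => rw [map_add, map_add, ha, hb, neg_add]
  | smul r a ha => rw [map_smul, map_smul, ha, smul_neg]
  | mul i x hx a ha =>
    let sh : 𝔤 ⊗[ℂ] (𝔤 ⊗[ℂ] SuperExterior 𝒢) →ₗ[ℂ] 𝔤 ⊗[ℂ] (𝔤 ⊗[ℂ] SuperExterior 𝒢) :=
      TensorProduct.map (twist 𝒢 i)
        (TensorProduct.map (twist 𝒢 i) (LinearMap.mulLeft ℂ (ι 𝒢 x)))
    have h1 : ∀ t, (coderiv 𝒢).lTensor 𝔤 (shift 𝒢 x t) =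
        braid 𝒢 _ (x ⊗ₜ t) - sh ((coderiv 𝒢).lTensor 𝔤 t) := by
      intro t
      induction t with
      | zero => simp
      | add s t hs ht =>
        simp only [map_add, TensorProduct.tmul_add, hs, ht]
        abel
      | tmul y w =>
        rw [shift_tmul 𝒢 hx, LinearMap.lTensor_tmul, coderiv_ι_mul, braid_tmul 𝒢 hx,
          LinearMap.lTensor_tmul, TensorProduct.tmul_sub]
        congr 1
        generalize coderiv 𝒢 w = s
        induction s with
        | zero => simp
        | add s t hs ht => simp only [map_add, TensorProduct.tmul_add, hs, ht]
        | tmul z w => simp [sh, shift_tmul 𝒢 hx]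
    have h2 : ∀ t, braid 𝒢 _ (sh t) = sh (braid 𝒢 _ t) := by
      intro t
      refine LinearMap.congr_fun (f := braid 𝒢 _ ∘ₗ sh) (g := sh ∘ₗ braid 𝒢 _)
        (tensor_ext_hom₂ 𝒢 fun j y hy k z hz c => ?_) t
      simp [sh, braid_tmul 𝒢 hy, braid_tmul 𝒢 (twist_mem 𝒢 hy i), twist_comm _ j i]
    rw [coderiv₂_apply, coderiv_ι_mul, map_sub, h1, LinearMap.lTensor_tmul, map_sub, map_sub,
      braid_braid, h2, ← coderiv₂_apply, ha, map_neg]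
    abel

end SuperExterior

namespace SuperLieAlgebra

open SuperExterior

variable {𝔤 : Type u} [AddCommGroup 𝔤] [Module ℂ 𝔤] {𝒢 : ZMod 2 → Submodule ℂ 𝔤}
  [DirectSum.Decomposition 𝒢] (L : SuperLieAlgebra 𝒢)

/-- The coderivation `x₁ ∧ ⋯ ∧ xₙ ↦ ∑ ± [x_i, x_j] ∧ x₁ ∧ ⋯ ∧ xₙ` (sum over all `i ≠ j`). -/
def bracketCoder : SuperExterior 𝒢 →ₗ[ℂ] SuperExterior 𝒢 :=
  Character.bracketWedge L ∘ₗ coderiv₂ 𝒢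

/-- The map `x ⊗ y ⊗ w ↦ [x, y] ⊗ w`. -/
def bracketHead (X : Type*) [AddCommGroup X] [Module ℂ X] : 𝔤 ⊗[ℂ] (𝔤 ⊗[ℂ] X) →ₗ[ℂ] 𝔤 ⊗[ℂ] X :=
  (TensorProduct.lift L.bracket).rTensor X ∘ₗ (TensorProduct.assoc ℂ 𝔤 𝔤 X).symm.toLinearMap

theorem bracketHead_tmul {X : Type*} [AddCommGroup X] [Module ℂ X] (x y : 𝔤) (c : X) :
    bracketHead L X (x ⊗ₜ (y ⊗ₜ c)) = L.bracket x y ⊗ₜ c := by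
  simp [bracketHead]

theorem coderiv_bracketCoder (w : SuperExterior 𝒢) :
    coderiv 𝒢 (bracketCoder L w) = bracketHead L (SuperExterior 𝒢) (coderiv₂ 𝒢 w) -
      (bracketCoder L).lTensor 𝔤 (coderiv 𝒢 w) := by
  let R := (coderiv₂ 𝒢).lTensor 𝔤 (coderiv 𝒢 w)
  have hR : R = ((coderiv 𝒢).lTensor 𝔤).lTensor 𝔤 (coderiv₂ 𝒢 w) := by
    rw [coderiv₂_apply, ← LinearMap.comp_apply (((coderiv 𝒢).lTensor 𝔤).lTensor 𝔤),
      ← LinearMap.lTensor_comp]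
    rfl
  have h1 : braid 𝒢 _ R = -R := by
    rw [hR, braid_natural, braid_coderiv₂, map_neg]
  have h2 : (braid 𝒢 (SuperExterior 𝒢)).lTensor 𝔤 R = -R := by
    have : braid 𝒢 (SuperExterior 𝒢) ∘ₗ coderiv₂ 𝒢 = -coderiv₂ 𝒢 :=
      LinearMap.ext (braid_coderiv₂ 𝒢)
    rw [← LinearMap.comp_apply, ← LinearMap.lTensor_comp, this, LinearMap.lTensor_neg]
    rfl
  let Ψ : 𝔤 ⊗[ℂ] (𝔤 ⊗[ℂ] (𝔤 ⊗[ℂ] SuperExterior 𝒢)) →ₗ[ℂ] 𝔤 ⊗[ℂ] SuperExterior 𝒢 :=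
    TensorProduct.lift (shift 𝒢) ∘ₗ bracketHead L _
  have h3 : ∀ r, Ψ r = (Character.bracketWedge L).lTensor 𝔤
      (braid 𝒢 _ ((braid 𝒢 (SuperExterior 𝒢)).lTensor 𝔤 r)) := by
    intro r
    refine LinearMap.congr_fun (f := Ψ) (g := (Character.bracketWedge L).lTensor 𝔤 ∘ₗ
      braid 𝒢 _ ∘ₗ (braid 𝒢 (SuperExterior 𝒢)).lTensor 𝔤)
      (tensor_ext_hom₂ 𝒢 fun i x hx j y hy t => ?_) r
    induction t with
    | zero => simp
    | add s t hs ht => simp only [map_add, TensorProduct.tmul_add, hs, ht]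
    | tmul z c =>
      simp [Ψ, bracketHead_tmul, shift_tmul 𝒢 (L.bracket_mem hx hy), braid_tmul 𝒢 hy,
        braid_tmul 𝒢 hx, twist_add, Character.bracketWedge_tmul]
  have h4 : ∀ t : 𝔤 ⊗[ℂ] (𝔤 ⊗[ℂ] SuperExterior 𝒢), coderiv 𝒢 (Character.bracketWedge L t) =
      bracketHead L _ t - Ψ (((coderiv 𝒢).lTensor 𝔤).lTensor 𝔤 t) := by
    intro t
    refine LinearMap.congr_fun (f := coderiv 𝒢 ∘ₗ Character.bracketWedge L)
      (g := bracketHead L _ - Ψ ∘ₗ ((coderiv 𝒢).lTensor 𝔤).lTensor 𝔤)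
      (tensor_ext_hom₂ 𝒢 fun i x hx j y hy t => ?_) t
    simp [Ψ, bracketHead_tmul, Character.bracketWedge_tmul, coderiv_ι_mul]
  have h5 : (bracketCoder L).lTensor 𝔤 (coderiv 𝒢 w) =
      (Character.bracketWedge L).lTensor 𝔤 R := by
    rw [bracketCoder, LinearMap.lTensor_comp]
    rfl
  rw [h5, bracketCoder, LinearMap.comp_apply, h4, ← hR, h3, h2, map_neg, h1, neg_neg]

/-! ### The antisymmetrization map and the operators `b` and `B` -/

open Enveloping

theorem antisymmetrization_succ (n : ℕ) (w : SuperExterior 𝒢) :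
    antisymmetrization L (n + 1) w = ((n : ℂ) + 1)⁻¹ • consEquiv L.Enveloping n
      (TensorProduct.map (ι L) (antisymmetrization L n) (coderiv 𝒢 w)) := rfl

theorem antisymmetrization_zero (w : SuperExterior 𝒢) :
    antisymmetrization L 0 w = augmentation 𝒢 w • antisymmetrization L 0 1 := by
  simp [antisymmetrization]

theorem counitHead_snoc_antisymmetrization (n : ℕ) (t : 𝔤 ⊗[ℂ] SuperExterior 𝒢) :
    counitHead L (n + 1) (snoc L (n + 1) (consEquiv L.Enveloping n
      (TensorProduct.map (ι L) (antisymmetrization L n) t))) = 0 := by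
  induction t with
  | zero => simp
  | add s t hs ht => simp only [map_add, hs, ht, add_zero]
  | tmul x w =>
    have := counitHom_ι_mul L x 1
    rw [mul_one] at this
    rw [TensorProduct.map_tmul, coface_succ_cons, counitHead_cons, this, zero_smul]

theorem headSwap_antisymmetrization (n : ℕ) (w : SuperExterior 𝒢) :
    headSwap (grading L) n (antisymmetrization L (n + 2) w) =
      -antisymmetrization L (n + 2) w := by
  have h1 : ∀ w, antisymmetrization L (n + 2) w = (((n + 1 : ℕ) : ℂ) + 1)⁻¹ •
      ((n : ℂ) + 1)⁻¹ • consEquiv L.Enveloping (n + 1)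
        ((consEquiv L.Enveloping n).toLinearMap.lTensor _
        (TensorProduct.map (ι L) (TensorProduct.map (ι L) (antisymmetrization L n))
          (coderiv₂ 𝒢 w))) := by
    intro w
    rw [antisymmetrization_succ, coderiv₂_apply]
    congr 1
    generalize coderiv 𝒢 w = t
    induction t with
    | zero => simp
    | add s t hs ht => simp only [map_add, hs, ht, smul_add]
    | tmul x w =>
      simp [antisymmetrization_succ]
  have h2 : ∀ t : 𝔤 ⊗[ℂ] (𝔤 ⊗[ℂ] SuperExterior 𝒢), headSwap (grading L) n
      (consEquiv L.Enveloping (n + 1) ((consEquiv L.Enveloping n).toLinearMap.lTensor _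
        (TensorProduct.map (ι L) (TensorProduct.map (ι L) (antisymmetrization L n)) t))) =
      consEquiv L.Enveloping (n + 1) ((consEquiv L.Enveloping n).toLinearMap.lTensor _
        (TensorProduct.map (ι L) (TensorProduct.map (ι L) (antisymmetrization L n))
          (braid 𝒢 _ t))) := by
    intro t
    refine LinearMap.congr_fun (f := headSwap (grading L) n ∘ₗ
      (consEquiv L.Enveloping (n + 1)).toLinearMap ∘ₗ
        (consEquiv L.Enveloping n).toLinearMap.lTensor _ ∘ₗ
        TensorProduct.map (ι L) (TensorProduct.map (ι L) (antisymmetrization L n)))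
      (g := (consEquiv L.Enveloping (n + 1)).toLinearMap ∘ₗ
        (consEquiv L.Enveloping n).toLinearMap.lTensor _ ∘ₗ
        TensorProduct.map (ι L) (TensorProduct.map (ι L) (antisymmetrization L n)) ∘ₗ
        braid 𝒢 _) (tensor_ext_hom₂ 𝒢 fun i x hx j y hy w => ?_) t
    simp only [LinearMap.comp_apply, TensorProduct.map_tmul, LinearMap.lTensor_tmul,
      LinearEquiv.coe_coe, headSwap_cons _ (ι_mem L hx), braid_tmul 𝒢 hx,
      twist_of_mem _ (ι_mem L hy), twist_of_mem _ hy, map_smul,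
      ← TensorProduct.smul_tmul']
  rw [h1, map_smul, map_smul, h2, braid_coderiv₂]
  simp only [map_neg, smul_neg]

theorem rotate_antisymmetrization (n : ℕ) (w : SuperExterior 𝒢) :
    rotate (grading L) n (antisymmetrization L (n + 1) w) =
      (-1 : ℂ) ^ n • antisymmetrization L (n + 1) w := by
  induction n generalizing w with
  | zero => simp [rotate]
  | succ n ih =>
    rw [rotate, LinearMap.comp_apply, headSwap_antisymmetrization, map_neg,
      antisymmetrization_succ, map_smul, smul_comm]
    refine (smul_neg _ _).symm.trans (congrArg _ ?_)
    generalize coderiv 𝒢 w = t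
    induction t with
    | zero => simp
    | add s t hs ht =>
      simp only [map_add, smul_add, neg_add] at hs ht ⊢
      rw [hs, ht]
    | tmul x w => rw [TensorProduct.map_tmul, consMap_cons, ih, cons_smul, pow_succ, mul_neg_one,
        neg_smul]

theorem signedRotate_antisymmetrization (n : ℕ) (w : SuperExterior 𝒢) :
    signedRotate L n (antisymmetrization L (n + 1) w) = antisymmetrization L (n + 1) w := by
  rw [signedRotate, LinearMap.smul_apply, rotate_antisymmetrization, smul_smul, ← mul_pow]
  simp

/-- The sum of the actions of the factors of `w` on the antisymmetrization of the rest. -/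
def actAntisymm (n : ℕ) : SuperExterior 𝒢 →ₗ[ℂ] ⨂[ℂ]^n L.Enveloping :=
  diagAct (grading L) n ∘ₗ TensorProduct.map (ι L) (antisymmetrization L n) ∘ₗ coderiv 𝒢

theorem actAntisymm_eq (n : ℕ) (w : SuperExterior 𝒢) :
    actAntisymm L n w = (2⁻¹ : ℂ) • antisymmetrization L n (bracketCoder L w) := by
  induction n generalizing w with
  | zero =>
    have h1 : ∀ t : 𝔤 ⊗[ℂ] SuperExterior 𝒢, diagAct (grading L) 0
        (TensorProduct.map (ι L) (antisymmetrization L 0) t) = 0 := by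
      intro t
      induction t with
      | zero => simp
      | add s t hs ht => simp only [map_add, hs, ht, add_zero]
      | tmul x w =>
        have := counitHom_ι_mul L x 1
        rw [mul_one] at this
        rw [TensorProduct.map_tmul, diagAct_zero, this, zero_smul]
    have h2 : ∀ t : 𝔤 ⊗[ℂ] (𝔤 ⊗[ℂ] SuperExterior 𝒢),
        augmentation 𝒢 (Character.bracketWedge L t) = 0 := by
      intro t
      refine LinearMap.congr_fun (f := (augmentation 𝒢).toLinearMap ∘ₗ Character.bracketWedge L)
        (g := 0) (tensor_ext_hom₂ 𝒢 fun i x hx j y hy w => ?_) t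
      simp [Character.bracketWedge_tmul, augmentation, SuperExterior.lift_ι]
    rw [actAntisymm, LinearMap.comp_apply, LinearMap.comp_apply, h1, antisymmetrization_zero,
      bracketCoder, LinearMap.comp_apply, h2, zero_smul, smul_zero]
  | succ n ih =>
    let F : 𝔤 ⊗[ℂ] SuperExterior 𝒢 →ₗ[ℂ] ⨂[ℂ]^(n + 1) L.Enveloping :=
      (consEquiv L.Enveloping n).toLinearMap ∘ₗ TensorProduct.map (ι L) (antisymmetrization L n)
    let G : 𝔤 ⊗[ℂ] (𝔤 ⊗[ℂ] SuperExterior 𝒢) →ₗ[ℂ] ⨂[ℂ]^(n + 1) L.Enveloping :=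
      (consEquiv L.Enveloping n).toLinearMap ∘ₗ TensorProduct.map (ι L)
        (diagAct (grading L) n ∘ₗ TensorProduct.map (ι L) (antisymmetrization L n))
    let K : 𝔤 ⊗[ℂ] (𝔤 ⊗[ℂ] SuperExterior 𝒢) →ₗ[ℂ] ⨂[ℂ]^(n + 1) L.Enveloping :=
      (consEquiv L.Enveloping n).toLinearMap ∘ₗ TensorProduct.map
        (LinearMap.mul' ℂ L.Enveloping ∘ₗ TensorProduct.map (ι L) (ι L))
        (antisymmetrization L n) ∘ₗ (TensorProduct.assoc ℂ 𝔤 𝔤 _).symm.toLinearMap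
    have hK : ∀ x y w, K (x ⊗ₜ (y ⊗ₜ w)) = (ι L x * ι L y) ⊹ antisymmetrization L n w := by
      intro x y w
      simp [K]
    have hG : ∀ x y w, G (x ⊗ₜ (y ⊗ₜ w)) =
        ι L x ⊹ diagAct (grading L) n (ι L y ⊗ₜ antisymmetrization L n w) := by
      intro x y w
      simp [G]
    have hF : ∀ x w, F (x ⊗ₜ w) = ι L x ⊹ antisymmetrization L n w := by
      intro x w
      simp [F]
    have h1 : ∀ t : 𝔤 ⊗[ℂ] SuperExterior 𝒢, diagAct (grading L) (n + 1)
        (TensorProduct.map (ι L) (antisymmetrization L (n + 1)) t) = ((n : ℂ) + 1)⁻¹ •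
        (K ((coderiv 𝒢).lTensor 𝔤 t) + G (braid 𝒢 _ ((coderiv 𝒢).lTensor 𝔤 t))) := by
      intro t
      refine LinearMap.congr_fun (f := diagAct (grading L) (n + 1) ∘ₗ
        TensorProduct.map (ι L) (antisymmetrization L (n + 1)))
        (g := ((n : ℂ) + 1)⁻¹ • (K ∘ₗ (coderiv 𝒢).lTensor 𝔤 +
          G ∘ₗ braid 𝒢 _ ∘ₗ (coderiv 𝒢).lTensor 𝔤)) (tensor_ext_hom 𝒢 fun i x hx w => ?_) t
      simp only [LinearMap.comp_apply, LinearMap.smul_apply, LinearMap.add_apply,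
        TensorProduct.map_tmul, LinearMap.lTensor_tmul, antisymmetrization_succ,
        TensorProduct.tmul_smul, map_smul]
      congr 1
      generalize coderiv 𝒢 w = s
      refine LinearMap.congr_fun (f := diagAct (grading L) (n + 1) ∘ₗ
        TensorProduct.mk ℂ _ _ (ι L x) ∘ₗ F)
        (g := K ∘ₗ TensorProduct.mk ℂ _ _ x + G ∘ₗ braid 𝒢 _ ∘ₗ TensorProduct.mk ℂ _ _ x)
        (tensor_ext_hom 𝒢 fun j y hy w => ?_) s
      simp only [LinearMap.comp_apply, LinearMap.add_apply, TensorProduct.mk_apply, hF, hK,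
        braid_tmul 𝒢 hx, hG, diagAct_ι L hx, diagDer_cons, twist_of_mem _ hy,
        twist_of_mem _ (ι_mem L hy), map_smul]
    have h2 : ∀ t, K t - K (braid 𝒢 _ t) = F (bracketHead L _ t) := by
      intro t
      refine LinearMap.congr_fun (f := K - K ∘ₗ braid 𝒢 _) (g := F ∘ₗ bracketHead L _)
        (tensor_ext_hom₂ 𝒢 fun i x hx j y hy w => ?_) t
      simp only [LinearMap.sub_apply, LinearMap.comp_apply, braid_tmul 𝒢 hx, hK, bracketHead_tmul,
        hF, ← ι_mul_ι L hx hy, sub_cons, twist_of_mem _ hy, map_smul, smul_mul_assoc]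
    have h3 : K (coderiv₂ 𝒢 w) = (2⁻¹ : ℂ) • F (bracketHead L _ (coderiv₂ 𝒢 w)) := by
      have := h2 (coderiv₂ 𝒢 w)
      rw [braid_coderiv₂, map_neg, sub_neg_eq_add, ← two_smul ℂ] at this
      rw [← this, smul_smul, inv_mul_cancel₀ two_ne_zero, one_smul]
    have h4 : G (coderiv₂ 𝒢 w) =
        (2⁻¹ : ℂ) • F ((bracketCoder L).lTensor 𝔤 (coderiv 𝒢 w)) := by
      rw [coderiv₂_apply]
      generalize coderiv 𝒢 w = t
      induction t with
      | zero => simp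
      | add s t hs ht => simp only [map_add, hs, ht, smul_add]
      | tmul x w =>
        have := ih w
        simp only [actAntisymm, LinearMap.comp_apply] at this
        simp only [LinearMap.lTensor_tmul, hF, G, LinearMap.comp_apply, TensorProduct.map_tmul,
          this, LinearEquiv.coe_coe, cons_smul]
    rw [actAntisymm, LinearMap.comp_apply, LinearMap.comp_apply, h1, ← coderiv₂_apply,
      braid_coderiv₂, map_neg, h3, h4, antisymmetrization_succ, coderiv_bracketCoder, smul_comm,
      ← sub_eq_add_neg, ← smul_sub, ← map_sub]
    rfl

namespace Character

variable {L} (δ : L.Character)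

theorem hochschildB_antisymmetrization (n : ℕ) (w : SuperExterior 𝒢) :
    δ.mpi.hochschildB n (L.antisymmetrization n w) = 0 := by
  induction n generalizing w with
  | zero => exact hochschildB_zero δ _
  | succ n ih =>
    rw [antisymmetrization_succ, map_smul]
    generalize coderiv 𝒢 w = t
    induction t with
    | zero => simp
    | add s t hs ht =>
      simp only [map_add, smul_add] at hs ht ⊢
      rw [hs, ht, add_zero]
    | tmul x w =>
      have hc : cobound (L := L) (ι L x) = 0 := by
        refine hom_induction 𝒢 (P := fun x => cobound (ι L x) = 0) x (fun a b ha hb => by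
          rw [map_add, map_add, ha, hb, add_zero]) ?_
        intro i x hx
        have := comul_ι_mul L hx 1
        rw [mul_one, comul_one, comulStep_tmul, mul_one, twist_one] at this
        rw [cobound_apply, this]
        abel
      rw [TensorProduct.map_tmul, hochschildB_cons, ih, hc, TensorProduct.zero_tmul, map_zero,
        cons_zero, sub_zero, smul_zero]

theorem coinv_antisymmetrization (n : ℕ) (w : SuperExterior 𝒢) :
    ((n : ℂ) + 1) • δ.coinv n (L.antisymmetrization (n + 1) w) =
      L.antisymmetrization n (δ.ceDifferential w) := by
  have h0 : (n : ℂ) + 1 ≠ 0 := Nat.cast_add_one_ne_zero n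
  have h1 : ∀ t : 𝔤 ⊗[ℂ] SuperExterior 𝒢, δ.coinv n (consEquiv L.Enveloping n
      (TensorProduct.map (ι L) (antisymmetrization L n) t)) =
      antisymmetrization L n (TensorProduct.lid ℂ _ (δ.toLinearMap.rTensor _ t)) -
        diagAct (grading L) n (TensorProduct.map (ι L) (antisymmetrization L n) t) := by
    intro t
    refine LinearMap.congr_fun (f := δ.coinv n ∘ₗ (consEquiv L.Enveloping n).toLinearMap ∘ₗ
      TensorProduct.map (ι L) (antisymmetrization L n)) (g := antisymmetrization L n ∘ₗ
        (TensorProduct.lid ℂ _).toLinearMap ∘ₗ δ.toLinearMap.rTensor _ -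
        diagAct (grading L) n ∘ₗ TensorProduct.map (ι L) (antisymmetrization L n))
      (tensor_ext_hom 𝒢 fun i x hx w => ?_) t
    have := twistedAntipode_ι_mul δ hx 1
    rw [mul_one, twistedAntipode_one, twist_one, one_mul] at this
    simp only [LinearMap.comp_apply, LinearMap.sub_apply, LinearEquiv.coe_coe,
      TensorProduct.map_tmul, coinv_cons, this, LinearMap.rTensor_tmul, TensorProduct.lid_tmul,
      TensorProduct.sub_tmul, map_sub, ← TensorProduct.smul_tmul', map_smul, diagAct_one]
  have h2 := actAntisymm_eq L n w
  simp only [actAntisymm, LinearMap.comp_apply] at h2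
  rw [antisymmetrization_succ, map_smul, smul_smul, mul_inv_cancel₀ h0, one_smul, h1, h2,
    ← map_smul, ← map_sub]
  rfl

theorem connesB_antisymmetrization (n : ℕ) (w : SuperExterior 𝒢) :
    δ.mpi.connesB n (L.antisymmetrization (n + 1) w) =
      L.antisymmetrization n (δ.ceDifferential w) := by
  have h1 : δ.coinv n (δ.mpi.signedCyclic (n + 1) (L.antisymmetrization (n + 1) w)) = 0 := by
    rw [SuperMPI.signedCyclic, LinearMap.smul_apply, cyclicOp_eq, map_smul, coinv_coinv,
      antisymmetrization_succ, map_smul, map_smul, counitHead_snoc_antisymmetrization, smul_zero,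
      map_zero, smul_zero]
  have h2 : ∀ k, (signedRotate L n ^ k) (L.antisymmetrization (n + 1) w) =
      L.antisymmetrization (n + 1) w := by
    intro k
    induction k with
    | zero => rfl
    | succ k ih => rw [pow_succ, Module.End.mul_apply, signedRotate_antisymmetrization, ih]
  rw [connesB_eq, map_sub, h1, sub_zero, cyclicNorm_coinv, ← coinv_antisymmetrization, cyclicNorm,
    LinearMap.sum_apply]
  simp only [h2, Finset.sum_const, Finset.card_range, map_nsmul]
  rw [← Nat.cast_smul_eq_nsmul ℂ]
  push_cast
  rfl

end Character

end SuperLieAlgebra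

/-! ### A linear retraction of the enveloping algebra onto the Lie algebra -/

theorem consMap_zero {V : Type*} [AddCommGroup V] [Module ℂ V] (m n : ℕ) :
    consMap (0 : (⨂[ℂ]^m V) →ₗ[ℂ] ⨂[ℂ]^n V) = 0 :=
  power_ext fun v c => by simp [consMap_cons]

section AdjSwap

variable {V : Type*} [AddCommGroup V] [Module ℂ V] (𝒱 : ZMod 2 → Submodule ℂ V)
  [DirectSum.Decomposition 𝒱]

/-- The super transposition of the factors `i` and `i + 1` (counted from `0`) of `V^{⊗ n}`; it is
the identity if there are no such factors. -/
def adjSwap : (i n : ℕ) → Module.End ℂ (⨂[ℂ]^n V)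
  | 0, 0 => LinearMap.id
  | 0, 1 => LinearMap.id
  | 0, n + 2 => headSwap 𝒱 n
  | _ + 1, 0 => LinearMap.id
  | i + 1, n + 1 => consMap (adjSwap i n)

theorem adjSwap_zero_cons {n : ℕ} {i : ZMod 2} {v : V} (hv : v ∈ 𝒱 i) (w : V) (c : ⨂[ℂ]^n V) :
    adjSwap 𝒱 0 (n + 2) (v ⊹ w ⊹ c) = twist 𝒱 i w ⊹ v ⊹ c := by
  rw [adjSwap, headSwap_cons 𝒱 hv]

theorem adjSwap_succ_cons {i n : ℕ} (v : V) (c : ⨂[ℂ]^n V) :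
    adjSwap 𝒱 (i + 1) (n + 1) (v ⊹ c) = v ⊹ adjSwap 𝒱 i n c := by
  rw [adjSwap, consMap_cons]

theorem adjSwap_of_lt (i n : ℕ) (h : n < i + 2) : adjSwap 𝒱 i n = LinearMap.id := by
  induction i generalizing n with
  | zero =>
    rcases n with _ | _ | n
    · rfl
    · rfl
    · omega
  | succ i ih =>
    rcases n with _ | n
    · rfl
    · rw [adjSwap, ih n (by omega), consMap_id]

theorem adjSwap_adjSwap (i n : ℕ) (c : ⨂[ℂ]^n V) : adjSwap 𝒱 i n (adjSwap 𝒱 i n c) = c := by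
  induction i generalizing n with
  | zero =>
    rcases n with _ | _ | n
    · rfl
    · rfl
    · refine LinearMap.congr_fun (f := adjSwap 𝒱 0 (n + 2) ∘ₗ adjSwap 𝒱 0 (n + 2))
        (g := LinearMap.id) (power_ext_hom₂ 𝒱 fun p x hx q y hy c => ?_) c
      simp only [LinearMap.comp_apply, adjSwap_zero_cons 𝒱 hx, adjSwap_zero_cons 𝒱 hy, map_smul,
        twist_of_mem 𝒱 hx, twist_of_mem 𝒱 hy, smul_cons, smul_smul, koszul_comm q p,
        koszul_mul_self, one_smul, LinearMap.id_apply]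
  | succ i ih =>
    rcases n with _ | n
    · rfl
    · refine LinearMap.congr_fun (f := adjSwap 𝒱 (i + 1) (n + 1) ∘ₗ adjSwap 𝒱 (i + 1) (n + 1))
        (g := LinearMap.id) (power_ext fun x c => ?_) c
      simp only [LinearMap.comp_apply, adjSwap_succ_cons, ih, LinearMap.id_apply]

theorem adjSwap_comm (i k n : ℕ) (c : ⨂[ℂ]^n V) :
    adjSwap 𝒱 i n (adjSwap 𝒱 (i + k + 2) n c) = adjSwap 𝒱 (i + k + 2) n (adjSwap 𝒱 i n c) := by
  induction i generalizing n with
  | zero =>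
    rcases n with _ | _ | n
    · rfl
    · rfl
    · refine LinearMap.congr_fun (f := adjSwap 𝒱 0 (n + 2) ∘ₗ adjSwap 𝒱 (0 + k + 2) (n + 2))
        (g := adjSwap 𝒱 (0 + k + 2) (n + 2) ∘ₗ adjSwap 𝒱 0 (n + 2))
        (power_ext_hom₂ 𝒱 fun p x hx q y hy c => ?_) c
      simp only [LinearMap.comp_apply, adjSwap_zero_cons 𝒱 hx, adjSwap_succ_cons]
  | succ i ih =>
    rcases n with _ | n
    · rfl
    · rw [show i + 1 + k + 2 = i + k + 2 + 1 by ring]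
      refine LinearMap.congr_fun
        (f := adjSwap 𝒱 (i + 1) (n + 1) ∘ₗ adjSwap 𝒱 (i + k + 2 + 1) (n + 1))
        (g := adjSwap 𝒱 (i + k + 2 + 1) (n + 1) ∘ₗ adjSwap 𝒱 (i + 1) (n + 1))
        (power_ext fun x c => ?_) c
      simp only [LinearMap.comp_apply, adjSwap_succ_cons, ih]

theorem adjSwap_braid (i n : ℕ) (h : i + 3 ≤ n) (c : ⨂[ℂ]^n V) :
    adjSwap 𝒱 i n (adjSwap 𝒱 (i + 1) n (adjSwap 𝒱 i n c)) =
      adjSwap 𝒱 (i + 1) n (adjSwap 𝒱 i n (adjSwap 𝒱 (i + 1) n c)) := by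
  induction i generalizing n with
  | zero =>
    obtain ⟨n, rfl⟩ : ∃ m, n = m + 3 := ⟨n - 3, by omega⟩
    refine LinearMap.congr_fun
      (f := adjSwap 𝒱 0 (n + 3) ∘ₗ adjSwap 𝒱 1 (n + 3) ∘ₗ adjSwap 𝒱 0 (n + 3))
      (g := adjSwap 𝒱 1 (n + 3) ∘ₗ adjSwap 𝒱 0 (n + 3) ∘ₗ adjSwap 𝒱 1 (n + 3))
      (power_ext_hom₃ 𝒱 fun p x hx q y hy r z hz c => ?_) c
    have h1 : ∀ (v : V) (c : ⨂[ℂ]^(n + 2) V),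
      adjSwap 𝒱 1 (n + 3) (v ⊹ c) = v ⊹ adjSwap 𝒱 0 (n + 2) c := adjSwap_succ_cons 𝒱
    simp only [LinearMap.comp_apply, adjSwap_zero_cons 𝒱 hx, h1, adjSwap_zero_cons 𝒱 hy,
      adjSwap_zero_cons 𝒱 (twist_mem 𝒱 hy _),
      twist_comm 𝒱 p q]
  | succ i ih =>
    rcases n with _ | n
    · omega
    · refine LinearMap.congr_fun
        (f := adjSwap 𝒱 (i + 1) (n + 1) ∘ₗ adjSwap 𝒱 (i + 2) (n + 1) ∘ₗ adjSwap 𝒱 (i + 1) (n + 1))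
        (g := adjSwap 𝒱 (i + 2) (n + 1) ∘ₗ adjSwap 𝒱 (i + 1) (n + 1) ∘ₗ adjSwap 𝒱 (i + 2) (n + 1))
        (power_ext fun x c => ?_) c
      simp only [LinearMap.comp_apply, adjSwap_succ_cons, ih n (by omega)]

end AdjSwap

namespace SuperLieAlgebra

variable {𝔤 : Type u} [AddCommGroup 𝔤] [Module ℂ 𝔤] {𝒢 : ZMod 2 → Submodule ℂ 𝔤}
  [DirectSum.Decomposition 𝒢] (L : SuperLieAlgebra 𝒢)

/-- The map `(x, y, c) ↦ ([x, y], c)`. -/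
def headBracket (n : ℕ) : (⨂[ℂ]^(n + 2) 𝔤) →ₗ[ℂ] ⨂[ℂ]^(n + 1) 𝔤 :=
  (consEquiv 𝔤 n).toLinearMap ∘ₗ bracketHead L _ ∘ₗ
    (consEquiv 𝔤 n).symm.toLinearMap.lTensor 𝔤 ∘ₗ (consEquiv 𝔤 (n + 1)).symm.toLinearMap

/-- The bracket of the factors `i` and `i + 1` (counted from `0`) of `𝔤^{⊗ (n+1)}`; it is zero if
there are no such factors. -/
def adjBracket : (i n : ℕ) → (⨂[ℂ]^(n + 1) 𝔤) →ₗ[ℂ] ⨂[ℂ]^n 𝔤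
  | 0, 0 => 0
  | 0, n + 1 => headBracket L n
  | _ + 1, 0 => 0
  | i + 1, n + 1 => consMap (adjBracket i n)

theorem adjBracket_zero_cons {n : ℕ} (x y : 𝔤) (c : ⨂[ℂ]^n 𝔤) :
    adjBracket L 0 (n + 1) (x ⊹ y ⊹ c) = L.bracket x y ⊹ c := by
  simp [adjBracket, headBracket, bracketHead_tmul]

theorem adjBracket_succ_cons {i n : ℕ} (x : 𝔤) (c : ⨂[ℂ]^(n + 1) 𝔤) :
    adjBracket L (i + 1) (n + 1) (x ⊹ c) = x ⊹ adjBracket L i n c := by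
  rw [adjBracket, consMap_cons]

theorem adjBracket_of_lt (i n : ℕ) (h : n < i + 1) : adjBracket L i n = 0 := by
  induction i generalizing n with
  | zero =>
    obtain rfl : n = 0 := by omega
    rfl
  | succ i ih =>
    rcases n with _ | n
    · rfl
    · rw [adjBracket, ih n (by omega), consMap_zero]

theorem adjBracket_adjSwap (i n : ℕ) (c : ⨂[ℂ]^(n + 1) 𝔤) :
    adjBracket L i n (adjSwap 𝒢 i (n + 1) c) = -adjBracket L i n c := by
  induction i generalizing n with
  | zero =>
    rcases n with _ | n
    · simp [adjBracket]
    · refine LinearMap.congr_fun (f := adjBracket L 0 (n + 1) ∘ₗ adjSwap 𝒢 0 (n + 2))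
        (g := -adjBracket L 0 (n + 1)) (power_ext_hom₂ 𝒢 fun p x hx q y hy c => ?_) c
      simp only [LinearMap.comp_apply, LinearMap.neg_apply, adjSwap_zero_cons 𝒢 hx,
        adjBracket_zero_cons, twist_of_mem 𝒢 hy, map_smul, smul_cons]
      rw [L.skew hx hy, ← neg_one_smul ℂ (koszul p q • _), smul_cons, smul_cons]
      module
  | succ i ih =>
    rcases n with _ | n
    · simp [adjBracket]
    · refine LinearMap.congr_fun (f := adjBracket L (i + 1) (n + 1) ∘ₗ adjSwap 𝒢 (i + 1) (n + 2))
        (g := -adjBracket L (i + 1) (n + 1)) (power_ext fun x c => ?_) c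
      simp only [LinearMap.comp_apply, LinearMap.neg_apply, adjSwap_succ_cons,
        adjBracket_succ_cons, ih, cons_neg]

theorem adjBracket_adjSwap_right (i k n : ℕ) (c : ⨂[ℂ]^(n + 1) 𝔤) :
    adjBracket L i n (adjSwap 𝒢 (i + k + 2) (n + 1) c) =
      adjSwap 𝒢 (i + k + 1) n (adjBracket L i n c) := by
  induction i generalizing n with
  | zero =>
    rcases n with _ | n
    · simp [adjBracket]
    · refine LinearMap.congr_fun (f := adjBracket L 0 (n + 1) ∘ₗ adjSwap 𝒢 (0 + k + 2) (n + 2))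
        (g := adjSwap 𝒢 (0 + k + 1) (n + 1) ∘ₗ adjBracket L 0 (n + 1))
        (power_ext_hom₂ 𝒢 fun p x hx q y hy c => ?_) c
      simp only [LinearMap.comp_apply, adjSwap_succ_cons, adjBracket_zero_cons]
  | succ i ih =>
    rcases n with _ | n
    · simp [adjBracket]
    · rw [show i + 1 + k + 2 = i + k + 2 + 1 by ring, show i + 1 + k + 1 = i + k + 1 + 1 by ring]
      refine LinearMap.congr_fun
        (f := adjBracket L (i + 1) (n + 1) ∘ₗ adjSwap 𝒢 (i + k + 2 + 1) (n + 2))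
        (g := adjSwap 𝒢 (i + k + 1 + 1) (n + 1) ∘ₗ adjBracket L (i + 1) (n + 1))
        (power_ext fun x c => ?_) c
      simp only [LinearMap.comp_apply, adjSwap_succ_cons, adjBracket_succ_cons, ih]

theorem adjBracket_adjSwap_left (i k n : ℕ) (c : ⨂[ℂ]^(n + 1) 𝔤) :
    adjBracket L (i + k + 2) n (adjSwap 𝒢 i (n + 1) c) =
      adjSwap 𝒢 i n (adjBracket L (i + k + 2) n c) := by
  induction i generalizing n with
  | zero =>
    rcases n with _ | _ | n
    · simp [adjBracket]
    · simp [adjBracket_of_lt L (k + 2) 1 (by omega)]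
    · refine LinearMap.congr_fun
        (f := adjBracket L (0 + k + 2) (n + 2) ∘ₗ adjSwap 𝒢 0 (n + 3))
        (g := adjSwap 𝒢 0 (n + 2) ∘ₗ adjBracket L (0 + k + 2) (n + 2))
        (power_ext_hom₂ 𝒢 fun p x hx q y hy c => ?_) c
      simp only [LinearMap.comp_apply, adjSwap_zero_cons 𝒢 hx, adjBracket_succ_cons]
  | succ i ih =>
    rcases n with _ | n
    · simp [adjBracket]
    · rw [show i + 1 + k + 2 = i + k + 2 + 1 by ring]
      refine LinearMap.congr_fun
        (f := adjBracket L (i + k + 2 + 1) (n + 1) ∘ₗ adjSwap 𝒢 (i + 1) (n + 2))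
        (g := adjSwap 𝒢 (i + 1) (n + 1) ∘ₗ adjBracket L (i + k + 2 + 1) (n + 1))
        (power_ext fun x c => ?_) c
      simp only [LinearMap.comp_apply, adjSwap_succ_cons, adjBracket_succ_cons, ih]

theorem adjBracket_adjBracket (i k n : ℕ) (c : ⨂[ℂ]^(n + 2) 𝔤) :
    adjBracket L i n (adjBracket L (i + k + 2) (n + 1) c) =
      adjBracket L (i + k + 1) n (adjBracket L i (n + 1) c) := by
  induction i generalizing n with
  | zero =>
    rcases n with _ | n
    · simp [adjBracket]
    · refine LinearMap.congr_fun
        (f := adjBracket L 0 (n + 1) ∘ₗ adjBracket L (0 + k + 2) (n + 2))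
        (g := adjBracket L (0 + k + 1) (n + 1) ∘ₗ adjBracket L 0 (n + 2))
        (power_ext_hom₂ 𝒢 fun p x hx q y hy c => ?_) c
      simp only [LinearMap.comp_apply, adjBracket_zero_cons, adjBracket_succ_cons]
  | succ i ih =>
    rcases n with _ | n
    · simp [adjBracket]
    · rw [show i + 1 + k + 2 = i + k + 2 + 1 by ring, show i + 1 + k + 1 = i + k + 1 + 1 by ring]
      refine LinearMap.congr_fun
        (f := adjBracket L (i + 1) (n + 1) ∘ₗ adjBracket L (i + k + 2 + 1) (n + 2))
        (g := adjBracket L (i + k + 1 + 1) (n + 1) ∘ₗ adjBracket L (i + 1) (n + 2))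
        (power_ext fun x c => ?_) c
      simp only [LinearMap.comp_apply, adjBracket_succ_cons, ih]

/-- The map `(…, x, y, z, …) ↦ (…, [x, y], z, …) ± (…, [x, z], y, …) ± (…, [y, z], x, …)`. -/
def tripleBracket (i n : ℕ) : (⨂[ℂ]^(n + 1) 𝔤) →ₗ[ℂ] ⨂[ℂ]^n 𝔤 :=
  adjBracket L i n - adjBracket L i n ∘ₗ adjSwap 𝒢 (i + 1) (n + 1) +
    adjBracket L i n ∘ₗ adjSwap 𝒢 (i + 1) (n + 1) ∘ₗ adjSwap 𝒢 i (n + 1)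

theorem tripleBracket_apply (i n : ℕ) (c : ⨂[ℂ]^(n + 1) 𝔤) : tripleBracket L i n c =
    adjBracket L i n c - adjBracket L i n (adjSwap 𝒢 (i + 1) (n + 1) c) +
    adjBracket L i n (adjSwap 𝒢 (i + 1) (n + 1) (adjSwap 𝒢 i (n + 1) c)) := rfl

theorem tripleBracket_succ_cons (i n : ℕ) (x : 𝔤) (c : ⨂[ℂ]^(n + 1) 𝔤) :
    tripleBracket L (i + 1) (n + 1) (x ⊹ c) = x ⊹ tripleBracket L i n c := by
  simp only [tripleBracket_apply, adjSwap_succ_cons, adjBracket_succ_cons, cons_add, cons_sub]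

theorem tripleBracket_zero_cons {n : ℕ} {p q r : ZMod 2} {x y z : 𝔤} (hx : x ∈ 𝒢 p)
    (hy : y ∈ 𝒢 q) (hz : z ∈ 𝒢 r) (c : ⨂[ℂ]^n 𝔤) :
    tripleBracket L 0 (n + 2) (x ⊹ y ⊹ z ⊹ c) = (L.bracket x y ⊹ z ⊹ c) -
      koszul q r • (L.bracket x z ⊹ y ⊹ c) +
      (koszul p q * koszul p r) • (L.bracket y z ⊹ x ⊹ c) := by
  have h1 : ∀ (v : 𝔤) (c : ⨂[ℂ]^(n + 2) 𝔤),
    adjSwap 𝒢 1 (n + 3) (v ⊹ c) = v ⊹ adjSwap 𝒢 0 (n + 2) c := adjSwap_succ_cons 𝒢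
  simp only [tripleBracket_apply, adjSwap_zero_cons 𝒢 hx, h1, zero_add, adjSwap_zero_cons 𝒢 hy,
    adjBracket_zero_cons, twist_of_mem 𝒢 hy, twist_of_mem 𝒢 hz, smul_cons, cons_smul, map_smul,
    smul_smul]

theorem adjBracket_tripleBracket (i n : ℕ) (h : i + 3 ≤ n + 2) (c : ⨂[ℂ]^(n + 2) 𝔤) :
    adjBracket L i n (tripleBracket L i (n + 1) c) = 0 := by
  induction i generalizing n with
  | zero =>
    obtain ⟨n, rfl⟩ : ∃ m, n = m + 1 := ⟨n - 1, by omega⟩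
    refine LinearMap.congr_fun
      (f := adjBracket L 0 (n + 1) ∘ₗ tripleBracket L 0 (n + 2)) (g := 0)
      (power_ext_hom₃ 𝒢 fun p x hx q y hy r z hz c => ?_) c
    simp only [LinearMap.comp_apply, LinearMap.zero_apply, tripleBracket_zero_cons L hx hy hz,
      map_add, map_sub, map_smul, adjBracket_zero_cons]
    have h1 := L.jacobi hx hy hz
    have h2 := L.skew (L.bracket_mem hy hz) hx
    have h3 := L.skew (L.bracket_mem hx hz) hy
    have h4 : L.bracket (L.bracket x y) z = L.bracket x (L.bracket y z) -
      koszul p q • L.bracket y (L.bracket x z) := by rw [h1]; abel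
    rw [h2, h3, h4, koszul_add_left, koszul_add_left, sub_cons, smul_cons,
      ← neg_one_smul ℂ ((koszul p q * koszul r q) • _),
      ← neg_one_smul ℂ ((koszul q p * koszul r p) • _), smul_cons, smul_cons, smul_cons, smul_cons,
      smul_smul, smul_smul, smul_smul, smul_smul, koszul_comm r q, koszul_comm q p,
      koszul_comm r p]
    have e1 : koszul q r * -1 * (koszul p q * koszul q r) = -koszul p q := by
      linear_combination -koszul p q * koszul_mul_self q r
    have e2 : koszul p q * koszul p r * -1 * (koszul p q * koszul p r) = -1 := by
      linear_combination -(koszul p r * koszul p r) * koszul_mul_self p q - koszul_mul_self p r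
    rw [e1, e2]
    module
  | succ i ih =>
    rcases n with _ | n
    · omega
    · refine LinearMap.congr_fun
        (f := adjBracket L (i + 1) (n + 1) ∘ₗ tripleBracket L (i + 1) (n + 2)) (g := 0)
        (power_ext fun x c => ?_) c
      simp only [LinearMap.comp_apply, tripleBracket_succ_cons, adjBracket_succ_cons,
        ih n (by omega), cons_zero, LinearMap.zero_apply]

theorem adjBracket_braid (i n : ℕ) (h : i + 3 ≤ n + 1) (c : ⨂[ℂ]^(n + 1) 𝔤) :
    (adjBracket L i n c + adjBracket L (i + 1) n (adjSwap 𝒢 i (n + 1) c) +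
      adjBracket L i n (adjSwap 𝒢 (i + 1) (n + 1) (adjSwap 𝒢 i (n + 1) c))) -
    (adjBracket L (i + 1) n c + adjBracket L i n (adjSwap 𝒢 (i + 1) (n + 1) c) +
      adjBracket L (i + 1) n (adjSwap 𝒢 i (n + 1) (adjSwap 𝒢 (i + 1) (n + 1) c))) =
    tripleBracket L i n c - adjSwap 𝒢 i n (tripleBracket L i n c) := by
  induction i generalizing n with
  | zero =>
    obtain ⟨n, rfl⟩ : ∃ m, n = m + 2 := ⟨n - 2, by omega⟩
    refine LinearMap.congr_fun
      (f := (adjBracket L 0 (n + 2) + adjBracket L 1 (n + 2) ∘ₗ adjSwap 𝒢 0 (n + 3) +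
          adjBracket L 0 (n + 2) ∘ₗ adjSwap 𝒢 1 (n + 3) ∘ₗ adjSwap 𝒢 0 (n + 3)) -
        (adjBracket L 1 (n + 2) + adjBracket L 0 (n + 2) ∘ₗ adjSwap 𝒢 1 (n + 3) +
          adjBracket L 1 (n + 2) ∘ₗ adjSwap 𝒢 0 (n + 3) ∘ₗ adjSwap 𝒢 1 (n + 3)))
      (g := tripleBracket L 0 (n + 2) - adjSwap 𝒢 0 (n + 2) ∘ₗ tripleBracket L 0 (n + 2))
      (power_ext_hom₃ 𝒢 fun p x hx q y hy r z hz c => ?_) c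
    have h1 : ∀ (v : 𝔤) (c : ⨂[ℂ]^(n + 2) 𝔤),
      adjSwap 𝒢 1 (n + 3) (v ⊹ c) = v ⊹ adjSwap 𝒢 0 (n + 2) c := adjSwap_succ_cons 𝒢
    have h2 : ∀ (v : 𝔤) (c : ⨂[ℂ]^(n + 2) 𝔤),
      adjBracket L 1 (n + 2) (v ⊹ c) = v ⊹ adjBracket L 0 (n + 1) c := adjBracket_succ_cons L
    simp only [LinearMap.comp_apply, LinearMap.sub_apply, LinearMap.add_apply,
      tripleBracket_zero_cons L hx hy hz, adjSwap_zero_cons 𝒢 hx, adjSwap_zero_cons 𝒢 hy,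
      adjSwap_zero_cons 𝒢 (L.bracket_mem hx hy), adjSwap_zero_cons 𝒢 (L.bracket_mem hx hz),
      adjSwap_zero_cons 𝒢 (L.bracket_mem hy hz), h1, h2, adjBracket_zero_cons, map_sub, map_add,
      map_smul, twist_of_mem 𝒢 hx, twist_of_mem 𝒢 hy, twist_of_mem 𝒢 hz, smul_cons, cons_smul,
      smul_smul, koszul_add_left, koszul_comm r q, koszul_comm q p, koszul_comm r p]
    have e1 : koszul q r * (koszul p q * koszul q r) = koszul p q := by
      linear_combination koszul p q * koszul_mul_self q r
    have e2 : koszul p q * koszul p r * (koszul p q * koszul p r) = 1 := by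
      linear_combination (koszul p r * koszul p r) * koszul_mul_self p q + koszul_mul_self p r
    rw [e1, e2]
    module
  | succ i ih =>
    rcases n with _ | n
    · omega
    · refine LinearMap.congr_fun
        (f := (adjBracket L (i + 1) (n + 1) + adjBracket L (i + 2) (n + 1) ∘ₗ
            adjSwap 𝒢 (i + 1) (n + 2) + adjBracket L (i + 1) (n + 1) ∘ₗ
            adjSwap 𝒢 (i + 2) (n + 2) ∘ₗ adjSwap 𝒢 (i + 1) (n + 2)) -
          (adjBracket L (i + 2) (n + 1) + adjBracket L (i + 1) (n + 1) ∘ₗ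
            adjSwap 𝒢 (i + 2) (n + 2) + adjBracket L (i + 2) (n + 1) ∘ₗ
            adjSwap 𝒢 (i + 1) (n + 2) ∘ₗ adjSwap 𝒢 (i + 2) (n + 2)))
        (g := tripleBracket L (i + 1) (n + 1) -
          adjSwap 𝒢 (i + 1) (n + 1) ∘ₗ tripleBracket L (i + 1) (n + 1))
        (power_ext fun x c => ?_) c
      simp only [LinearMap.comp_apply, LinearMap.sub_apply, LinearMap.add_apply,
        tripleBracket_succ_cons, adjSwap_succ_cons, adjBracket_succ_cons, ← cons_add, ← cons_sub]
      rw [ih n (by omega)]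

end SuperLieAlgebra

namespace SuperLieAlgebra

variable {𝔤 : Type u} [AddCommGroup 𝔤] [Module ℂ 𝔤] {𝒢 : ZMod 2 → Submodule ℂ 𝔤}
  [DirectSum.Decomposition 𝒢] (L : SuperLieAlgebra 𝒢)

section Extension

variable {M : Type*} [AddCommGroup M] [Module ℂ M] {n : ℕ}

/-- The operator `(u, v) ↦ (s_i u, v + Φ (b_i u))`, where `s_i` transposes the factors `i`, `i + 1`
and `b_i` takes their bracket. -/
def swapOp (Φ : (⨂[ℂ]^(n + 1) 𝔤) →ₗ[ℂ] M) (i : ℕ) : Module.End ℂ ((⨂[ℂ]^(n + 2) 𝔤) × M) :=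
  LinearMap.prod (adjSwap 𝒢 i (n + 2) ∘ₗ LinearMap.fst ℂ _ _)
    (LinearMap.snd ℂ _ _ + Φ ∘ₗ adjBracket L i (n + 1) ∘ₗ LinearMap.fst ℂ _ _)

theorem swapOp_apply (Φ : (⨂[ℂ]^(n + 1) 𝔤) →ₗ[ℂ] M) (i : ℕ) (q : (⨂[ℂ]^(n + 2) 𝔤) × M) :
    swapOp L Φ i q = (adjSwap 𝒢 i (n + 2) q.1, q.2 + Φ (adjBracket L i (n + 1) q.1)) := rfl

variable {L} {Φ' : (⨂[ℂ]^n 𝔤) →ₗ[ℂ] M} {Φ : (⨂[ℂ]^(n + 1) 𝔤) →ₗ[ℂ] M}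

theorem swapOp_mul_self (i : ℕ) : swapOp L Φ i * swapOp L Φ i = 1 := by
  refine LinearMap.ext fun q => ?_
  simp only [Module.End.mul_apply, swapOp_apply, adjSwap_adjSwap, adjBracket_adjSwap, map_neg,
    Module.End.one_apply, add_neg_cancel_right]

theorem swapOp_comm
    (hΦ : ∀ i c, Φ (adjSwap 𝒢 i (n + 1) c) + Φ' (adjBracket L i n c) = Φ c) (i k : ℕ) :
    swapOp L Φ i * swapOp L Φ (i + k + 2) = swapOp L Φ (i + k + 2) * swapOp L Φ i := by
  refine LinearMap.ext fun q => ?_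
  have h1 := hΦ i (adjBracket L (i + k + 2) (n + 1) q.1)
  have h2 := hΦ (i + k + 1) (adjBracket L i (n + 1) q.1)
  rw [adjBracket_adjBracket] at h1
  simp only [Module.End.mul_apply, swapOp_apply, adjSwap_comm, adjBracket_adjSwap_right,
    adjBracket_adjSwap_left]
  rw [← h1, ← h2]
  congr 1
  abel

theorem swapOp_braid
    (hΦ : ∀ i c, Φ (adjSwap 𝒢 i (n + 1) c) + Φ' (adjBracket L i n c) = Φ c) (i : ℕ)
    (hi : i + 1 < n + 1) :
    swapOp L Φ i * swapOp L Φ (i + 1) * swapOp L Φ i =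
      swapOp L Φ (i + 1) * swapOp L Φ i * swapOp L Φ (i + 1) := by
  refine LinearMap.ext fun q => ?_
  have h1 := congrArg Φ (adjBracket_braid L i (n + 1) (by omega) q.1)
  have h2 := hΦ i (tripleBracket L i (n + 1) q.1)
  rw [adjBracket_tripleBracket L i n (by omega), map_zero, add_zero] at h2
  rw [map_sub, map_sub, h2, sub_self, sub_eq_zero] at h1
  simp only [map_add] at h1
  simp only [Module.End.mul_apply, swapOp_apply, adjSwap_braid 𝒢 i (n + 2) (by omega), add_assoc]
  rw [← add_assoc (Φ _), h1, add_assoc]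

theorem exists_extension
    (hΦ : ∀ i c, Φ (adjSwap 𝒢 i (n + 1) c) + Φ' (adjBracket L i n c) = Φ c) :
    ∃ Ψ : (⨂[ℂ]^(n + 2) 𝔤) →ₗ[ℂ] M,
      ∀ i c, Ψ (adjSwap 𝒢 i (n + 2) c) + Φ (adjBracket L i (n + 1) c) = Ψ c := by
  set e := symmetrizer (swapOp L Φ) (n + 1) with he
  refine ⟨LinearMap.snd ℂ _ _ ∘ₗ e ∘ₗ LinearMap.inl ℂ _ _, fun i c => ?_⟩
  rcases Nat.lt_or_ge i (n + 1) with hi | hi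
  · have h1 : e * swapOp L Φ i = e := by
      refine symmetrizer_mul (m := n + 1) (fun i _ => swapOp_mul_self i) (fun i j hij _ => ?_)
        (swapOp_braid hΦ) (n + 1) le_rfl i hi
      obtain ⟨k, rfl⟩ : ∃ k, j = i + k + 2 := ⟨j - i - 2, by omega⟩
      exact swapOp_comm hΦ i k
    have h2 : ∀ v : M, e (0, v) = (0, v) := fun v =>
      symmetrizer_apply_of_fixed fun i _ => by simp [swapOp_apply]
    have h3 := LinearMap.congr_fun h1 (c, 0)
    have h4 : swapOp L Φ i (c, 0) =
        (adjSwap 𝒢 i (n + 2) c, 0) + (0, Φ (adjBracket L i (n + 1) c)) := by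
      simp [swapOp_apply]
    rw [Module.End.mul_apply, h4, map_add, h2] at h3
    exact congrArg Prod.snd h3
  · rw [adjSwap_of_lt 𝒢 i (n + 2) (by omega), adjBracket_of_lt L i (n + 1) (by omega)]
    simp

end Extension

theorem exists_tensor_retraction : ∃ Φ : ∀ n, (⨂[ℂ]^n 𝔤) →ₗ[ℂ] 𝔤,
    Φ 0 = 0 ∧ (∀ x c, Φ 1 (x ⊹ c) = PiTensorProduct.isEmptyEquiv (Fin 0) c • x) ∧
    ∀ n i c, Φ (n + 1) (adjSwap 𝒢 i (n + 1) c) + Φ n (adjBracket L i n c) = Φ (n + 1) c := by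
  let T : ℕ → Type u := fun n => {q : ((⨂[ℂ]^n 𝔤) →ₗ[ℂ] 𝔤) × ((⨂[ℂ]^(n + 1) 𝔤) →ₗ[ℂ] 𝔤) //
    ∀ i c, q.2 (adjSwap 𝒢 i (n + 1) c) + q.1 (adjBracket L i n c) = q.2 c}
  let base : T 0 := ⟨(0, TensorProduct.lift ((LinearMap.lsmul ℂ 𝔤).flip.compl₂
      (PiTensorProduct.isEmptyEquiv (R := ℂ) (s := fun _ : Fin 0 => 𝔤) (Fin 0)).toLinearMap) ∘ₗ
      (consEquiv 𝔤 0).symm.toLinearMap), fun i c => by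
    simp [adjSwap_of_lt 𝒢 i (0 + 1) (by omega)]⟩
  let step : ∀ n, T n → T (n + 1) := fun n q =>
    ⟨(q.1.2, (exists_extension q.2).choose), (exists_extension q.2).choose_spec⟩
  let seq : ∀ n, T n := fun n => Nat.rec base step n
  refine ⟨fun n => (seq n).1.1, rfl, fun x c => ?_, fun n => (seq n).2⟩
  change base.1.2 (x ⊹ c) = _
  simp [base]

/-- The sum of the tensor powers of `𝔤`. -/
abbrev TensorSum (_ : SuperLieAlgebra 𝒢) : Type u := ⨁ n : ℕ, ⨂[ℂ]^n 𝔤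

/-- The relations `(…, x, y, …) = (-1)^{|x||y|} (…, y, x, …) + (…, [x, y], …)`. -/
def tensorRel : Submodule ℂ L.TensorSum :=
  Submodule.span ℂ {r | ∃ (n i : ℕ) (c : ⨂[ℂ]^(n + 1) 𝔤), r =
    DirectSum.lof ℂ ℕ (fun n => ⨂[ℂ]^n 𝔤) (n + 1) (c - adjSwap 𝒢 i (n + 1) c) -
      DirectSum.lof ℂ ℕ (fun n => ⨂[ℂ]^n 𝔤) n (adjBracket L i n c)}

/-- Left multiplication by an element of `𝔤`. -/
def consSum (x : 𝔤) : L.TensorSum →ₗ[ℂ] L.TensorSum :=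
  DirectSum.toModule ℂ ℕ _ fun n =>
    DirectSum.lof ℂ ℕ (fun n => ⨂[ℂ]^n 𝔤) (n + 1) ∘ₗ consWith x n

theorem consSum_lof (x : 𝔤) (n : ℕ) (c : ⨂[ℂ]^n 𝔤) :
    consSum L x (DirectSum.lof ℂ ℕ (fun n => ⨂[ℂ]^n 𝔤) n c) =
      DirectSum.lof ℂ ℕ (fun n => ⨂[ℂ]^n 𝔤) (n + 1) (x ⊹ c) := by
  simp [consSum, consWith_eq]

theorem tensorRel_le_comap (x : 𝔤) : L.tensorRel ≤ L.tensorRel.comap (consSum L x) := by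
  rw [tensorRel, Submodule.span_le]
  rintro _ ⟨n, i, c, rfl⟩
  rw [SetLike.mem_coe, Submodule.mem_comap, map_sub, consSum_lof, consSum_lof, cons_sub]
  exact Submodule.subset_span ⟨n + 1, i + 1, x ⊹ c, by
    rw [adjSwap_succ_cons, adjBracket_succ_cons]⟩

/-- Left multiplication by elements of `𝔤` modulo the relations. -/
def consQuot : 𝔤 →ₗ[ℂ] Module.End ℂ (L.TensorSum ⧸ L.tensorRel) where
  toFun x := L.tensorRel.mapQ L.tensorRel (consSum L x) (tensorRel_le_comap L x)
  map_add' x y := by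
    ext n c
    simp [consSum_lof, add_cons]
  map_smul' r x := by
    ext n c
    simp [consSum_lof, smul_cons]

theorem consQuot_mk_lof (x : 𝔤) (n : ℕ) (c : ⨂[ℂ]^n 𝔤) :
    consQuot L x (Submodule.Quotient.mk (DirectSum.lof ℂ ℕ (fun n => ⨂[ℂ]^n 𝔤) n c)) =
      Submodule.Quotient.mk (DirectSum.lof ℂ ℕ (fun n => ⨂[ℂ]^n 𝔤) (n + 1) (x ⊹ c)) := by
  simp [consQuot, consSum_lof]

theorem consQuot_rel (i j : ZMod 2) (a b : 𝔤) (ha : a ∈ 𝒢 i) (hb : b ∈ 𝒢 j) :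
    consQuot L a * consQuot L b - koszul i j • (consQuot L b * consQuot L a) =
      consQuot L (L.bracket a b) := by
  refine Submodule.linearMap_qext _ (DirectSum.linearMap_ext _ fun n => LinearMap.ext fun c => ?_)
  simp only [LinearMap.comp_apply, LinearMap.sub_apply, LinearMap.smul_apply,
    Module.End.mul_apply, Submodule.mkQ_apply, consQuot_mk_lof]
  rw [← Submodule.Quotient.mk_smul, ← Submodule.Quotient.mk_sub, ← map_smul, ← map_sub,
    Submodule.Quotient.eq]
  refine Submodule.subset_span ⟨n + 1, 0, a ⊹ b ⊹ c, ?_⟩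
  rw [adjSwap_zero_cons 𝒢 ha, adjBracket_zero_cons, twist_of_mem 𝒢 hb, smul_cons]

/-- The enveloping algebra of `𝔤` has an even linear retraction onto `𝔤` that kills `1`. -/
theorem exists_retraction : ∃ θ : L.Enveloping →ₗ[ℂ] 𝔤,
    (∀ i, ∀ u ∈ Enveloping.grading L i, θ u ∈ 𝒢 i) ∧ (∀ x, θ (Enveloping.ι L x) = x) ∧
      θ 1 = 0 := by
  obtain ⟨Φ, h0, h1, hΦ⟩ := exists_tensor_retraction L
  let Ψ : (L.TensorSum ⧸ L.tensorRel) →ₗ[ℂ] 𝔤 :=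
    L.tensorRel.liftQ (DirectSum.toModule ℂ ℕ 𝔤 Φ) (by
      rw [tensorRel, Submodule.span_le]
      rintro _ ⟨n, i, c, rfl⟩
      rw [SetLike.mem_coe, LinearMap.mem_ker, map_sub, DirectSum.toModule_lof,
        DirectSum.toModule_lof, map_sub, sub_sub, hΦ, sub_self])
  have hΨ : ∀ n c, Ψ (Submodule.Quotient.mk (DirectSum.lof ℂ ℕ (fun n => ⨂[ℂ]^n 𝔤) n c)) = Φ n c :=
    fun n c => by simp [Ψ]
  let unit : ⨂[ℂ]^0 𝔤 := (PiTensorProduct.isEmptyEquiv (Fin 0)).symm (1 : ℂ)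
  let θ : L.Enveloping →ₗ[ℂ] 𝔤 := Ψ ∘ₗ LinearMap.applyₗ
    (Submodule.Quotient.mk (DirectSum.lof ℂ ℕ (fun n => ⨂[ℂ]^n 𝔤) 0 unit)) ∘ₗ
      (Enveloping.lift L (consQuot L) (consQuot_rel L)).toLinearMap
  have hθ1 : θ 1 = 0 := by
    simp only [θ, LinearMap.comp_apply, AlgHom.toLinearMap_apply, map_one,
      LinearMap.applyₗ_apply_apply, Module.End.one_apply, hΨ, h0, LinearMap.zero_apply]
  have hθι : ∀ x, θ (Enveloping.ι L x) = x := fun x => by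
    simp only [θ, LinearMap.comp_apply, AlgHom.toLinearMap_apply, Enveloping.lift_ι,
      LinearMap.applyₗ_apply_apply, consQuot_mk_lof, hΨ]
    simp [unit, h1]
  refine ⟨∑ i : ZMod 2, homProj 𝒢 i ∘ₗ θ ∘ₗ homProj (Enveloping.grading L) i, ?_, fun x => ?_, ?_⟩
  · intro i u hu
    simp only [LinearMap.sum_apply, LinearMap.comp_apply, homProj_of_mem _ hu]
    rw [Finset.sum_eq_single i]
    · exact homProj_mem 𝒢 i _
    · intro j _ hj
      simp [Ne.symm hj]
    · simp
  · refine LinearMap.congr_fun (g := LinearMap.id) (f := (∑ i : ZMod 2, homProj 𝒢 i ∘ₗ θ ∘ₗ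
      homProj (Enveloping.grading L) i) ∘ₗ Enveloping.ι L)
      (linearMap_ext_hom 𝒢 fun i x hx => ?_) x
    simp only [LinearMap.sum_apply, LinearMap.comp_apply,
      homProj_of_mem _ (Enveloping.ι_mem L hx)]
    rw [Finset.sum_eq_single i]
    · simp [hθι, homProj_of_mem 𝒢 hx]
    · intro j _ hj
      simp [Ne.symm hj]
    · simp
  · have h : (1 : L.Enveloping) ∈ Enveloping.grading L 0 := SetLike.GradedOne.one_mem
    simp only [LinearMap.sum_apply, LinearMap.comp_apply, homProj_of_mem _ h]
    refine Finset.sum_eq_zero fun j _ => ?_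
    split_ifs <;> simp [hθ1]

end SuperLieAlgebra

/-! ### The Koszul complex -/

section SuperSwap

variable {V : Type*} [AddCommGroup V] [Module ℂ V] (𝒱 : ZMod 2 → Submodule ℂ V)
  [DirectSum.Decomposition 𝒱]

/-- The super transposition `v ⊗ w ↦ (-1)^{|v||w|} w ⊗ v`. -/
def superSwap : V ⊗[ℂ] V →ₗ[ℂ] V ⊗[ℂ] V :=
  ∑ i : ZMod 2, TensorProduct.map (twist 𝒱 i) (homProj 𝒱 i) ∘ₗ
    (TensorProduct.comm ℂ V V).toLinearMap

theorem superSwap_tmul {i : ZMod 2} {v : V} (hv : v ∈ 𝒱 i) (w : V) :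
    superSwap 𝒱 (v ⊗ₜ w) = twist 𝒱 i w ⊗ₜ v := by
  simp only [superSwap, LinearMap.sum_apply, LinearMap.comp_apply, LinearEquiv.coe_coe,
    TensorProduct.comm_tmul, TensorProduct.map_tmul, homProj_of_mem 𝒱 hv]
  rw [Finset.sum_eq_single i]
  · simp
  · intro j _ hj
    simp [Ne.symm hj]
  · simp

end SuperSwap

namespace SuperExterior

variable {𝔤 : Type u} [AddCommGroup 𝔤] [Module ℂ 𝔤] (𝒢 : ZMod 2 → Submodule ℂ 𝔤)
  [DirectSum.Decomposition 𝒢]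

theorem power_zero : power 𝒢 0 = 1 := pow_zero _

theorem ι_mul_mem_power {n : ℕ} (x : 𝔤) {w : SuperExterior 𝒢} (hw : w ∈ power 𝒢 n) :
    ι 𝒢 x * w ∈ power 𝒢 (n + 1) := by
  rw [power, pow_succ']
  exact Submodule.mul_mem_mul ⟨x, rfl⟩ hw

theorem power_succ_le {n : ℕ} {S : Submodule ℂ (SuperExterior 𝒢)}
    (h : ∀ i, ∀ x ∈ 𝒢 i, ∀ w ∈ power 𝒢 n, ι 𝒢 x * w ∈ S) : power 𝒢 (n + 1) ≤ S := by
  rw [power, pow_succ', Submodule.mul_le]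
  rintro _ ⟨x, rfl⟩ w hw
  refine hom_induction 𝒢 x (P := fun x => ι 𝒢 x * w ∈ S) (fun x y hx hy => ?_)
    fun i x hx => h i x hx w hw
  rw [map_add, add_mul]
  exact S.add_mem hx hy

theorem mem_iSup_power (w : SuperExterior 𝒢) : w ∈ ⨆ n, power 𝒢 n := by
  induction w using SuperExterior.induction with
  | one =>
    refine Submodule.mem_iSup_of_mem 0 ?_
    rw [power_zero]
    exact Submodule.one_le.1 le_rfl
  | add a b ha hb => exact Submodule.add_mem _ ha hb
  | smul r a ha => exact Submodule.smul_mem _ r ha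
  | mul i x _ a ha =>
    refine Submodule.iSup_induction _ (motive := fun a => ι 𝒢 x * a ∈ ⨆ n, power 𝒢 n) ha
      (fun n a ha => Submodule.mem_iSup_of_mem (n + 1) (ι_mul_mem_power 𝒢 x ha)) ?_
      fun a b ha hb => ?_
    · rw [mul_zero]
      exact Submodule.zero_mem _
    · rw [mul_add]
      exact Submodule.add_mem _ ha hb

theorem coderiv_eq_zero {w : SuperExterior 𝒢} (hw : w ∈ power 𝒢 0) : coderiv 𝒢 w = 0 := by
  rw [power_zero, Submodule.mem_one] at hw
  obtain ⟨r, rfl⟩ := hw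
  rw [Algebra.algebraMap_eq_smul_one, map_smul, coderiv_one, smul_zero]

theorem coderiv_mem {n : ℕ} {w : SuperExterior 𝒢} (hw : w ∈ power 𝒢 (n + 1)) :
    coderiv 𝒢 w ∈ Submodule.map₂ (TensorProduct.mk ℂ 𝔤 (SuperExterior 𝒢)) ⊤ (power 𝒢 n) := by
  induction n generalizing w with
  | zero =>
    refine power_succ_le 𝒢 (S := Submodule.comap (coderiv 𝒢)
      (Submodule.map₂ (TensorProduct.mk ℂ 𝔤 (SuperExterior 𝒢)) ⊤ (power 𝒢 0)))
      (fun i x _ w hw => ?_) hw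
    rw [Submodule.mem_comap, coderiv_ι_mul, coderiv_eq_zero 𝒢 hw, map_zero, sub_zero]
    exact Submodule.apply_mem_map₂ _ trivial hw
  | succ n ih =>
    refine power_succ_le 𝒢 (S := Submodule.comap (coderiv 𝒢)
      (Submodule.map₂ (TensorProduct.mk ℂ 𝔤 (SuperExterior 𝒢)) ⊤ (power 𝒢 (n + 1))))
      (fun i x hx w hw => ?_) hw
    rw [Submodule.mem_comap, coderiv_ι_mul]
    refine Submodule.sub_mem _ (Submodule.apply_mem_map₂ _ trivial hw) ?_
    have h : Submodule.map₂ (TensorProduct.mk ℂ 𝔤 (SuperExterior 𝒢)) ⊤ (power 𝒢 n) ≤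
        Submodule.comap (shift 𝒢 x)
          (Submodule.map₂ (TensorProduct.mk ℂ 𝔤 (SuperExterior 𝒢)) ⊤ (power 𝒢 (n + 1))) := by
      rw [Submodule.map₂_le]
      intro y _ v hv
      rw [Submodule.mem_comap, TensorProduct.mk_apply, shift_tmul 𝒢 hx]
      exact Submodule.apply_mem_map₂ _ trivial (ι_mul_mem_power 𝒢 x hv)
    exact h (ih hw)

/-- The map `x ⊗ w ↦ x ∧ w`. -/
def wedgeHead : 𝔤 ⊗[ℂ] SuperExterior 𝒢 →ₗ[ℂ] SuperExterior 𝒢 :=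
  LinearMap.mul' ℂ (SuperExterior 𝒢) ∘ₗ (ι 𝒢).rTensor (SuperExterior 𝒢)

theorem wedgeHead_tmul (x : 𝔤) (w : SuperExterior 𝒢) : wedgeHead 𝒢 (x ⊗ₜ w) = ι 𝒢 x * w := by
  simp [wedgeHead]

theorem wedgeHead_shift {i : ZMod 2} {x : 𝔤} (hx : x ∈ 𝒢 i) (t : 𝔤 ⊗[ℂ] SuperExterior 𝒢) :
    wedgeHead 𝒢 (shift 𝒢 x t) = -(ι 𝒢 x * wedgeHead 𝒢 t) := by
  refine LinearMap.congr_fun (f := wedgeHead 𝒢 ∘ₗ shift 𝒢 x)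
    (g := -(LinearMap.mulLeft ℂ (ι 𝒢 x) ∘ₗ wedgeHead 𝒢)) (tensor_ext_hom 𝒢 fun j y hy w => ?_) t
  simp only [LinearMap.comp_apply, LinearMap.neg_apply, LinearMap.mulLeft_apply, shift_tmul 𝒢 hx,
    wedgeHead_tmul, twist_of_mem 𝒢 hy, map_smul]
  rw [smul_mul_assoc, ← mul_assoc, ← mul_assoc, ← smul_mul_assoc, ← neg_mul,
    eq_neg_of_add_eq_zero_right (ι_mul_ι 𝒢 hx hy)]

theorem wedgeHead_coderiv {n : ℕ} {w : SuperExterior 𝒢} (hw : w ∈ power 𝒢 n) :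
    wedgeHead 𝒢 (coderiv 𝒢 w) = (n : ℂ) • w := by
  induction n generalizing w with
  | zero => rw [coderiv_eq_zero 𝒢 hw, map_zero, Nat.cast_zero, zero_smul]
  | succ n ih =>
    have h : power 𝒢 (n + 1) ≤ LinearMap.ker
        (wedgeHead 𝒢 ∘ₗ coderiv 𝒢 - ((n + 1 : ℕ) : ℂ) • LinearMap.id) := by
      refine power_succ_le 𝒢 fun i x hx w hw => ?_
      rw [LinearMap.mem_ker, LinearMap.sub_apply, LinearMap.comp_apply, coderiv_ι_mul, map_sub,
        wedgeHead_shift 𝒢 hx, ih hw, wedgeHead_tmul, mul_smul_comm, LinearMap.smul_apply,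
        LinearMap.id_apply]
      push_cast
      module
    exact sub_eq_zero.1 (h hw)

end SuperExterior


namespace SuperLieAlgebra

open SuperExterior Enveloping

variable {𝔤 : Type u} [AddCommGroup 𝔤] [Module ℂ 𝔤] {𝒢 : ZMod 2 → Submodule ℂ 𝔤}
  [DirectSum.Decomposition 𝒢] (L : SuperLieAlgebra 𝒢)

theorem superSwap_comul (u : L.Enveloping) : superSwap (grading L) (comul L u) = comul L u := by
  refine LinearMap.congr_fun (f := superSwap (grading L) ∘ₗ comul L) (g := comul L)
    (linearMap_ext L ?_ fun i x hx a ha => ?_) u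
  · rw [LinearMap.comp_apply, Enveloping.comul_one, superSwap_tmul _ SetLike.GradedOne.one_mem,
      twist_zero]
  · rw [LinearMap.comp_apply] at ha ⊢
    rw [comul_ι_mul L hx]
    conv_rhs => rw [← ha]
    refine LinearMap.congr_fun (f := superSwap (grading L) ∘ₗ comulStep L i (Enveloping.ι L x))
      (g := comulStep L i (Enveloping.ι L x) ∘ₗ superSwap (grading L))
      (tensor_ext_hom (grading L) fun j a ha b => ?_) _
    have h : Enveloping.ι L x * a ∈ grading L (i + j) :=
      SetLike.GradedMul.mul_mem (Enveloping.ι_mem L hx) ha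
    simp only [LinearMap.comp_apply, comulStep_tmul, map_add, superSwap_tmul _ ha,
      superSwap_tmul _ h, twist_add, twist_ι_mul L j hx, twist_of_mem _ ha, map_smul,
      ← TensorProduct.smul_tmul', smul_smul,
      koszul_comm j i, koszul_mul_self, one_smul]
    rw [add_comm]

/-- An even linear retraction of `U(𝔤)` onto `𝔤` that kills `1`. -/
def retraction : L.Enveloping →ₗ[ℂ] 𝔤 := (exists_retraction L).choose

theorem retraction_mem {i : ZMod 2} {u : L.Enveloping} (hu : u ∈ grading L i) :
    retraction L u ∈ 𝒢 i := (exists_retraction L).choose_spec.1 i u hu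

theorem retraction_ι (x : 𝔤) : retraction L (Enveloping.ι L x) = x :=
  (exists_retraction L).choose_spec.2.1 x

theorem retraction_one : retraction L 1 = 0 := (exists_retraction L).choose_spec.2.2

/-- The retraction onto `𝔤`, with values in `⋀ 𝔤`. -/
def toExterior : L.Enveloping →ₗ[ℂ] SuperExterior 𝒢 := SuperExterior.ι 𝒢 ∘ₗ retraction L

theorem toExterior_apply (u : L.Enveloping) :
    toExterior L u = SuperExterior.ι 𝒢 (retraction L u) := rfl

theorem toExterior_one : toExterior L 1 = 0 := by
  rw [toExterior_apply, retraction_one, map_zero]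

theorem toExterior_ι (x : 𝔤) : toExterior L (Enveloping.ι L x) = SuperExterior.ι 𝒢 x := by
  rw [toExterior_apply, retraction_ι]

/-- The map `u ⊗ v ↦ v ∧ u`. -/
def wedgeRev : L.Enveloping ⊗[ℂ] L.Enveloping →ₗ[ℂ] SuperExterior 𝒢 :=
  LinearMap.mul' ℂ (SuperExterior 𝒢) ∘ₗ TensorProduct.map (toExterior L) (toExterior L) ∘ₗ
    (TensorProduct.comm ℂ L.Enveloping L.Enveloping).toLinearMap

theorem wedgeRev_tmul (u v : L.Enveloping) :
    wedgeRev L (u ⊗ₜ v) = toExterior L v * toExterior L u := by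
  simp [wedgeRev]

theorem wedgeRev_comul (u : L.Enveloping) : wedgeRev L (comul L u) = 0 := by
  have h : wedgeRev L ∘ₗ superSwap (grading L) = -wedgeRev L := by
    refine tensor_ext_hom (grading L) fun i a ha b => ?_
    refine LinearMap.congr_fun (f := wedgeRev L ∘ₗ superSwap (grading L) ∘ₗ
      TensorProduct.mk ℂ _ _ a) (g := -wedgeRev L ∘ₗ TensorProduct.mk ℂ _ _ a)
      (linearMap_ext_hom (grading L) fun j b hb => ?_) b
    simp only [LinearMap.comp_apply, LinearMap.neg_apply, TensorProduct.mk_apply,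
      superSwap_tmul _ ha, twist_of_mem _ hb, wedgeRev_tmul, map_smul,
      ← TensorProduct.smul_tmul', toExterior_apply]
    rw [eq_neg_iff_add_eq_zero, add_comm, koszul_comm]
    exact SuperExterior.ι_mul_ι 𝒢 (retraction_mem L hb) (retraction_mem L ha)
  have h2 := LinearMap.congr_fun h (comul L u)
  rw [LinearMap.comp_apply, superSwap_comul, LinearMap.neg_apply] at h2
  have h3 : (2 : ℂ) • wedgeRev L (comul L u) = 0 := by
    rw [two_smul]
    exact eq_neg_iff_add_eq_zero.1 h2
  exact (smul_eq_zero.1 h3).resolve_left two_ne_zero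

/-- The map `a ⊗ b ↦ (a ∧ w) ⊗ b`. -/
def wedgeStep (w : SuperExterior 𝒢) :
    L.Enveloping ⊗[ℂ] L.Enveloping →ₗ[ℂ] SuperExterior 𝒢 ⊗[ℂ] L.Enveloping :=
  (LinearMap.mulRight ℂ w ∘ₗ toExterior L).rTensor L.Enveloping

theorem wedgeStep_tmul (w : SuperExterior 𝒢) (a b : L.Enveloping) :
    wedgeStep L w (a ⊗ₜ b) = (toExterior L a * w) ⊗ₜ b := rfl

/-- The Koszul differential `w ⊗ u ↦ (u⁽¹⁾ ∧ w) ⊗ u⁽²⁾` on `⋀ 𝔤 ⊗ U(𝔤)`. -/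
def koszulDiff : SuperExterior 𝒢 ⊗[ℂ] L.Enveloping →ₗ[ℂ] SuperExterior 𝒢 ⊗[ℂ] L.Enveloping :=
  TensorProduct.lift (LinearMap.lcomp ℂ _ (comul L) ∘ₗ LinearMap.rTensorHom L.Enveloping ∘ₗ
    LinearMap.lcomp ℂ _ (toExterior L) ∘ₗ (LinearMap.mul ℂ (SuperExterior 𝒢)).flip)

theorem koszulDiff_tmul (w : SuperExterior 𝒢) (u : L.Enveloping) :
    koszulDiff L (w ⊗ₜ u) = wedgeStep L w (comul L u) := rfl

theorem koszulDiff_koszulDiff (z : SuperExterior 𝒢 ⊗[ℂ] L.Enveloping) :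
    koszulDiff L (koszulDiff L z) = 0 := by
  refine LinearMap.congr_fun (f := koszulDiff L ∘ₗ koszulDiff L) (g := 0)
    (TensorProduct.ext' fun w u => ?_) z
  have h : ∀ t : L.Enveloping ⊗[ℂ] L.Enveloping, koszulDiff L (wedgeStep L w t) =
      (LinearMap.mulRight ℂ w ∘ₗ wedgeRev L).rTensor L.Enveloping
        ((TensorProduct.assoc ℂ L.Enveloping L.Enveloping L.Enveloping).symm
          ((comul L).lTensor L.Enveloping t)) := by
    intro t
    induction t with
    | zero => simp
    | add s t hs ht => simp only [map_add, hs, ht]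
    | tmul a b =>
      rw [wedgeStep_tmul, koszulDiff_tmul, LinearMap.lTensor_tmul]
      generalize comul L b = s
      induction s with
      | zero => simp
      | add s t hs ht => simp only [map_add, TensorProduct.tmul_add, hs, ht]
      | tmul b c => simp [wedgeStep_tmul, wedgeRev_tmul, mul_assoc]
  have h2 : (comul L).lTensor L.Enveloping (comul L u) = _ :=
    (Coalgebra.coassoc_apply (R := ℂ) u).symm
  rw [LinearMap.comp_apply, koszulDiff_tmul, h, h2, LinearEquiv.symm_apply_apply]
  change (LinearMap.mulRight ℂ w ∘ₗ wedgeRev L).rTensor L.Enveloping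
    ((comul L).rTensor L.Enveloping (comul L u)) = 0
  rw [← LinearMap.comp_apply, ← LinearMap.rTensor_comp, LinearMap.comp_assoc,
    show wedgeRev L ∘ₗ comul L = 0 from LinearMap.ext (wedgeRev_comul L)]
  simp

/-- The map `(x ⊗ w) ⊗ u ↦ w ⊗ x u`. -/
def mulInner : (𝔤 ⊗[ℂ] SuperExterior 𝒢) ⊗[ℂ] L.Enveloping →ₗ[ℂ]
    SuperExterior 𝒢 ⊗[ℂ] L.Enveloping :=
  (LinearMap.mul' ℂ L.Enveloping ∘ₗ (Enveloping.ι L).rTensor L.Enveloping).lTensor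
      (SuperExterior 𝒢) ∘ₗ
    (TensorProduct.assoc ℂ (SuperExterior 𝒢) 𝔤 L.Enveloping).toLinearMap ∘ₗ
    (TensorProduct.comm ℂ 𝔤 (SuperExterior 𝒢)).toLinearMap.rTensor L.Enveloping

theorem mulInner_tmul (x : 𝔤) (w : SuperExterior 𝒢) (u : L.Enveloping) :
    mulInner L ((x ⊗ₜ w) ⊗ₜ u) = w ⊗ₜ (Enveloping.ι L x * u) := by
  simp [mulInner]

/-- The contraction `x₁ ∧ ⋯ ∧ xₙ ⊗ u ↦ ∑ i, ± x₁ ∧ ⋯ x̂_i ⋯ ∧ xₙ ⊗ x_i u`. -/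
def contraction : SuperExterior 𝒢 ⊗[ℂ] L.Enveloping →ₗ[ℂ] SuperExterior 𝒢 ⊗[ℂ] L.Enveloping :=
  mulInner L ∘ₗ (coderiv 𝒢).rTensor L.Enveloping

theorem contraction_tmul (w : SuperExterior 𝒢) (u : L.Enveloping) :
    contraction L (w ⊗ₜ u) = mulInner L (coderiv 𝒢 w ⊗ₜ u) := rfl

/-- The map `u ↦ θ(u⁽¹⁾) u⁽²⁾`, where `θ` is the retraction onto `𝔤`. -/
def eulerOp : L.Enveloping →ₗ[ℂ] L.Enveloping :=
  LinearMap.mul' ℂ L.Enveloping ∘ₗ (Enveloping.ι L ∘ₗ retraction L).rTensor L.Enveloping ∘ₗ comul L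

/-- The map `(a, x ⊗ w) ↦ θ(x a) ∧ w`, where `θ` is the retraction onto `𝔤`. -/
def wedgeAct : L.Enveloping →ₗ[ℂ] 𝔤 ⊗[ℂ] SuperExterior 𝒢 →ₗ[ℂ] SuperExterior 𝒢 :=
  LinearMap.llcomp ℂ _ _ _ (LinearMap.mul' ℂ (SuperExterior 𝒢)) ∘ₗ
    LinearMap.rTensorHom (SuperExterior 𝒢) ∘ₗ LinearMap.llcomp ℂ _ _ _ (toExterior L) ∘ₗ
    LinearMap.lcomp ℂ _ (Enveloping.ι L) ∘ₗ (LinearMap.mul ℂ L.Enveloping).flip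

theorem wedgeAct_tmul (a : L.Enveloping) (x : 𝔤) (w : SuperExterior 𝒢) :
    wedgeAct L a (x ⊗ₜ w) = toExterior L (Enveloping.ι L x * a) * w := rfl

theorem contraction_wedgeStep (w : SuperExterior 𝒢) (t : L.Enveloping ⊗[ℂ] L.Enveloping) :
    contraction L (wedgeStep L w t) =
      w ⊗ₜ LinearMap.mul' ℂ L.Enveloping
        ((Enveloping.ι L ∘ₗ retraction L).rTensor L.Enveloping t) -
      mulInner L (((shift 𝒢).flip (coderiv 𝒢 w) ∘ₗ retraction L).rTensor L.Enveloping t) := by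
  induction t with
  | zero => simp
  | add s t hs ht =>
    simp only [map_add, hs, ht, TensorProduct.tmul_add]
    abel
  | tmul a b =>
    rw [wedgeStep_tmul, contraction_tmul, toExterior_apply, coderiv_ι_mul, TensorProduct.sub_tmul,
      map_sub, mulInner_tmul]
    rfl

theorem koszulDiff_mulInner (s : 𝔤 ⊗[ℂ] SuperExterior 𝒢) (u : L.Enveloping) :
    koszulDiff L (mulInner L (s ⊗ₜ u)) =
      ((wedgeAct L).flip s).rTensor L.Enveloping (comul L u) +
      mulInner L (((shift 𝒢).flip s ∘ₗ retraction L).rTensor L.Enveloping (comul L u)) := by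
  refine LinearMap.congr_fun (f := koszulDiff L ∘ₗ mulInner L ∘ₗ (TensorProduct.mk ℂ _ _).flip u)
    (g := LinearMap.applyₗ (comul L u) ∘ₗ (LinearMap.rTensorHom L.Enveloping ∘ₗ (wedgeAct L).flip +
      LinearMap.llcomp ℂ _ _ _ (mulInner L) ∘ₗ LinearMap.rTensorHom L.Enveloping ∘ₗ
        LinearMap.lcomp ℂ _ (retraction L) ∘ₗ (shift 𝒢).flip))
    (tensor_ext_hom 𝒢 fun i x hx w => ?_) s
  change koszulDiff L (mulInner L ((x ⊗ₜ w) ⊗ₜ u)) =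
    ((wedgeAct L).flip (x ⊗ₜ w)).rTensor L.Enveloping (comul L u) +
      mulInner L (((shift 𝒢).flip (x ⊗ₜ w) ∘ₗ retraction L).rTensor L.Enveloping (comul L u))
  rw [mulInner_tmul, koszulDiff_tmul, comul_ι_mul L hx]
  generalize comul L u = t
  refine LinearMap.congr_fun (f := wedgeStep L w ∘ₗ comulStep L i (Enveloping.ι L x))
    (g := ((wedgeAct L).flip (x ⊗ₜ w)).rTensor L.Enveloping +
      mulInner L ∘ₗ ((shift 𝒢).flip (x ⊗ₜ w) ∘ₗ retraction L).rTensor L.Enveloping)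
    (tensor_ext_hom (grading L) fun j a ha b => ?_) t
  simp only [LinearMap.comp_apply, LinearMap.add_apply, LinearMap.rTensor_tmul,
    LinearMap.flip_apply, comulStep_tmul, map_add, wedgeStep_tmul, wedgeAct_tmul,
    shift_tmul 𝒢 (retraction_mem L ha), mulInner_tmul, twist_of_mem _ ha, twist_of_mem 𝒢 hx,
    map_smul, ← TensorProduct.smul_tmul', koszul_comm j i,
    toExterior_apply]

/-- The Laplacian of the Koszul differential and the contraction. -/
theorem contraction_koszulDiff (w : SuperExterior 𝒢) (u : L.Enveloping) :
    contraction L (koszulDiff L (w ⊗ₜ u)) + koszulDiff L (contraction L (w ⊗ₜ u)) =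
      w ⊗ₜ eulerOp L u +
        ((wedgeAct L).flip (coderiv 𝒢 w)).rTensor L.Enveloping (comul L u) := by
  rw [koszulDiff_tmul, contraction_wedgeStep, contraction_tmul, koszulDiff_mulInner]
  change _ ⊗ₜ eulerOp L u - _ + _ = _
  abel

end SuperLieAlgebra

namespace SuperLieAlgebra

open SuperExterior Enveloping

variable {𝔤 : Type u} [AddCommGroup 𝔤] [Module ℂ 𝔤] {𝒢 : ZMod 2 → Submodule ℂ 𝔤}
  [DirectSum.Decomposition 𝒢] (L : SuperLieAlgebra 𝒢)

/-! ### Exactness of the Koszul complex -/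

/-- The subspace of `U(𝔤)` spanned by the products of less than `a` elements of `𝔤`. -/
def filt : ℕ → Submodule ℂ L.Enveloping
  | 0 => ⊥
  | a + 1 => 1 ⊔ LinearMap.range (Enveloping.ι L) * filt a

theorem one_mem_filt (a : ℕ) : 1 ∈ filt L (a + 1) :=
  Submodule.mem_sup_left (Submodule.one_le.1 le_rfl)

theorem ι_mul_mem_filt {a : ℕ} (x : 𝔤) {u : L.Enveloping} (hu : u ∈ filt L a) :
    Enveloping.ι L x * u ∈ filt L (a + 1) :=
  Submodule.mem_sup_right (Submodule.mul_mem_mul ⟨x, rfl⟩ hu)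

theorem filt_succ_le {a : ℕ} {S : Submodule ℂ L.Enveloping} (one : 1 ∈ S)
    (mul : ∀ i, ∀ x ∈ 𝒢 i, ∀ u ∈ filt L a, Enveloping.ι L x * u ∈ S) : filt L (a + 1) ≤ S := by
  refine sup_le (Submodule.one_le.2 one) (Submodule.mul_le.2 ?_)
  rintro _ ⟨x, rfl⟩ u hu
  refine hom_induction 𝒢 x (P := fun x => Enveloping.ι L x * u ∈ S) (fun x y hx hy => ?_)
    fun i x hx => mul i x hx u hu
  rw [map_add, add_mul]
  exact S.add_mem hx hy

theorem filt_le_succ (a : ℕ) : filt L a ≤ filt L (a + 1) := by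
  induction a with
  | zero => exact bot_le
  | succ a ih =>
    exact filt_succ_le L (one_mem_filt L _) fun i x _ u hu => ι_mul_mem_filt L x (ih hu)

theorem filt_mono : Monotone (filt L) := monotone_nat_of_le_succ (filt_le_succ L)

theorem exists_mem_filt (u : L.Enveloping) : ∃ a, u ∈ filt L a := by
  induction u using Enveloping.induction with
  | one => exact ⟨1, one_mem_filt L 0⟩
  | add u v hu hv =>
    obtain ⟨a, ha⟩ := hu
    obtain ⟨b, hb⟩ := hv
    exact ⟨max a b, Submodule.add_mem _ (filt_mono L (le_max_left a b) ha)
      (filt_mono L (le_max_right a b) hb)⟩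
  | smul r u hu =>
    obtain ⟨a, ha⟩ := hu
    exact ⟨a, Submodule.smul_mem _ r ha⟩
  | mul i x _ u hu =>
    obtain ⟨a, ha⟩ := hu
    exact ⟨a + 1, ι_mul_mem_filt L x ha⟩

/-- The subspace `U(𝔤) ⊗ F_a` of `U(𝔤) ⊗ U(𝔤)`, where `F_a` is spanned by the products of less
than `a` elements. -/
def rightFilt (a : ℕ) : Submodule ℂ (L.Enveloping ⊗[ℂ] L.Enveloping) :=
  Submodule.map₂ (TensorProduct.mk ℂ _ _) ⊤ (filt L a)

theorem tmul_mem_rightFilt {a : ℕ} (u : L.Enveloping) {v : L.Enveloping} (hv : v ∈ filt L a) :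
    u ⊗ₜ v ∈ rightFilt L a := Submodule.apply_mem_map₂ _ trivial hv

theorem rightFilt_le {a : ℕ} {S : Submodule ℂ (L.Enveloping ⊗[ℂ] L.Enveloping)}
    (h : ∀ i, ∀ u ∈ grading L i, ∀ v ∈ filt L a, u ⊗ₜ v ∈ S) : rightFilt L a ≤ S := by
  refine Submodule.map₂_le.2 fun u _ v hv => ?_
  refine hom_induction (grading L) u (P := fun u => TensorProduct.mk ℂ _ _ u v ∈ S)
    (fun u u' hu hu' => ?_) fun i u hu => h i u hu v hv
  rw [map_add, LinearMap.add_apply]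
  exact S.add_mem hu hu'

theorem comulStep_mem {a : ℕ} (i : ZMod 2) (x : 𝔤) {t : L.Enveloping ⊗[ℂ] L.Enveloping}
    (ht : t ∈ rightFilt L a) : comulStep L i (Enveloping.ι L x) t ∈ rightFilt L (a + 1) := by
  refine rightFilt_le L (S := (rightFilt L (a + 1)).comap (comulStep L i (Enveloping.ι L x)))
    (fun j u _ v hv => ?_) ht
  rw [Submodule.mem_comap, comulStep_tmul]
  exact Submodule.add_mem _ (tmul_mem_rightFilt L _ (filt_le_succ L a hv))
    (tmul_mem_rightFilt L _ (ι_mul_mem_filt L x hv))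

theorem comul_sub_mem {a : ℕ} {u : L.Enveloping} (hu : u ∈ filt L (a + 1)) :
    comul L u - 1 ⊗ₜ u ∈ rightFilt L a := by
  induction a generalizing u with
  | zero =>
    refine filt_succ_le L (S := (rightFilt L 0).comap (comul L - TensorProduct.mk ℂ _ _ 1)) ?_
      (fun i x hx v hv => ?_) hu
    · rw [Submodule.mem_comap, LinearMap.sub_apply, Enveloping.comul_one, TensorProduct.mk_apply,
        sub_self]
      exact Submodule.zero_mem _
    · rw [show v = 0 from hv, mul_zero]
      exact Submodule.zero_mem _
  | succ a ih =>
    refine filt_succ_le L (S := (rightFilt L (a + 1)).comap (comul L - TensorProduct.mk ℂ _ _ 1)) ?_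
      (fun i x hx v hv => ?_) hu
    · rw [Submodule.mem_comap, LinearMap.sub_apply, Enveloping.comul_one, TensorProduct.mk_apply,
        sub_self]
      exact Submodule.zero_mem _
    · have h := comulStep_mem L i x (ih hv)
      rw [map_sub, comulStep_tmul, twist_one, mul_one, ← comul_ι_mul L hx] at h
      rw [Submodule.mem_comap, LinearMap.sub_apply, TensorProduct.mk_apply]
      have h2 := Submodule.add_mem _ h (tmul_mem_rightFilt L (Enveloping.ι L x) hv)
      convert h2 using 1
      abel

theorem mul'_rTensor_mem {a : ℕ} {t : L.Enveloping ⊗[ℂ] L.Enveloping} (f : L.Enveloping →ₗ[ℂ] 𝔤)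
    (ht : t ∈ rightFilt L a) :
    LinearMap.mul' ℂ L.Enveloping ((Enveloping.ι L ∘ₗ f).rTensor L.Enveloping t) ∈
      filt L (a + 1) := by
  refine rightFilt_le L (S := (filt L (a + 1)).comap (LinearMap.mul' ℂ L.Enveloping ∘ₗ
    (Enveloping.ι L ∘ₗ f).rTensor L.Enveloping)) (fun j u _ v hv => ?_) ht
  simpa using ι_mul_mem_filt L _ hv

theorem eulerOp_one : eulerOp L 1 = 0 := by
  simp [eulerOp, Enveloping.comul_one, retraction_one]

theorem eulerOp_ι_mul {i : ZMod 2} {x : 𝔤} (hx : x ∈ 𝒢 i) (u : L.Enveloping) :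
    eulerOp L (Enveloping.ι L x * u) = Enveloping.ι L x * eulerOp L u +
      LinearMap.mul' ℂ L.Enveloping ((Enveloping.ι L ∘ₗ (retraction L ∘ₗ
        LinearMap.mulLeft ℂ (Enveloping.ι L x) - L.bracket x ∘ₗ retraction L)).rTensor L.Enveloping
          (comul L u)) := by
  simp only [eulerOp, LinearMap.comp_apply, comul_ι_mul L hx]
  generalize comul L u = t
  refine LinearMap.congr_fun (f := LinearMap.mul' ℂ L.Enveloping ∘ₗ
      (Enveloping.ι L ∘ₗ retraction L).rTensor L.Enveloping ∘ₗ comulStep L i (Enveloping.ι L x))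
    (g := LinearMap.mulLeft ℂ (Enveloping.ι L x) ∘ₗ LinearMap.mul' ℂ L.Enveloping ∘ₗ
      (Enveloping.ι L ∘ₗ retraction L).rTensor L.Enveloping + LinearMap.mul' ℂ L.Enveloping ∘ₗ
        (Enveloping.ι L ∘ₗ (retraction L ∘ₗ LinearMap.mulLeft ℂ (Enveloping.ι L x) -
          L.bracket x ∘ₗ retraction L)).rTensor L.Enveloping)
    (tensor_ext_hom (grading L) fun j a ha b => ?_) t
  have h := Enveloping.ι_mul_ι L hx (retraction_mem L ha)
  simp only [LinearMap.comp_apply, LinearMap.add_apply, LinearMap.rTensor_tmul, comulStep_tmul,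
    map_add, LinearMap.mul'_apply, LinearMap.mulLeft_apply, LinearMap.sub_apply, map_sub,
    twist_of_mem _ ha, map_smul, sub_mul, ← h, smul_mul_assoc, mul_assoc]
  abel

theorem eulerOp_sub_mem {a : ℕ} {u : L.Enveloping} (hu : u ∈ filt L (a + 1)) :
    eulerOp L u - (a : ℂ) • u ∈ filt L a := by
  induction a generalizing u with
  | zero =>
    refine filt_succ_le L (S := (filt L 0).comap (eulerOp L - ((0 : ℕ) : ℂ) • LinearMap.id)) ?_
      (fun i x hx v hv => ?_) hu
    · simp [eulerOp_one]
    · rw [show v = 0 from hv, mul_zero]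
      exact Submodule.zero_mem _
  | succ a ih =>
    refine filt_succ_le L
      (S := (filt L (a + 1)).comap (eulerOp L - ((a + 1 : ℕ) : ℂ) • LinearMap.id)) ?_
      (fun i x hx v hv => ?_) hu
    · rw [Submodule.mem_comap, LinearMap.sub_apply, eulerOp_one, zero_sub]
      exact Submodule.neg_mem _ (Submodule.smul_mem _ _ (one_mem_filt L a))
    · have h1 := ι_mul_mem_filt L x (ih hv)
      have h2 := mul'_rTensor_mem L (retraction L ∘ₗ LinearMap.mulLeft ℂ (Enveloping.ι L x) -
        L.bracket x ∘ₗ retraction L) (comul_sub_mem L hv)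
      have h3 := Submodule.add_mem _ h1 h2
      rw [Submodule.mem_comap, LinearMap.sub_apply, eulerOp_ι_mul L hx]
      convert h3 using 1
      rw [map_sub, map_sub]
      simp only [LinearMap.rTensor_tmul, LinearMap.comp_apply, LinearMap.sub_apply,
        LinearMap.mulLeft_apply, mul_one, retraction_ι, retraction_one, map_zero, sub_zero,
        LinearMap.mul'_apply, LinearMap.smul_apply, LinearMap.id_apply, mul_sub, mul_smul_comm]
      push_cast
      module

/-- The subspace of `⋀ 𝔤 ⊗ U(𝔤)` of elements of total degree less than `k`. -/
def totalFilt (k : ℕ) : Submodule ℂ (SuperExterior 𝒢 ⊗[ℂ] L.Enveloping) :=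
  Submodule.span ℂ {t | ∃ a b, a + b ≤ k ∧ ∃ w ∈ power 𝒢 b, ∃ u ∈ filt L a, t = w ⊗ₜ u}

theorem tmul_mem_totalFilt {k a b : ℕ} (h : a + b ≤ k) {w : SuperExterior 𝒢} (hw : w ∈ power 𝒢 b)
    {u : L.Enveloping} (hu : u ∈ filt L a) : w ⊗ₜ u ∈ totalFilt L k :=
  Submodule.subset_span ⟨a, b, h, w, hw, u, hu, rfl⟩

theorem totalFilt_mono : Monotone (totalFilt L) := fun k l hkl => by
  rw [totalFilt, Submodule.span_le]
  rintro _ ⟨a, b, h, w, hw, u, hu, rfl⟩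
  exact tmul_mem_totalFilt L (h.trans hkl) hw hu

theorem exists_mem_totalFilt (z : SuperExterior 𝒢 ⊗[ℂ] L.Enveloping) :
    ∃ k, z ∈ totalFilt L k := by
  have key : ∀ k l (y z : SuperExterior 𝒢 ⊗[ℂ] L.Enveloping), y ∈ totalFilt L k →
      z ∈ totalFilt L l → ∃ m, y + z ∈ totalFilt L m := fun k l y z hy hz =>
    ⟨max k l, Submodule.add_mem _ (totalFilt_mono L (le_max_left k l) hy)
      (totalFilt_mono L (le_max_right k l) hz)⟩
  induction z with
  | zero => exact ⟨0, Submodule.zero_mem _⟩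
  | add y z hy hz =>
    obtain ⟨k, hk⟩ := hy
    obtain ⟨l, hl⟩ := hz
    exact key k l y z hk hl
  | tmul w u =>
    obtain ⟨a, ha⟩ := exists_mem_filt L u
    refine Submodule.iSup_induction _ (motive := fun w => ∃ k, w ⊗ₜ u ∈ totalFilt L k)
      (mem_iSup_power 𝒢 w)
      (fun n w hw => ⟨a + n, tmul_mem_totalFilt L le_rfl hw ha⟩) ?_ ?_
    · exact ⟨0, by rw [TensorProduct.zero_tmul]; exact Submodule.zero_mem _⟩
    · rintro v w ⟨k, hk⟩ ⟨l, hl⟩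
      rw [TensorProduct.add_tmul]
      exact key k l _ _ hk hl

theorem wedgeAct_mem {b : ℕ} {w : SuperExterior 𝒢} (hw : w ∈ power 𝒢 b) (u : L.Enveloping) :
    wedgeAct L u (coderiv 𝒢 w) ∈ power 𝒢 b := by
  rcases b with _ | b
  · rw [coderiv_eq_zero 𝒢 hw, map_zero]
    exact Submodule.zero_mem _
  · have h : Submodule.map₂ (TensorProduct.mk ℂ 𝔤 (SuperExterior 𝒢)) ⊤ (power 𝒢 b) ≤
        (power 𝒢 (b + 1)).comap (wedgeAct L u) := by
      rw [Submodule.map₂_le]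
      intro x _ v hv
      exact ι_mul_mem_power 𝒢 _ hv
    exact h (coderiv_mem 𝒢 hw)

theorem wedgeAct_one (t : 𝔤 ⊗[ℂ] SuperExterior 𝒢) : wedgeAct L 1 t = wedgeHead 𝒢 t := by
  refine LinearMap.congr_fun (f := wedgeAct L 1) (g := wedgeHead 𝒢)
    (TensorProduct.ext' fun x w => ?_) t
  rw [wedgeAct_tmul, wedgeHead_tmul, mul_one, toExterior_ι]

theorem laplacian_sub_mem {k : ℕ} {z : SuperExterior 𝒢 ⊗[ℂ] L.Enveloping}
    (hz : z ∈ totalFilt L (k + 1)) :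
    contraction L (koszulDiff L z) + koszulDiff L (contraction L z) - (k : ℂ) • z ∈
      totalFilt L k := by
  have h : totalFilt L (k + 1) ≤ (totalFilt L k).comap (contraction L ∘ₗ koszulDiff L +
      koszulDiff L ∘ₗ contraction L - (k : ℂ) • LinearMap.id) := by
    rw [totalFilt, Submodule.span_le]
    rintro _ ⟨a, b, hab, w, hw, u, hu, rfl⟩
    rcases a with _ | a
    · rw [show u = 0 from hu, TensorProduct.tmul_zero]
      exact Submodule.zero_mem _
    rw [SetLike.mem_coe, Submodule.mem_comap]
    simp only [LinearMap.sub_apply, LinearMap.add_apply, LinearMap.comp_apply,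
      LinearMap.smul_apply, LinearMap.id_apply]
    rw [contraction_koszulDiff]
    have h1 : w ⊗ₜ (eulerOp L u - (a : ℂ) • u) ∈ totalFilt L k :=
      tmul_mem_totalFilt L (by omega) hw (eulerOp_sub_mem L hu)
    have h2 : ((wedgeAct L).flip (coderiv 𝒢 w)).rTensor L.Enveloping (comul L u - 1 ⊗ₜ u) ∈
        totalFilt L k := by
      refine rightFilt_le L (S := (totalFilt L k).comap
        (((wedgeAct L).flip (coderiv 𝒢 w)).rTensor L.Enveloping)) (fun i c _ v hv => ?_)
        (comul_sub_mem L hu)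
      exact tmul_mem_totalFilt L (by omega) (wedgeAct_mem L hw c) hv
    have h3 : ((a : ℂ) + b - k) • (w ⊗ₜ[ℂ] u) ∈ totalFilt L k := by
      rcases Nat.lt_or_ge (a + b) k with h | h
      · exact Submodule.smul_mem _ _ (tmul_mem_totalFilt L (by omega) hw hu)
      · rw [show k = a + b by omega, Nat.cast_add, sub_self, zero_smul]
        exact Submodule.zero_mem _
    rw [map_sub, LinearMap.rTensor_tmul, LinearMap.flip_apply, wedgeAct_one,
      wedgeHead_coderiv 𝒢 hw] at h2
    rw [TensorProduct.tmul_sub, TensorProduct.tmul_smul] at h1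
    rw [← TensorProduct.smul_tmul'] at h2
    convert Submodule.add_mem _ (Submodule.add_mem _ h1 h2) h3 using 1
    module
  exact h hz

theorem koszulDiff_one : koszulDiff L (1 ⊗ₜ 1) = 0 := by
  rw [koszulDiff_tmul, Enveloping.comul_one, wedgeStep_tmul, toExterior_one, zero_mul,
    TensorProduct.zero_tmul]

/-- The Koszul complex is exact away from `1 ⊗ 1`. -/
theorem exists_of_koszulDiff_eq_zero {z : SuperExterior 𝒢 ⊗[ℂ] L.Enveloping}
    (hz : koszulDiff L z = 0) : ∃ y, ∃ r : ℂ, z = koszulDiff L y + r • 1 ⊗ₜ 1 := by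
  obtain ⟨k, hk⟩ := exists_mem_totalFilt L z
  induction k generalizing z with
  | zero =>
    have h : totalFilt L 0 ≤ ⊥ := by
      rw [totalFilt, Submodule.span_le]
      rintro _ ⟨a, b, hab, w, hw, u, hu, rfl⟩
      obtain rfl : a = 0 := by omega
      rw [show u = 0 from hu, TensorProduct.tmul_zero]
      exact Submodule.zero_mem _
    exact ⟨0, 0, by rw [(Submodule.mem_bot ℂ).1 (h hk)]; simp⟩
  | succ k ih =>
    rcases k with _ | k
    · have h : totalFilt L 1 ≤ Submodule.span ℂ {1 ⊗ₜ 1} := by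
        rw [totalFilt, Submodule.span_le]
        rintro _ ⟨a, b, hab, w, hw, u, hu, rfl⟩
        rcases a with _ | a
        · rw [show u = 0 from hu, TensorProduct.tmul_zero]
          exact Submodule.zero_mem _
        · obtain rfl : a = 0 := by omega
          obtain rfl : b = 0 := by omega
          rw [power_zero, Submodule.mem_one] at hw
          obtain ⟨r, rfl⟩ := hw
          have h1 : filt L 1 ≤ 1 := filt_succ_le L (Submodule.one_le.1 le_rfl) fun i x _ v hv => by
            rw [show v = 0 from hv, mul_zero]
            exact Submodule.zero_mem _
          obtain ⟨s, rfl⟩ := Submodule.mem_one.1 (h1 hu)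
          rw [Algebra.algebraMap_eq_smul_one, Algebra.algebraMap_eq_smul_one,
            TensorProduct.smul_tmul_smul]
          exact Submodule.smul_mem _ _ (Submodule.mem_span_singleton_self _)
      obtain ⟨r, hr⟩ := Submodule.mem_span_singleton.1 (h hk)
      exact ⟨0, r, by rw [map_zero, zero_add, hr]⟩
    · have h := laplacian_sub_mem L hk
      rw [hz, map_zero, zero_add] at h
      have hne : ((k + 1 : ℕ) : ℂ) ≠ 0 := Nat.cast_ne_zero.2 (Nat.succ_ne_zero k)
      obtain ⟨y, r, hy⟩ := ih (z := koszulDiff L (contraction L z) - ((k + 1 : ℕ) : ℂ) • z)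
        (by rw [map_sub, koszulDiff_koszulDiff, map_smul, hz, smul_zero, sub_zero]) h
      refine ⟨((k + 1 : ℕ) : ℂ)⁻¹ • (contraction L z - y), -((k + 1 : ℕ) : ℂ)⁻¹ * r, ?_⟩
      have h2 : ((k + 1 : ℕ) : ℂ) • z =
          koszulDiff L (contraction L z) - (koszulDiff L y + r • 1 ⊗ₜ 1) := by rw [← hy]; abel
      have h3 := congrArg (fun t => ((k + 1 : ℕ) : ℂ)⁻¹ • t) h2
      simp only [smul_smul, inv_mul_cancel₀ hne, one_smul] at h3
      rw [map_smul, map_sub]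
      refine h3.trans ?_
      module

end SuperLieAlgebra

namespace SuperExterior

variable {𝔤 : Type u} [AddCommGroup 𝔤] [Module ℂ 𝔤] (𝒢 : ZMod 2 → Submodule ℂ 𝔤)
  [DirectSum.Decomposition 𝒢]

/-- The antiautomorphism of `⋀ 𝔤` that fixes `𝔤`, as a homomorphism to the opposite algebra. -/
def reversalHom : SuperExterior 𝒢 →ₐ[ℂ] (SuperExterior 𝒢)ᵐᵒᵖ :=
  lift 𝒢 ((MulOpposite.opLinearEquiv ℂ).toLinearMap ∘ₗ ι 𝒢) (fun i j a b ha hb => by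
    simp only [LinearMap.comp_apply, LinearEquiv.coe_coe, MulOpposite.coe_opLinearEquiv,
      ← MulOpposite.op_mul, ← MulOpposite.op_smul, ← MulOpposite.op_add, koszul_comm i j,
      ι_mul_ι 𝒢 hb ha, MulOpposite.op_zero])

/-- The antiautomorphism of `⋀ 𝔤` that fixes `𝔤`. -/
def reversal : SuperExterior 𝒢 →ₗ[ℂ] SuperExterior 𝒢 :=
  (MulOpposite.opLinearEquiv ℂ).symm.toLinearMap ∘ₗ (reversalHom 𝒢).toLinearMap

theorem reversal_one : reversal 𝒢 1 = 1 := by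
  simp [reversal]

theorem reversal_mul (v w : SuperExterior 𝒢) :
    reversal 𝒢 (v * w) = reversal 𝒢 w * reversal 𝒢 v := by
  simp [reversal]

theorem reversal_ι (x : 𝔤) : reversal 𝒢 (ι 𝒢 x) = ι 𝒢 x := by
  simp [reversal, reversalHom, lift_ι]

theorem reversal_reversal (w : SuperExterior 𝒢) : reversal 𝒢 (reversal 𝒢 w) = w := by
  induction w using SuperExterior.induction with
  | one => rw [reversal_one, reversal_one]
  | add a b ha hb => rw [map_add, map_add, ha, hb]
  | smul r a ha => rw [map_smul, map_smul, ha]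
  | mul i x hx a ha => rw [reversal_mul, reversal_mul, ha, reversal_ι, reversal_ι]

theorem reversal_mem {n : ℕ} {w : SuperExterior 𝒢} (hw : w ∈ power 𝒢 n) :
    reversal 𝒢 w ∈ power 𝒢 n := by
  induction n generalizing w with
  | zero =>
    rw [power_zero, Submodule.mem_one] at hw ⊢
    obtain ⟨r, rfl⟩ := hw
    exact ⟨r, by rw [Algebra.algebraMap_eq_smul_one, map_smul, reversal_one]⟩
  | succ n ih =>
    refine power_succ_le 𝒢 (S := (power 𝒢 (n + 1)).comap (reversal 𝒢)) (fun i x _ w hw => ?_) hw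
    rw [Submodule.mem_comap, reversal_mul, reversal_ι, power, pow_succ]
    exact Submodule.mul_mem_mul (ih hw) ⟨x, rfl⟩

end SuperExterior

namespace SuperLieAlgebra

open SuperExterior Enveloping

variable {𝔤 : Type u} [AddCommGroup 𝔤] [Module ℂ 𝔤] {𝒢 : ZMod 2 → Submodule ℂ 𝔤}
  [DirectSum.Decomposition 𝒢] (L : SuperLieAlgebra 𝒢)

/-! ### The Koszul resolution of the cobar complex -/

/-- The identification `(⋀ 𝔤 ⊗ U(𝔤)) ⊗ U(𝔤)^{⊗ m} = ⋀ 𝔤 ⊗ U(𝔤)^{⊗ (m+1)}`. -/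
def headEquiv (m : ℕ) : (SuperExterior 𝒢 ⊗[ℂ] L.Enveloping) ⊗[ℂ] (⨂[ℂ]^m L.Enveloping) ≃ₗ[ℂ]
    SuperExterior 𝒢 ⊗[ℂ] (⨂[ℂ]^(m + 1) L.Enveloping) :=
  TensorProduct.assoc ℂ _ _ _ ≪≫ₗ
    TensorProduct.congr (LinearEquiv.refl ℂ _) (consEquiv L.Enveloping m)

theorem headEquiv_tmul {m : ℕ} (w : SuperExterior 𝒢) (u : L.Enveloping)
    (c : ⨂[ℂ]^m L.Enveloping) : headEquiv L m ((w ⊗ₜ u) ⊗ₜ c) = w ⊗ₜ (u ⊹ c) := rfl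

theorem headEquiv_symm_tmul {m : ℕ} (w : SuperExterior 𝒢) (u : L.Enveloping)
    (c : ⨂[ℂ]^m L.Enveloping) : (headEquiv L m).symm (w ⊗ₜ (u ⊹ c)) = (w ⊗ₜ u) ⊗ₜ c := by
  rw [← headEquiv_tmul, LinearEquiv.symm_apply_apply]

theorem head_ext {m : ℕ} {W : Type*} [AddCommGroup W] [Module ℂ W]
    {f g : SuperExterior 𝒢 ⊗[ℂ] (⨂[ℂ]^(m + 1) L.Enveloping) →ₗ[ℂ] W}
    (h : ∀ w u c, f (w ⊗ₜ (u ⊹ c)) = g (w ⊗ₜ (u ⊹ c))) : f = g :=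
  TensorProduct.ext (LinearMap.ext fun w => power_ext fun u c => h w u c)

/-- The Koszul differential on the first factors of `⋀ 𝔤 ⊗ U(𝔤)^{⊗ (m+1)}`. -/
def koszulHead (m : ℕ) : Module.End ℂ (SuperExterior 𝒢 ⊗[ℂ] (⨂[ℂ]^(m + 1) L.Enveloping)) :=
  (headEquiv L m).toLinearMap ∘ₗ (koszulDiff L).rTensor _ ∘ₗ (headEquiv L m).symm.toLinearMap

theorem koszulHead_tmul {m : ℕ} (w : SuperExterior 𝒢) (u : L.Enveloping)
    (c : ⨂[ℂ]^m L.Enveloping) :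
    koszulHead L m (w ⊗ₜ (u ⊹ c)) = headEquiv L m (wedgeStep L w (comul L u) ⊗ₜ c) := by
  simp only [koszulHead, LinearMap.comp_apply, LinearEquiv.coe_coe, headEquiv_symm_tmul,
    LinearMap.rTensor_tmul, koszulDiff_tmul]

theorem koszulHead_koszulHead {m : ℕ}
    (z : SuperExterior 𝒢 ⊗[ℂ] (⨂[ℂ]^(m + 1) L.Enveloping)) :
    koszulHead L m (koszulHead L m z) = 0 := by
  simp only [koszulHead, LinearMap.comp_apply, LinearEquiv.coe_coe, LinearEquiv.symm_apply_apply]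
  rw [← LinearMap.comp_apply ((koszulDiff L).rTensor _), ← LinearMap.rTensor_comp,
    show koszulDiff L ∘ₗ koszulDiff L = 0 from LinearMap.ext (koszulDiff_koszulDiff L)]
  simp

theorem koszulHead_one_cons {m : ℕ} (c : ⨂[ℂ]^m L.Enveloping) :
    koszulHead L m (1 ⊗ₜ (1 ⊹ c)) = 0 := by
  rw [koszulHead_tmul, ← koszulDiff_tmul, koszulDiff_one, TensorProduct.zero_tmul, map_zero]

theorem exists_of_koszulHead_eq_zero {m : ℕ}
    {z : SuperExterior 𝒢 ⊗[ℂ] (⨂[ℂ]^(m + 1) L.Enveloping)} (hz : koszulHead L m z = 0) :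
    ∃ y x, z = koszulHead L m y + 1 ⊗ₜ (1 ⊹ x) := by
  let g : (SuperExterior 𝒢 ⊗[ℂ] L.Enveloping) × ℂ →ₗ[ℂ] SuperExterior 𝒢 ⊗[ℂ] L.Enveloping :=
    (koszulDiff L).coprod (LinearMap.toSpanSingleton ℂ _ (1 ⊗ₜ 1))
  have hg : Function.Exact g (koszulDiff L) := by
    intro t
    constructor
    · intro ht
      obtain ⟨y, r, rfl⟩ := exists_of_koszulDiff_eq_zero L ht
      exact ⟨(y, r), by simp [g]⟩
    · rintro ⟨⟨y, r⟩, rfl⟩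
      simp [g, koszulDiff_koszulDiff, koszulDiff_one]
  have h := Module.Flat.rTensor_exact (⨂[ℂ]^m L.Enveloping) hg
  have hz' : (koszulDiff L).rTensor (⨂[ℂ]^m L.Enveloping) ((headEquiv L m).symm z) = 0 := by
    simpa [koszulHead] using hz
  obtain ⟨s, hs⟩ := (h _).1 hz'
  have key : ∀ s, ∃ y x, headEquiv L m (g.rTensor (⨂[ℂ]^m L.Enveloping) s) =
      koszulHead L m y + 1 ⊗ₜ (1 ⊹ x) := by
    intro s
    induction s with
    | zero => exact ⟨0, 0, by simp⟩
    | add s t hs ht =>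
      obtain ⟨y, x, hs⟩ := hs
      obtain ⟨y', x', ht⟩ := ht
      refine ⟨y + y', x + x', ?_⟩
      rw [map_add, map_add, hs, ht, map_add, cons_add, TensorProduct.tmul_add]
      abel
    | tmul q c =>
      refine ⟨headEquiv L m (q.1 ⊗ₜ c), q.2 • c, ?_⟩
      simp [g, koszulHead, TensorProduct.add_tmul, ← headEquiv_tmul,
        ← TensorProduct.smul_tmul']
  obtain ⟨y, x, hyx⟩ := key s
  exact ⟨y, x, by rw [← hyx, hs, LinearEquiv.apply_symm_apply]⟩

/-- The map `w ⊗ c ↦ ε(w) c`, where `ε` is the augmentation of `⋀ 𝔤`. -/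
def augTensor (Y : Type*) [AddCommGroup Y] [Module ℂ Y] : SuperExterior 𝒢 ⊗[ℂ] Y →ₗ[ℂ] Y :=
  (TensorProduct.lid ℂ Y).toLinearMap ∘ₗ (augmentation 𝒢).toLinearMap.rTensor Y

theorem augTensor_tmul {Y : Type*} [AddCommGroup Y] [Module ℂ Y] (w : SuperExterior 𝒢) (c : Y) :
    augTensor Y (w ⊗ₜ[ℂ] c) = augmentation 𝒢 w • c := by
  simp [augTensor]

theorem augTensor_lTensor {Y Z : Type*} [AddCommGroup Y] [Module ℂ Y] [AddCommGroup Z]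
    [Module ℂ Z] (f : Y →ₗ[ℂ] Z) (z : SuperExterior 𝒢 ⊗[ℂ] Y) :
    augTensor Z (f.lTensor (SuperExterior 𝒢) z) = f (augTensor Y z) := by
  refine LinearMap.congr_fun (f := augTensor Z ∘ₗ f.lTensor (SuperExterior 𝒢))
    (g := f ∘ₗ augTensor Y) (TensorProduct.ext' fun w c => ?_) z
  simp [augTensor_tmul]

theorem augmentation_toExterior_mul (u : L.Enveloping) (w : SuperExterior 𝒢) :
    augmentation 𝒢 (toExterior L u * w) = 0 := by
  rw [map_mul, toExterior_apply]
  unfold augmentation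
  rw [SuperExterior.lift_ι, LinearMap.zero_apply, zero_mul]

theorem augTensor_koszulHead {m : ℕ}
    (z : SuperExterior 𝒢 ⊗[ℂ] (⨂[ℂ]^(m + 1) L.Enveloping)) :
    augTensor _ (koszulHead L m z) = 0 := by
  refine LinearMap.congr_fun (f := augTensor _ ∘ₗ koszulHead L m) (g := 0)
    (head_ext L fun w u c => ?_) z
  rw [LinearMap.comp_apply, koszulHead_tmul]
  generalize comul L u = t
  induction t with
  | zero => simp
  | add s t hs ht =>
    rw [map_add, TensorProduct.add_tmul, map_add, map_add, hs, ht, LinearMap.zero_apply, add_zero]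
  | tmul a b =>
    rw [wedgeStep_tmul, headEquiv_tmul, augTensor_tmul, augmentation_toExterior_mul, zero_smul,
      LinearMap.zero_apply]

/-- The map `w ⊗ (u₁, …, u_m) ↦ θ(u_m) ∧ ⋯ ∧ θ(u₁) ∧ w`, where `θ` is the retraction onto `𝔤`. -/
def wedgeAll : (m : ℕ) → SuperExterior 𝒢 ⊗[ℂ] (⨂[ℂ]^m L.Enveloping) →ₗ[ℂ] SuperExterior 𝒢
  | 0 => (TensorProduct.rid ℂ (SuperExterior 𝒢)).toLinearMap ∘ₗ
      (PiTensorProduct.isEmptyEquiv (R := ℂ) (s := fun _ : Fin 0 => L.Enveloping)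
        (Fin 0)).toLinearMap.lTensor (SuperExterior 𝒢)
  | m + 1 => wedgeAll m ∘ₗ (counitHead L m).lTensor (SuperExterior 𝒢) ∘ₗ koszulHead L m

theorem wedgeAll_zero_tmul (w : SuperExterior 𝒢) (c : ⨂[ℂ]^0 L.Enveloping) :
    wedgeAll L 0 (w ⊗ₜ c) = PiTensorProduct.isEmptyEquiv (R := ℂ) (Fin 0) c • w := by
  simp [wedgeAll]

theorem wedgeAll_zero_injective : Function.Injective (wedgeAll L 0) := by
  have h : wedgeAll L 0 = (TensorProduct.congr (LinearEquiv.refl ℂ (SuperExterior 𝒢))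
      (PiTensorProduct.isEmptyEquiv (R := ℂ) (s := fun _ : Fin 0 => L.Enveloping) (Fin 0)) ≪≫ₗ
        TensorProduct.rid ℂ (SuperExterior 𝒢)).toLinearMap := rfl
  rw [h]
  exact LinearEquiv.injective _

theorem wedgeAll_succ_tmul {m : ℕ} (w : SuperExterior 𝒢) (u : L.Enveloping)
    (c : ⨂[ℂ]^m L.Enveloping) :
    wedgeAll L (m + 1) (w ⊗ₜ (u ⊹ c)) = wedgeAll L m ((toExterior L u * w) ⊗ₜ c) := by
  have h : ∀ t : L.Enveloping ⊗[ℂ] L.Enveloping, (counitHead L m).lTensor (SuperExterior 𝒢)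
      (headEquiv L m (wedgeStep L w t ⊗ₜ c)) =
      (toExterior L (TensorProduct.rid ℂ _ ((counitHom L).toLinearMap.lTensor _ t)) * w) ⊗ₜ c := by
    intro t
    induction t with
    | zero => simp
    | add s t hs ht => simp only [map_add, TensorProduct.add_tmul, hs, ht, add_mul]
    | tmul a b =>
      simp [wedgeStep_tmul, headEquiv_tmul, counitHead_cons, TensorProduct.smul_tmul]
  have h2 : (counitHom L).toLinearMap.lTensor _ (comul L u) = u ⊗ₜ 1 :=
    Coalgebra.lTensor_counit_comul (R := ℂ) u
  rw [wedgeAll, LinearMap.comp_apply, LinearMap.comp_apply, koszulHead_tmul, h, h2,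
    TensorProduct.rid_tmul, one_smul]

theorem wedgeAll_cons₂ {m : ℕ} (w : SuperExterior 𝒢) (t : L.Enveloping ⊗[ℂ] L.Enveloping)
    (c : ⨂[ℂ]^m L.Enveloping) :
    wedgeAll L (m + 2) (w ⊗ₜ cons₂ m (t ⊗ₜ c)) = wedgeAll L m ((wedgeRev L t * w) ⊗ₜ c) := by
  induction t with
  | zero => simp
  | add s t hs ht =>
    simp only [map_add, TensorProduct.add_tmul, TensorProduct.tmul_add, hs, ht, add_mul]
  | tmul a b => rw [cons₂_tmul, wedgeAll_succ_tmul, wedgeAll_succ_tmul, wedgeRev_tmul, mul_assoc]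

theorem wedgeAll_mem {m k : ℕ} {w : SuperExterior 𝒢} (hw : w ∈ power 𝒢 k)
    (c : ⨂[ℂ]^m L.Enveloping) : wedgeAll L m (w ⊗ₜ c) ∈ power 𝒢 (k + m) := by
  induction m generalizing k w with
  | zero =>
    rw [wedgeAll_zero_tmul]
    exact Submodule.smul_mem _ _ hw
  | succ m ih =>
    induction c using cons_induction with
    | zero =>
      rw [TensorProduct.tmul_zero, map_zero]
      exact Submodule.zero_mem _
    | add c d hc hd =>
      rw [TensorProduct.tmul_add, map_add]
      exact Submodule.add_mem _ hc hd
    | cons u c =>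
      rw [wedgeAll_succ_tmul, show k + (m + 1) = k + 1 + m by ring]
      exact ih (ι_mul_mem_power 𝒢 _ hw) c

theorem wedgeAll_hochschildB (δ : L.Character) {m : ℕ} (w : SuperExterior 𝒢)
    (c : ⨂[ℂ]^m L.Enveloping) : wedgeAll L (m + 1) (w ⊗ₜ δ.mpi.hochschildB m c) = 0 := by
  induction m generalizing w with
  | zero => rw [Character.hochschildB_zero, TensorProduct.tmul_zero, map_zero]
  | succ m ih =>
    induction c using cons_induction with
    | zero => rw [map_zero, TensorProduct.tmul_zero, map_zero]
    | add c d hc hd => rw [map_add, TensorProduct.tmul_add, map_add, hc, hd, add_zero]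
    | cons u c =>
      rw [Character.hochschildB_cons, TensorProduct.tmul_sub, map_sub, wedgeAll_cons₂,
        wedgeAll_succ_tmul, ih, Character.cobound_apply, map_sub, map_add, wedgeRev_comul,
        wedgeRev_tmul, wedgeRev_tmul, toExterior_one, mul_zero, zero_mul]
      simp

theorem wedgeAll_antisymmetrization {n : ℕ} (v : SuperExterior 𝒢) {w : SuperExterior 𝒢}
    (hw : w ∈ power 𝒢 n) :
    wedgeAll L n (v ⊗ₜ antisymmetrization L n w) = reversal 𝒢 w * v := by
  induction n generalizing v w with
  | zero =>
    rw [power_zero, Submodule.mem_one] at hw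
    obtain ⟨r, rfl⟩ := hw
    rw [wedgeAll_zero_tmul, Algebra.algebraMap_eq_smul_one, map_smul, map_smul, map_smul,
      reversal_one]
    simp [antisymmetrization]
  | succ n ih =>
    have h : Submodule.map₂ (TensorProduct.mk ℂ 𝔤 (SuperExterior 𝒢)) ⊤ (power 𝒢 n) ≤
        LinearMap.ker (wedgeAll L (n + 1) ∘ₗ TensorProduct.mk ℂ _ _ v ∘ₗ
          (consEquiv L.Enveloping n).toLinearMap ∘ₗ
          TensorProduct.map (Enveloping.ι L) (antisymmetrization L n) -
            LinearMap.mulRight ℂ v ∘ₗ reversal 𝒢 ∘ₗ wedgeHead 𝒢) := by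
      rw [Submodule.map₂_le]
      intro x _ w hw
      rw [LinearMap.mem_ker, LinearMap.sub_apply, sub_eq_zero]
      simp only [LinearMap.comp_apply, TensorProduct.mk_apply, TensorProduct.map_tmul,
        LinearEquiv.coe_coe, wedgeAll_succ_tmul, toExterior_ι, ih _ hw, wedgeHead_tmul,
        LinearMap.mulRight_apply, reversal_mul, reversal_ι, mul_assoc]
    have h2 := LinearMap.mem_ker.1 (h (coderiv_mem 𝒢 hw))
    rw [LinearMap.sub_apply, sub_eq_zero] at h2
    simp only [LinearMap.comp_apply, TensorProduct.mk_apply, LinearEquiv.coe_coe,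
      wedgeHead_coderiv 𝒢 hw, map_smul] at h2
    have hne : (n : ℂ) + 1 ≠ 0 := by exact_mod_cast Nat.succ_ne_zero n
    rw [antisymmetrization_succ, TensorProduct.tmul_smul, map_smul, h2, LinearMap.mulRight_apply,
      smul_smul]
    push_cast
    rw [inv_mul_cancel₀ hne, one_smul]

/-! ### The cohomology of the cobar complex -/

section Cobar

variable {L} (δ : L.Character)

/-- The differential `c ↦ 1 ⊗ c - b c` of the cobar resolution. -/
def resDiff (m : ℕ) : (⨂[ℂ]^m L.Enveloping) →ₗ[ℂ] ⨂[ℂ]^(m + 1) L.Enveloping :=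
  consWith 1 m - δ.mpi.hochschildB m

theorem resDiff_apply {m : ℕ} (c : ⨂[ℂ]^m L.Enveloping) :
    resDiff δ m c = (1 ⊹ c) - δ.mpi.hochschildB m c := rfl

theorem resDiff_cons {m : ℕ} (u : L.Enveloping) (c : ⨂[ℂ]^m L.Enveloping) :
    resDiff δ (m + 1) (u ⊹ c) =
      cons₂ m (comul L u ⊗ₜ c) - (u ⊹ 1 ⊹ c) + (u ⊹ δ.mpi.hochschildB m c) := by
  rw [resDiff_apply, Character.hochschildB_cons, Character.cobound_apply, TensorProduct.sub_tmul,
    TensorProduct.add_tmul, map_sub, map_add, cons₂_tmul, cons₂_tmul]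
  abel

theorem hochschildB_one_cons {m : ℕ} (c : ⨂[ℂ]^m L.Enveloping) :
    δ.mpi.hochschildB (m + 1) (1 ⊹ c) = 1 ⊹ resDiff δ m c := by
  rw [Character.hochschildB_cons, Character.cobound_apply, Enveloping.comul_one,
    add_sub_cancel_right,
    cons₂_tmul, resDiff_apply, cons_sub]

theorem resDiff_resDiff {m : ℕ} (c : ⨂[ℂ]^m L.Enveloping) :
    resDiff δ (m + 1) (resDiff δ m c) = 0 := by
  rw [resDiff_apply δ (resDiff δ m c)]
  nth_rw 2 [resDiff_apply]
  rw [map_sub, hochschildB_one_cons, Character.hochschildB_hochschildB, sub_zero, sub_self]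

theorem counitHead_resDiff {m : ℕ} (c : ⨂[ℂ]^(m + 1) L.Enveloping) :
    counitHead L (m + 1) (resDiff δ (m + 1) c) + resDiff δ m (counitHead L m c) = c := by
  refine LinearMap.congr_fun (f := counitHead L (m + 1) ∘ₗ resDiff δ (m + 1) +
    resDiff δ m ∘ₗ counitHead L m) (g := LinearMap.id) (power_ext fun u c => ?_) c
  simp only [LinearMap.add_apply, LinearMap.comp_apply, resDiff_cons, map_add, map_sub,
    counitHead_cons₂, counitHead_cons, map_smul, LinearMap.id_apply]
  rw [resDiff_apply]
  module

theorem koszulHead_cons₂ {m : ℕ} (w : SuperExterior 𝒢) (t : L.Enveloping ⊗[ℂ] L.Enveloping)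
    (c : ⨂[ℂ]^m L.Enveloping) : koszulHead L (m + 1) (w ⊗ₜ cons₂ m (t ⊗ₜ c)) =
      TensorProduct.map (LinearMap.mulRight ℂ w ∘ₗ toExterior L)
        (cons₂ m ∘ₗ (TensorProduct.mk ℂ _ _).flip c)
        (TensorProduct.assoc ℂ _ _ _ ((comul L).rTensor L.Enveloping t)) := by
  induction t with
  | zero => simp
  | add s t hs ht => simp only [map_add, TensorProduct.add_tmul, TensorProduct.tmul_add, hs, ht]
  | tmul a b =>
    rw [cons₂_tmul, koszulHead_tmul, LinearMap.rTensor_tmul]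
    generalize comul L a = s
    induction s with
    | zero => simp
    | add s t hs ht => simp only [map_add, TensorProduct.add_tmul, hs, ht]
    | tmul x y => simp [wedgeStep_tmul, headEquiv_tmul, cons₂_tmul]

theorem lTensor_resDiff_headEquiv {m : ℕ} (w : SuperExterior 𝒢)
    (t : L.Enveloping ⊗[ℂ] L.Enveloping) (c : ⨂[ℂ]^m L.Enveloping) :
    (resDiff δ (m + 1)).lTensor (SuperExterior 𝒢) (headEquiv L m (wedgeStep L w t ⊗ₜ c)) =
      TensorProduct.map (LinearMap.mulRight ℂ w ∘ₗ toExterior L)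
        (cons₂ m ∘ₗ (TensorProduct.mk ℂ _ _).flip c) ((comul L).lTensor L.Enveloping t) -
      headEquiv L (m + 1) (wedgeStep L w t ⊗ₜ (1 ⊹ c)) +
      headEquiv L (m + 1) (wedgeStep L w t ⊗ₜ δ.mpi.hochschildB m c) := by
  induction t with
  | zero => simp
  | add s t hs ht =>
    simp only [map_add, TensorProduct.add_tmul, hs, ht]
    abel
  | tmul a b =>
    simp only [wedgeStep_tmul, headEquiv_tmul, LinearMap.lTensor_tmul, resDiff_cons,
      TensorProduct.map_tmul, LinearMap.comp_apply, LinearMap.flip_apply, TensorProduct.mk_apply,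
      LinearMap.mulRight_apply, TensorProduct.tmul_add, TensorProduct.tmul_sub]

theorem koszulHead_resDiff {m : ℕ} (z : SuperExterior 𝒢 ⊗[ℂ] (⨂[ℂ]^(m + 1) L.Enveloping)) :
    koszulHead L (m + 1) ((resDiff δ (m + 1)).lTensor (SuperExterior 𝒢) z) =
      (resDiff δ (m + 1)).lTensor (SuperExterior 𝒢) (koszulHead L m z) := by
  refine LinearMap.congr_fun
    (f := koszulHead L (m + 1) ∘ₗ (resDiff δ (m + 1)).lTensor (SuperExterior 𝒢))
    (g := (resDiff δ (m + 1)).lTensor (SuperExterior 𝒢) ∘ₗ koszulHead L m)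
    (head_ext L fun w u c => ?_) z
  have h : (comul L).lTensor L.Enveloping (comul L u) =
      TensorProduct.assoc ℂ _ _ _ ((comul L).rTensor L.Enveloping (comul L u)) :=
    (Coalgebra.coassoc_apply (R := ℂ) u).symm
  rw [LinearMap.comp_apply, LinearMap.comp_apply, koszulHead_tmul, lTensor_resDiff_headEquiv, h,
    LinearMap.lTensor_tmul, resDiff_cons, TensorProduct.tmul_add, TensorProduct.tmul_sub, map_add,
    map_sub, koszulHead_cons₂, koszulHead_tmul, koszulHead_tmul]

theorem lTensor_counitHead_resDiff {m : ℕ}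
    (z : SuperExterior 𝒢 ⊗[ℂ] (⨂[ℂ]^(m + 1) L.Enveloping)) :
    (counitHead L (m + 1)).lTensor _ ((resDiff δ (m + 1)).lTensor _ z) +
      (resDiff δ m).lTensor _ ((counitHead L m).lTensor _ z) = z := by
  refine LinearMap.congr_fun (f := (counitHead L (m + 1)).lTensor (SuperExterior 𝒢) ∘ₗ
    (resDiff δ (m + 1)).lTensor _ + (resDiff δ m).lTensor _ ∘ₗ (counitHead L m).lTensor _)
    (g := LinearMap.id) (TensorProduct.ext' fun w c => ?_) z
  simp only [LinearMap.add_apply, LinearMap.comp_apply, LinearMap.lTensor_tmul,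
    ← TensorProduct.tmul_add, counitHead_resDiff, LinearMap.id_apply]

theorem lTensor_resDiff_resDiff {m : ℕ} (z : SuperExterior 𝒢 ⊗[ℂ] (⨂[ℂ]^m L.Enveloping)) :
    (resDiff δ (m + 1)).lTensor _ ((resDiff δ m).lTensor _ z) = 0 := by
  rw [← LinearMap.lTensor_comp_apply,
    show resDiff δ (m + 1) ∘ₗ resDiff δ m = 0 from LinearMap.ext (resDiff_resDiff δ),
    LinearMap.lTensor_zero, LinearMap.zero_apply]

theorem exists_koszulHead_sub_eq_zero {m : ℕ}
    {z : SuperExterior 𝒢 ⊗[ℂ] (⨂[ℂ]^(m + 1) L.Enveloping)}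
    (hz : (resDiff δ (m + 1)).lTensor _ (koszulHead L m z) = 0) (hP : wedgeAll L (m + 1) z = 0) :
    ∃ s, koszulHead L m (z - (resDiff δ m).lTensor _ s) = 0 := by
  have hE := lTensor_counitHead_resDiff δ (koszulHead L m z)
  rw [hz, map_zero, zero_add] at hE
  induction m with
  | zero =>
    have h : (counitHead L 0).lTensor (SuperExterior 𝒢) (koszulHead L 0 z) = 0 :=
      wedgeAll_zero_injective L (by rw [map_zero]; exact hP)
    refine ⟨0, ?_⟩
    rw [h, map_zero] at hE
    rw [map_zero, sub_zero, ← hE]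
  | succ m ih =>
    set v := (counitHead L (m + 1)).lTensor (SuperExterior 𝒢) (koszulHead L (m + 1) z) with hv
    have h1 : (resDiff δ (m + 1)).lTensor _ (koszulHead L m v) = 0 := by
      rw [← koszulHead_resDiff, hE, koszulHead_koszulHead]
    have h2 := lTensor_counitHead_resDiff δ (koszulHead L m v)
    rw [h1, map_zero, zero_add] at h2
    obtain ⟨s, hs⟩ := ih h1 hP h2
    obtain ⟨y, x, hyx⟩ := exists_of_koszulHead_eq_zero L hs
    have h3 : koszulHead L (m + 1) z = koszulHead L (m + 1) ((resDiff δ (m + 1)).lTensor _ y) +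
        1 ⊗ₜ resDiff δ (m + 1) (1 ⊹ x) := by
      rw [koszulHead_resDiff, ← LinearMap.lTensor_tmul, ← map_add, ← hyx, map_sub,
        lTensor_resDiff_resDiff, sub_zero, hE]
    have h4 := congrArg (augTensor _) h3
    rw [map_add, augTensor_koszulHead, augTensor_koszulHead, zero_add, augTensor_tmul, map_one,
      one_smul] at h4
    rw [← h4, TensorProduct.tmul_zero, add_zero] at h3
    exact ⟨y, by rw [map_sub, h3, sub_self]⟩

theorem exists_eq_hochschildB {m : ℕ} {c : ⨂[ℂ]^(m + 1) L.Enveloping}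
    (hc : δ.mpi.hochschildB (m + 1) c = 0) (hP : wedgeAll L (m + 1) (1 ⊗ₜ c) = 0) :
    ∃ x, c = δ.mpi.hochschildB m x := by
  obtain ⟨s, hs⟩ := exists_koszulHead_sub_eq_zero δ (z := 1 ⊗ₜ c) (by
    rw [← koszulHead_resDiff, LinearMap.lTensor_tmul, resDiff_apply, hc, sub_zero,
      koszulHead_one_cons]) hP
  obtain ⟨y, x, hyx⟩ := exists_of_koszulHead_eq_zero L hs
  have h := congrArg (augTensor _) hyx
  rw [map_sub, map_add, augTensor_koszulHead, zero_add, augTensor_lTensor, augTensor_tmul,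
    augTensor_tmul, map_one, one_smul, one_smul, sub_eq_iff_eq_add, resDiff_apply] at h
  set y₀ := augTensor (⨂[ℂ]^m L.Enveloping) s
  have h2 : c = (1 ⊹ (x + y₀)) - δ.mpi.hochschildB m y₀ := by
    rw [h, cons_add]
    abel
  have h3 := congrArg (counitHead L _) (congrArg (δ.mpi.hochschildB _) h2)
  rw [hc, map_sub, Character.hochschildB_hochschildB, sub_zero, hochschildB_one_cons,
    counitHead_cons, map_zero, map_one, one_smul, resDiff_apply, eq_comm, sub_eq_zero] at h3
  exact ⟨x + y₀ - y₀, by rw [h2, h3, map_sub]⟩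

theorem eq_zero_of_antisymmetrization_eq_zero {n : ℕ} {w : SuperExterior 𝒢} (hw : w ∈ power 𝒢 n)
    (h : antisymmetrization L n w = 0) : w = 0 := by
  have h2 := wedgeAll_antisymmetrization L 1 hw
  rw [h, TensorProduct.tmul_zero, map_zero, mul_one] at h2
  rw [← reversal_reversal 𝒢 w, ← h2, map_zero]

theorem eq_zero_of_antisymmetrization_eq_hochschildB {n : ℕ} {w : SuperExterior 𝒢}
    (hw : w ∈ power 𝒢 (n + 1)) {x : ⨂[ℂ]^n L.Enveloping}
    (h : antisymmetrization L (n + 1) w = δ.mpi.hochschildB n x) : w = 0 := by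
  have h2 := wedgeAll_antisymmetrization L 1 hw
  rw [h, wedgeAll_hochschildB, mul_one] at h2
  rw [← reversal_reversal 𝒢 w, ← h2, map_zero]

variable (L) in
theorem exists_wedgeAll_sub_eq_zero {n : ℕ} (c : ⨂[ℂ]^n L.Enveloping) :
    ∃ w ∈ power 𝒢 n, wedgeAll L n (1 ⊗ₜ (c - antisymmetrization L n w)) = 0 := by
  have h := wedgeAll_mem L (k := 0) (w := 1) (by
    rw [power_zero]; exact Submodule.one_le.1 le_rfl) c
  rw [zero_add] at h
  refine ⟨_, reversal_mem 𝒢 h, ?_⟩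
  rw [TensorProduct.tmul_sub, map_sub, wedgeAll_antisymmetrization L 1 (reversal_mem 𝒢 h),
    reversal_reversal, mul_one, sub_self]

variable (L) in
theorem exists_eq_antisymmetrization_zero (c : ⨂[ℂ]^0 L.Enveloping) :
    ∃ w ∈ power 𝒢 0, c = antisymmetrization L 0 w := by
  obtain ⟨w, hw, h⟩ := exists_wedgeAll_sub_eq_zero L c
  refine ⟨w, hw, ?_⟩
  rw [wedgeAll_zero_tmul, Algebra.smul_def, mul_one] at h
  have h2 := congrArg (augmentation 𝒢) h
  rw [AlgHom.commutes, map_zero] at h2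
  exact sub_eq_zero.1 ((LinearEquiv.map_eq_zero_iff _).1 h2)

/-- The antisymmetrization map is onto in Hochschild cohomology. -/
theorem exists_eq_antisymmetrization_add {n : ℕ} {c : ⨂[ℂ]^(n + 1) L.Enveloping}
    (hc : δ.mpi.hochschildB (n + 1) c = 0) :
    ∃ w ∈ power 𝒢 (n + 1), ∃ x, c = antisymmetrization L (n + 1) w + δ.mpi.hochschildB n x := by
  obtain ⟨w, hw, h⟩ := exists_wedgeAll_sub_eq_zero L c
  obtain ⟨x, hx⟩ := exists_eq_hochschildB δ (c := c - antisymmetrization L (n + 1) w)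
    (by rw [map_sub, hc, Character.hochschildB_antisymmetrization, sub_self]) h
  exact ⟨w, hw, x, by rw [← hx]; abel⟩

end Cobar

/-! ### The Chevalley–Eilenberg complex -/

namespace Character

variable {L} (δ : L.Character)

theorem bracketWedge_coderiv_mem {n : ℕ} {w : SuperExterior 𝒢} (hw : w ∈ power 𝒢 (n + 1)) :
    bracketCoder L w ∈ power 𝒢 n := by
  have h : ∀ k, Submodule.map₂ (TensorProduct.mk ℂ 𝔤 (SuperExterior 𝒢)) ⊤ (power 𝒢 k) ≤
      (power 𝒢 k).comap (bracketWedge L ∘ₗ (coderiv 𝒢).lTensor 𝔤) := by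
    intro k
    rw [Submodule.map₂_le]
    intro x _ w hw
    rw [Submodule.mem_comap, TensorProduct.mk_apply, LinearMap.comp_apply, LinearMap.lTensor_tmul]
    rcases k with _ | k
    · rw [coderiv_eq_zero 𝒢 hw, TensorProduct.tmul_zero, map_zero]
      exact Submodule.zero_mem _
    · have h2 : Submodule.map₂ (TensorProduct.mk ℂ 𝔤 (SuperExterior 𝒢)) ⊤ (power 𝒢 k) ≤
          (power 𝒢 (k + 1)).comap (bracketWedge L ∘ₗ TensorProduct.mk ℂ _ _ x) := by
        rw [Submodule.map₂_le]
        intro y _ v hv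
        rw [Submodule.mem_comap, LinearMap.comp_apply, TensorProduct.mk_apply,
          TensorProduct.mk_apply, bracketWedge_tmul]
        exact ι_mul_mem_power 𝒢 _ hv
      exact h2 (coderiv_mem 𝒢 hw)
  exact h n (coderiv_mem 𝒢 hw)

theorem ceDifferential_mem {n : ℕ} {w : SuperExterior 𝒢} (hw : w ∈ power 𝒢 (n + 1)) :
    δ.ceDifferential w ∈ power 𝒢 n := by
  refine Submodule.sub_mem _ ?_ (Submodule.smul_mem _ _ (bracketWedge_coderiv_mem hw))
  have h : Submodule.map₂ (TensorProduct.mk ℂ 𝔤 (SuperExterior 𝒢)) ⊤ (power 𝒢 n) ≤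
      (power 𝒢 n).comap ((TensorProduct.lid ℂ (SuperExterior 𝒢)).toLinearMap ∘ₗ
        δ.toLinearMap.rTensor (SuperExterior 𝒢)) := by
    rw [Submodule.map₂_le]
    intro x _ v hv
    simpa using Submodule.smul_mem _ (δ.toLinearMap x) hv
  exact h (coderiv_mem 𝒢 hw)

theorem ceDifferential_eq_zero {w : SuperExterior 𝒢} (hw : w ∈ power 𝒢 0) :
    δ.ceDifferential w = 0 := by
  rw [power_zero, Submodule.mem_one] at hw
  obtain ⟨r, rfl⟩ := hw
  rw [Algebra.algebraMap_eq_smul_one, map_smul, ceDifferential_one, smul_zero]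

theorem ceDifferential_ceDifferential (w : SuperExterior 𝒢) :
    δ.ceDifferential (δ.ceDifferential w) = 0 := by
  refine Submodule.iSup_induction _ (motive := fun w => δ.ceDifferential (δ.ceDifferential w) = 0)
    (mem_iSup_power 𝒢 w) (fun n w hw => ?_) (by simp) fun v w hv hw => by
      rw [map_add, map_add, hv, hw, add_zero]
  rcases n with _ | _ | n
  · rw [δ.ceDifferential_eq_zero hw, map_zero]
  · exact δ.ceDifferential_eq_zero (δ.ceDifferential_mem hw)
  · refine eq_zero_of_antisymmetrization_eq_zero (L := L)
      (δ.ceDifferential_mem (δ.ceDifferential_mem hw)) ?_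
    rw [← connesB_antisymmetrization, ← connesB_antisymmetrization, connesB_connesB]

end Character

end SuperLieAlgebra

/-! ### Periodic cyclic cohomology -/

namespace SuperMPI

variable {H : Type u} [Ring H] [Algebra ℂ H]

/-- A cochain that is concentrated in degree `n`. -/
abbrev single (H : Type u) [Ring H] [Algebra ℂ H] (n : ℕ) : (⨂[ℂ]^n H) →ₗ[ℂ] Cochains H :=
  DirectSum.lof ℂ ℕ (fun k => ⨂[ℂ]^k H) n

theorem single_apply_self (n : ℕ) (c : ⨂[ℂ]^n H) : single H n c n = c :=
  DirectSum.lof_apply (M := fun k => ⨂[ℂ]^k H) ℂ n c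

theorem single_apply_of_ne {m n : ℕ} (h : m ≠ n) (c : ⨂[ℂ]^m H) : single H m c n = 0 :=
  DirectSum.of_eq_of_ne (β := fun k => ⨂[ℂ]^k H) m n c h.symm

theorem mem_parityPart {p : ZMod 2} {c : Cochains H} :
    c ∈ parityPart H p ↔ ∀ n : ℕ, (n : ZMod 2) ≠ p → c n = 0 := by
  simp only [parityPart, Submodule.mem_iInf, LinearMap.mem_ker]
  rfl

theorem single_mem_parityPart {p : ZMod 2} {n : ℕ} (hn : (n : ZMod 2) = p) (c : ⨂[ℂ]^n H) :
    single H n c ∈ parityPart H p :=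
  mem_parityPart.2 fun m hm => single_apply_of_ne (by rintro rfl; exact hm hn) c

theorem exists_bound (c : Cochains H) : ∃ N, ∀ n, N ≤ n → c n = 0 := by
  induction c using DirectSum.induction_on with
  | zero => exact ⟨0, fun n _ => rfl⟩
  | of m x => exact ⟨m + 1, fun n hn => single_apply_of_ne (by omega) x⟩
  | add c d hc hd =>
    obtain ⟨M, hM⟩ := hc
    obtain ⟨N, hN⟩ := hd
    exact ⟨max M N, fun n hn => by
      rw [DirectSum.add_apply, hM n (le_of_max_le_left hn), hN n (le_of_max_le_right hn),
        add_zero]⟩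

end SuperMPI

namespace SuperLieAlgebra

open SuperExterior Enveloping SuperMPI

variable {𝔤 : Type u} [AddCommGroup 𝔤] [Module ℂ 𝔤] {𝒢 : ZMod 2 → Submodule ℂ 𝔤}
  [DirectSum.Decomposition 𝒢] {L : SuperLieAlgebra 𝒢} (δ : L.Character)

namespace Character

theorem totalDifferential_apply_zero (c : Cochains L.Enveloping) :
    δ.mpi.totalDifferential c 0 = δ.mpi.connesB 0 (c 1) := by
  refine LinearMap.congr_fun
    (f := DirectSum.component ℂ ℕ (fun k => ⨂[ℂ]^k L.Enveloping) 0 ∘ₗ δ.mpi.totalDifferential)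
    (g := δ.mpi.connesB 0 ∘ₗ DirectSum.component ℂ ℕ (fun k => ⨂[ℂ]^k L.Enveloping) 1)
    (DirectSum.linearMap_ext _ fun m => LinearMap.ext fun x => ?_) c
  change δ.mpi.totalDifferential (single L.Enveloping m x) 0 =
    δ.mpi.connesB 0 (single L.Enveloping m x 1)
  rcases m with _ | _ | m
  · rw [totalDifferential_lof_zero, single_apply_of_ne (by omega), map_zero]
    rfl
  · rw [totalDifferential_lof_succ, DirectSum.add_apply, single_apply_of_ne (by omega), zero_add,
      single_apply_self, single_apply_self]
  · rw [totalDifferential_lof_succ, DirectSum.add_apply, single_apply_of_ne (by omega), zero_add,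
      single_apply_of_ne (by omega), single_apply_of_ne (by omega), map_zero]

theorem totalDifferential_apply_succ (c : Cochains L.Enveloping) (n : ℕ) :
    δ.mpi.totalDifferential c (n + 1) =
      δ.mpi.hochschildB n (c n) + δ.mpi.connesB (n + 1) (c (n + 2)) := by
  induction c using DirectSum.induction_on with
  | zero =>
    simp only [map_zero, DirectSum.zero_apply, add_zero]
  | add c d hc hd =>
    simp only [map_add, DirectSum.add_apply, hc, hd]
    abel
  | of m x =>
    change δ.mpi.totalDifferential (single L.Enveloping m x) (n + 1) =
      δ.mpi.hochschildB n (single L.Enveloping m x n) +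
        δ.mpi.connesB (n + 1) (single L.Enveloping m x (n + 2))
    rcases m with _ | m
    · rw [totalDifferential_lof_zero, single_apply_of_ne (n := n + 2) (by omega), map_zero,
        add_zero]
      rcases n with _ | n
      · rw [single_apply_self, hochschildB_zero]
        rfl
      · rw [single_apply_of_ne (by omega), map_zero]
        rfl
    · rw [totalDifferential_lof_succ, DirectSum.add_apply]
      congr 1
      · rcases eq_or_ne (m + 1) n with rfl | h
        · rw [single_apply_self, single_apply_self]
        · rw [single_apply_of_ne (by omega), single_apply_of_ne h, map_zero]
      · rcases eq_or_ne m (n + 1) with rfl | h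
        · rw [single_apply_self, single_apply_self]
        · rw [single_apply_of_ne h, single_apply_of_ne (by omega), map_zero]

theorem totalDifferential_mem {p : ZMod 2} {c : Cochains L.Enveloping}
    (hc : c ∈ parityPart L.Enveloping (p + 1)) :
    δ.mpi.totalDifferential c ∈ parityPart L.Enveloping p := by
  rw [mem_parityPart] at hc ⊢
  have h2 : (2 : ZMod 2) = 0 := rfl
  intro n hn
  rcases n with _ | n
  · rw [totalDifferential_apply_zero, hc 1 fun h =>
      hn (Nat.cast_zero.trans (show p = 0 by simpa using h).symm), map_zero]
  · have h : (n : ZMod 2) ≠ p + 1 := fun h => hn (by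
      push_cast
      rw [h, add_assoc, one_add_one_eq_two, h2, add_zero])
    rw [totalDifferential_apply_succ, hc n h, hc (n + 2) (by push_cast; rwa [h2, add_zero]),
      map_zero, map_zero, add_zero]

theorem totalDifferential_antisymmetrization {c : Cochains L.Enveloping}
    {v : ℕ → SuperExterior 𝒢} (h : ∀ k, c k = antisymmetrization L k (v k)) (n : ℕ) :
    δ.mpi.totalDifferential c n = antisymmetrization L n (δ.ceDifferential (v (n + 1))) := by
  rcases n with _ | n
  · rw [totalDifferential_apply_zero, h, connesB_antisymmetrization]
  · rw [totalDifferential_apply_succ, h, h, hochschildB_antisymmetrization,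
      connesB_antisymmetrization, zero_add]

theorem single_antisymmetrization_apply (N : ℕ) (w : SuperExterior 𝒢) (k : ℕ) :
    single L.Enveloping N (antisymmetrization L N w) k =
      antisymmetrization L k (if k = N then w else 0) := by
  split_ifs with h
  · subst h
    exact single_apply_self _ _
  · rw [single_apply_of_ne (Ne.symm h), map_zero]

theorem ite_mem_power {N : ℕ} {w : SuperExterior 𝒢} (hw : w ∈ power 𝒢 N) (k : ℕ) :
    (if k = N then w else 0) ∈ power 𝒢 k := by
  split_ifs with h
  · exact h ▸ hw
  · exact Submodule.zero_mem _

/-- A cochain whose top component is a Hochschild cocycle is, modulo coboundaries of lower cochains,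
equal to the antisymmetrization of an exterior power in its top degree. -/
theorem exists_top {N : ℕ} {c : Cochains L.Enveloping} (hc : ∀ n, N + 1 ≤ n → c n = 0)
    (hN : δ.mpi.hochschildB N (c N) = 0) :
    ∃ w ∈ power 𝒢 N, ∃ y : Cochains L.Enveloping,
      (∀ p : ZMod 2, (N : ZMod 2) = p → y ∈ parityPart L.Enveloping (p + 1)) ∧
      ∀ n, N ≤ n → (c - single L.Enveloping N (antisymmetrization L N w) -
        δ.mpi.totalDifferential y) n = 0 := by
  rcases N with _ | N
  · obtain ⟨w, hw, h⟩ := exists_eq_antisymmetrization_zero L (c 0)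
    refine ⟨w, hw, 0, fun p _ => Submodule.zero_mem _, fun n _ => ?_⟩
    rw [map_zero, sub_zero, DirectSum.sub_apply]
    rcases n with _ | n
    · rw [single_apply_self, ← h, sub_self]
    · rw [hc _ (by omega), single_apply_of_ne (by omega), sub_zero]
  · obtain ⟨w, hw, x, h⟩ := exists_eq_antisymmetrization_add δ hN
    refine ⟨w, hw, single L.Enveloping N x, fun p hp => single_mem_parityPart ?_ x, fun n hn => ?_⟩
    · rw [← hp]
      push_cast
      rw [add_assoc, one_add_one_eq_two, show (2 : ZMod 2) = 0 from rfl, add_zero]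
    · obtain ⟨n, rfl⟩ : ∃ k, n = k + 1 := ⟨n - 1, by omega⟩
      rw [DirectSum.sub_apply, DirectSum.sub_apply, totalDifferential_apply_succ,
        single_apply_of_ne (m := N) (n := n + 2) (by omega), map_zero, add_zero]
      rcases eq_or_ne n N with rfl | hne
      · rw [single_apply_self, single_apply_self, h]
        abel
      · rw [hc _ (by omega), single_apply_of_ne (by omega), single_apply_of_ne (by omega), map_zero,
          sub_zero, sub_zero]

/-- If the antisymmetrization of a family of cycles is a coboundary, then so is the family. -/
theorem exists_eq_ceDifferential (N : ℕ) (y : Cochains L.Enveloping)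
    (hy : ∀ n, N ≤ n → y n = 0) (z : ℕ → SuperExterior 𝒢) (hz : ∀ n, z n ∈ power 𝒢 n)
    (h : ∀ n, antisymmetrization L n (z n) = δ.mpi.totalDifferential y n) :
    ∃ w : ℕ → SuperExterior 𝒢, (∀ n, w n ∈ power 𝒢 n) ∧
      ∀ n, z n = δ.ceDifferential (w (n + 1)) := by
  induction N generalizing y z with
  | zero =>
    obtain rfl : y = 0 := DFinsupp.ext fun n => hy n (Nat.zero_le n)
    refine ⟨0, fun n => Submodule.zero_mem _, fun n => ?_⟩
    rw [Pi.zero_apply, map_zero]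
    exact eq_zero_of_antisymmetrization_eq_zero (hz n) (by rw [h, map_zero]; rfl)
  | succ N ih =>
    have h1 := h (N + 1)
    rw [totalDifferential_apply_succ, hy (N + 2) (by omega), map_zero, add_zero] at h1
    rw [eq_zero_of_antisymmetrization_eq_hochschildB δ (hz _) h1, map_zero] at h1
    obtain ⟨v, hv, x, _, hx⟩ := exists_top δ hy h1.symm
    obtain ⟨w, hw, hwz⟩ := ih _ hx
      (fun n => z n - δ.ceDifferential (if n + 1 = N then v else 0))
      (fun n => Submodule.sub_mem _ (hz n) (δ.ceDifferential_mem (ite_mem_power hv (n + 1))))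
      (fun n => by
        rw [map_sub, map_sub, δ.totalDifferential_totalDifferential, sub_zero, map_sub,
          DirectSum.sub_apply, ← h, δ.totalDifferential_antisymmetrization
            (v := fun k => if k = N then v else 0) (single_antisymmetrization_apply N v)])
    refine ⟨fun n => w n + if n = N then v else 0, fun n =>
      Submodule.add_mem _ (hw n) (ite_mem_power hv n), fun n => ?_⟩
    rw [map_add, ← hwz, sub_add_cancel]

theorem single_antisymmetrization_mem {p : ZMod 2} {i : ℕ} (hi : (i : ZMod 2) = p)
    {z : SuperExterior 𝒢} (hz : δ.ceDifferential z = 0) :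
    single L.Enveloping i (antisymmetrization L i z) ∈ δ.mpi.periodicCocycles p := by
  refine ⟨DFinsupp.ext fun n => ?_, single_mem_parityPart hi _⟩
  rw [δ.totalDifferential_antisymmetrization (single_antisymmetrization_apply i z)]
  split_ifs
  · rw [hz, map_zero]
    rfl
  · rw [map_zero, map_zero]
    rfl

/-- The antisymmetrization of cycles. -/
def cyclesMap (p : ZMod 2) (i : {i : ℕ // (i : ZMod 2) = p}) :
    δ.cycles i →ₗ[ℂ] δ.mpi.periodicCocycles p :=
  LinearMap.codRestrict _
    (single L.Enveloping i.1 ∘ₗ antisymmetrization L i ∘ₗ (δ.cycles i).subtype)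
    fun z => δ.single_antisymmetrization_mem i.2 z.2.1

/-- The map `H_i(𝔤; ℂ_δ) → HP^p_{(δ,1)}(U(𝔤))`, `i ≡ p`, induced by antisymmetrization. -/
def homologyMap (p : ZMod 2) (i : {i : ℕ // (i : ZMod 2) = p}) :
    δ.Homology i →ₗ[ℂ] δ.mpi.HP p :=
  Submodule.liftQ _ (Submodule.mkQ _ ∘ₗ δ.cyclesMap p i) (by
    rintro z hz
    obtain ⟨w, hw, hwz⟩ := hz
    rw [LinearMap.mem_ker, LinearMap.comp_apply, Submodule.mkQ_apply, Submodule.Quotient.mk_eq_zero]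
    refine ⟨single L.Enveloping (i.1 + 1) (antisymmetrization L (i.1 + 1) w),
      single_mem_parityPart (by
      push_cast
      rw [i.2]) _, ?_⟩
    rw [totalDifferential_lof_succ, δ.hochschildB_antisymmetrization,
      δ.connesB_antisymmetrization, hwz, map_zero, zero_add]
    rfl)

theorem homologyMap_mk (p : ZMod 2) (i : {i : ℕ // (i : ZMod 2) = p}) (z : δ.cycles i) :
    δ.homologyMap p i (Submodule.Quotient.mk z) = Submodule.Quotient.mk (δ.cyclesMap p i z) := rfl

/-- The map `⨁ H_i(𝔤; ℂ_δ) → HP^p_{(δ,1)}(U(𝔤))`, `i ≡ p`, induced by antisymmetrization. -/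
def totalHomologyMap (p : ZMod 2) :
    (⨁ i : {i : ℕ // (i : ZMod 2) = p}, δ.Homology i) →ₗ[ℂ] δ.mpi.HP p :=
  DirectSum.toModule ℂ _ _ (δ.homologyMap p)

theorem totalHomologyMap_lof (p : ZMod 2) (i : {i : ℕ // (i : ZMod 2) = p}) (z : δ.cycles i) :
    δ.totalHomologyMap p (DirectSum.lof ℂ _ (fun i : {i : ℕ // (i : ZMod 2) = p} => δ.Homology i) i
      (Submodule.Quotient.mk z)) = Submodule.Quotient.mk (δ.cyclesMap p i z) := by
  rw [totalHomologyMap, DirectSum.toModule_lof, homologyMap_mk]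

theorem exists_representative (p : ZMod 2)
    (h : ⨁ i : {i : ℕ // (i : ZMod 2) = p}, δ.Homology i) :
    ∃ (ζ : ∀ i : {i : ℕ // (i : ZMod 2) = p}, δ.cycles i) (c : δ.mpi.periodicCocycles p),
      (∀ i, Submodule.Quotient.mk (ζ i) = h i) ∧
      δ.totalHomologyMap p h = Submodule.Quotient.mk c ∧
      ∀ i : {i : ℕ // (i : ZMod 2) = p},
        c.1 i.1 = antisymmetrization L i.1 (ζ i : SuperExterior 𝒢) := by
  classical
  induction h using DirectSum.induction_on with
  | zero => exact ⟨0, 0, fun i => rfl, by rw [map_zero]; rfl, fun i => by simp⟩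
  | add h h' ih ih' =>
    obtain ⟨ζ, c, h1, h2, h3⟩ := ih
    obtain ⟨ζ', c', h1', h2', h3'⟩ := ih'
    refine ⟨ζ + ζ', c + c', fun i => ?_, ?_, fun i => ?_⟩
    · rw [Pi.add_apply, Submodule.Quotient.mk_add, h1, h1', DirectSum.add_apply]
    · rw [map_add, h2, h2', Submodule.Quotient.mk_add]
    · rw [Submodule.coe_add, DirectSum.add_apply, h3, h3', Pi.add_apply, Submodule.coe_add, map_add]
  | of i x =>
    obtain ⟨z, rfl⟩ := Submodule.Quotient.mk_surjective _ x
    refine ⟨Pi.single i z, δ.cyclesMap p i z, fun j => ?_, δ.totalHomologyMap_lof p i z,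
      fun j => ?_⟩
    · rcases eq_or_ne j i with rfl | hj
      · rw [Pi.single_eq_same, DirectSum.of_eq_same]
      · rw [Pi.single_eq_of_ne hj, DirectSum.of_eq_of_ne _ _ _ hj]
        rfl
    · change single L.Enveloping i.1 (antisymmetrization L i (z : SuperExterior 𝒢)) j.1 = _
      rcases eq_or_ne j i with rfl | hj
      · rw [Pi.single_eq_same, single_apply_self]
      · rw [Pi.single_eq_of_ne hj, single_apply_of_ne (fun h => hj (Subtype.ext h.symm)),
          Submodule.coe_zero, map_zero]

theorem totalHomologyMap_injective (p : ZMod 2) : Function.Injective (δ.totalHomologyMap p) := by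
  intro h h' hh
  obtain ⟨ζ, c, h1, h2, h3⟩ := δ.exists_representative p h
  obtain ⟨ζ', c', h1', h2', h3'⟩ := δ.exists_representative p h'
  rw [h2, h2', Submodule.Quotient.eq] at hh
  obtain ⟨y, hy, hyc⟩ := hh
  obtain ⟨N, hN⟩ := exists_bound y
  have hyc' : δ.mpi.totalDifferential y = c.1 - c'.1 := hyc
  obtain ⟨w, hw, hwz⟩ := δ.exists_eq_ceDifferential N y hN
    (fun n => if hn : (n : ZMod 2) = p then
      (ζ ⟨n, hn⟩ : SuperExterior 𝒢) - (ζ' ⟨n, hn⟩ : SuperExterior 𝒢) else 0)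
    (fun n => by
      split_ifs with hn
      · exact Submodule.sub_mem _ (ζ ⟨n, hn⟩).2.2 (ζ' ⟨n, hn⟩).2.2
      · exact Submodule.zero_mem _)
    (fun n => by
      rw [hyc', DirectSum.sub_apply]
      split_ifs with hn
      · rw [map_sub, ← h3 ⟨n, hn⟩, ← h3' ⟨n, hn⟩]
      · rw [map_zero, mem_parityPart.1 c.2.2 n hn, mem_parityPart.1 c'.2.2 n hn, sub_zero])
  refine DFinsupp.ext fun i => ?_
  have h4 := hwz i.1
  simp only [dif_pos i.2] at h4
  refine (h1 i).symm.trans (Eq.trans ?_ (h1' i))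
  rw [Submodule.Quotient.eq]
  exact ⟨w (i.1 + 1), hw _, h4.symm⟩

theorem ceDifferential_eq_zero_of_neg {N : ℕ} {w : SuperExterior 𝒢} (hw : w ∈ power 𝒢 N)
    {c : Cochains L.Enveloping} (hc : ∀ n, N ≤ n → c n = 0)
    (h : ∀ n, antisymmetrization L n (δ.ceDifferential (if n + 1 = N then w else 0)) =
      -δ.mpi.totalDifferential c n) : δ.ceDifferential w = 0 := by
  rcases N with _ | _ | N
  · exact δ.ceDifferential_eq_zero hw
  · have h1 := h 0
    have h2 : δ.mpi.connesB 0 (c 1) = 0 := (congrArg _ (hc 1 (by omega))).trans (map_zero _)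
    rw [if_pos rfl, totalDifferential_apply_zero, h2, neg_zero] at h1
    exact eq_zero_of_antisymmetrization_eq_zero (δ.ceDifferential_mem hw) h1
  · have h1 := h (N + 1)
    have h2 : δ.mpi.connesB (N + 1) (c (N + 2)) = 0 :=
      (congrArg _ (hc (N + 2) (by omega))).trans (map_zero _)
    rw [if_pos rfl, totalDifferential_apply_succ, h2, add_zero, ← map_neg] at h1
    exact eq_zero_of_antisymmetrization_eq_hochschildB δ (δ.ceDifferential_mem hw) h1

theorem exists_totalHomologyMap_eq (p : ZMod 2) (N : ℕ) (c : Cochains L.Enveloping)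
    (hc : c ∈ δ.mpi.periodicCocycles p) (hN : ∀ n, N ≤ n → c n = 0) :
    ∃ h, δ.totalHomologyMap p h = Submodule.Quotient.mk ⟨c, hc⟩ := by
  induction N generalizing c with
  | zero =>
    obtain rfl : c = 0 := DFinsupp.ext fun n => hN n (Nat.zero_le n)
    exact ⟨0, by rw [map_zero]; rfl⟩
  | succ N ih =>
    by_cases hp : (N : ZMod 2) = p
    · have h1 : δ.mpi.totalDifferential c (N + 1) = 0 := by
        rw [show δ.mpi.totalDifferential c = 0 from hc.1]
        rfl
      rw [totalDifferential_apply_succ, hN (N + 2) (by omega), map_zero, add_zero] at h1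
      obtain ⟨w, hw, y, hy, hx⟩ := δ.exists_top hN h1
      have hy' := hy p hp
      set c' := c - single L.Enveloping N (antisymmetrization L N w) -
        δ.mpi.totalDifferential y with hc'
      have hD : ∀ n, antisymmetrization L n (δ.ceDifferential (if n + 1 = N then w else 0)) =
          -δ.mpi.totalDifferential c' n := by
        intro n
        rw [hc', map_sub, map_sub, δ.totalDifferential_totalDifferential,
          show δ.mpi.totalDifferential c = 0 from hc.1, sub_zero, DirectSum.sub_apply,
          DirectSum.zero_apply, zero_sub, neg_neg, δ.totalDifferential_antisymmetrization
            (v := fun k => if k = N then w else 0) (single_antisymmetrization_apply N w)]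
      have hdw : δ.ceDifferential w = 0 := δ.ceDifferential_eq_zero_of_neg hw hx hD
      have hs := δ.single_antisymmetrization_mem hp hdw
      have hb : δ.mpi.totalDifferential y ∈ δ.mpi.periodicCocycles p :=
        ⟨δ.totalDifferential_totalDifferential y, δ.totalDifferential_mem hy'⟩
      have hc'' : c' ∈ δ.mpi.periodicCocycles p :=
        Submodule.sub_mem _ (Submodule.sub_mem _ hc hs) hb
      obtain ⟨h, hh⟩ := ih c' hc'' hx
      refine ⟨h + DirectSum.lof ℂ _ (fun i : {i : ℕ // (i : ZMod 2) = p} => δ.Homology i) ⟨N, hp⟩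
        (Submodule.Quotient.mk ⟨w, hdw, hw⟩), ?_⟩
      rw [map_add, hh, totalHomologyMap_lof, ← Submodule.Quotient.mk_add, Submodule.Quotient.eq]
      refine ⟨-y, Submodule.neg_mem _ hy', ?_⟩
      change δ.mpi.totalDifferential (-y) =
        c' + single L.Enveloping N (antisymmetrization L N w) - c
      rw [map_neg, hc']
      abel
    · refine ih c hc fun n hn => ?_
      rcases eq_or_lt_of_le hn with rfl | hn
      · exact mem_parityPart.1 hc.2 _ hp
      · exact hN n hn

theorem totalHomologyMap_surjective (p : ZMod 2) :
    Function.Surjective (δ.totalHomologyMap p) := by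
  intro q
  obtain ⟨⟨c, hc⟩, rfl⟩ := Submodule.Quotient.mk_surjective _ q
  obtain ⟨N, hN⟩ := exists_bound c
  exact δ.exists_totalHomologyMap_eq p N c hc hN

end Character

end SuperLieAlgebra

end SuperHopf

end

/-- Let `𝔤 = 𝒢 0 ⊕ 𝒢 1` be a complex super Lie algebra with a character `δ`, let `d` be the
Chevalley–Eilenberg differential of `⋀ 𝔤` with coefficients in `ℂ_δ`, and let `b`, `B` be the
operators on `⨁ₙ U(𝔤)^{⊗ n}` that belong to the modular pair in involution `(δ, 1)`.  Then
`d² = 0`, `(b + B)² = 0`, `b A = 0` and `B A = A d` for the antisymmetrization map `A`, and `A`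
induces isomorphisms `⨁_{i ≡ p mod 2} H_i(𝔤; ℂ_δ) ≅ HP^p_{(δ,1)}(U(𝔤))`. -/
theorem mainTheorem7 {𝔤 : Type*} [AddCommGroup 𝔤] [Module ℂ 𝔤] (𝒢 : ZMod 2 → Submodule ℂ 𝔤)
    [DirectSum.Decomposition 𝒢] (L : SuperHopf.SuperLieAlgebra 𝒢) (δ : L.Character) :
    (∀ w, δ.ceDifferential (δ.ceDifferential w) = 0) ∧
    (∀ c, δ.mpi.totalDifferential (δ.mpi.totalDifferential c) = 0) ∧
    (∀ n w, δ.mpi.hochschildB n (L.antisymmetrization n w) = 0) ∧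
    (∀ n w, δ.mpi.connesB n (L.antisymmetrization (n + 1) w) =
      L.antisymmetrization n (δ.ceDifferential w)) ∧
    ∀ p : ZMod 2, ∃ e : (⨁ i : {i : ℕ // (i : ZMod 2) = p}, δ.Homology i) ≃ₗ[ℂ] δ.mpi.HP p,
      ∀ (i : {i : ℕ // (i : ZMod 2) = p}) (z : δ.cycles i),
        ∃ h : DirectSum.lof ℂ ℕ (fun n => ⨂[ℂ]^n L.Enveloping) i
            (L.antisymmetrization i (z : SuperHopf.SuperExterior 𝒢)) ∈ δ.mpi.periodicCocycles p,
          e (DirectSum.lof ℂ _ (fun i : {i : ℕ // (i : ZMod 2) = p} => δ.Homology i) i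
            (Submodule.Quotient.mk z)) = Submodule.Quotient.mk ⟨_, h⟩ := by
  refine ⟨δ.ceDifferential_ceDifferential, δ.totalDifferential_totalDifferential,
    δ.hochschildB_antisymmetrization, δ.connesB_antisymmetrization, fun p => ?_⟩
  refine ⟨LinearEquiv.ofBijective (δ.totalHomologyMap p)
    ⟨δ.totalHomologyMap_injective p, δ.totalHomologyMap_surjective p⟩, fun i z => ?_⟩
  exact ⟨δ.single_antisymmetrization_mem i.2 z.2.1, δ.totalHomologyMap_lof p i z⟩
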